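/- Let $\mathbb N=\{1,2,3,\dots\}$, and for $n\in\mathbb N$ let $X_n=\{1,\dots,n\}\times\mathbb N$; the set $\{i\}\times\mathbb N$ is the $i$-th ray. Permutations act on the right. The Houghton group $H_n\le \mathrm{Sym}(X_n)$ consists of all $g\in\mathrm{Sym}(X_n)$ for which there are $z_1,\dots,z_n\in\mathbb N$ and $t_1,\dots,t_n\in\mathbb Z$ with $(i,m)g=(i,m+t_i)$ for all $i$ and all $m\ge z_i$. The symmetric group $S_n$ acts on $X_n$ by $(i,m)\sigma=(i\sigma,m)$, and $H_n\rtimes S_n\le\mathrm{Sym}(X_n)$ is the subgroup generated by $H_n$ and these permutations. For $2\le i\le n$ let $g_i\in H_n$ be given by $(1,m)g_i=(1,m+1)$, $(i,1)g_i=(1,1)$, $(i,m)g_i=(i,m-1)$ for $m>1$, and $(j,m)g_i=(j,m)$ for $j\ne 1,i$. For $n\ge2$, elements of $H_n\rtimes S_n$ are given as words in the following generators and their inverses: $g_2$, the element of $S_n$ exchanging rays $1$ and $2$, and, if $n\ge 3$, the element $(1\,2\,\cdots\,n)$ of $S_n$, or, if $n=2$, the transposition of the points $(1,1)$ and $(2,1)$.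 For $n\ge 2$ and $p\in\mathbb N$ let $U_p=\langle \mathrm{FAlt}(X_n),\,g_2^p,\dots,g_n^p\rangle\le H_n$, where $\mathrm{FAlt}(X_n)$ is the group of even permutations of $X_n$ with finite support. Let $\phi:X_n\to X_{np}$ be the bijection $(i,(q-1)p+d)\mapsto((i-1)p+d,\,q)$, for $1\le i\le n$, $1\le d\le p$, $q\in\mathbb N$, and let $(U_p)\hat\phi=\{\phi^{-1}u\phi\mid u\in U_p\}\le H_{np}$. Then there is an algorithm which, given $n\ge2$, $p\in\mathbb N$, words representing elements $a,b\in H_{np}\rtimes S_{np}$, and a word representing an element $x\in H_{np}$ with $x^{-1}ax=b$, decides whether $a$ and $b$ are conjugate in $(U_p)\hat\phi$, that is, whether there exists $y\in(U_p)\hat\phi$ with $y^{-1}ay=b$. -/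

import Mathlib

open Equiv

/-- The point set `X_n`, a disjoint union of `n` rays. Rays and positions on a ray are counted
from `0`, so `(i, m)` here is the point `(i+1, m+1)` in the numbering that starts from `1`. -/
abbrev RaySpace (n : ℕ) : Type := Fin n × ℕ

/-- `g` translates the far part of every ray: there are `z_i` and `t_i` with
`(i, m) g = (i, m + t_i)` for all `m ≥ z_i`. -/
def EventuallyTranslates {n : ℕ} (g : Perm (RaySpace n)) : Prop :=
  ∃ (z : Fin n → ℕ) (t : Fin n → ℤ), ∀ (i : Fin n) (m : ℕ), z i ≤ m →
    (g (i, m)).1 = i ∧ ((g (i, m)).2 : ℤ) = (m : ℤ) + t i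

/-- The Houghton group `H_n`. -/
def houghton (n : ℕ) : Subgroup (Perm (RaySpace n)) where
  carrier := {g | EventuallyTranslates g}
  one_mem' := ⟨fun _ => 0, fun _ => 0, fun i m _ => by simp⟩
  mul_mem' := by
    rintro g h ⟨z, t, hg⟩ ⟨z', t', hh⟩
    refine ⟨fun i => z' i + z i + (t' i).natAbs, fun i => t' i + t i, fun i m hm => ?_⟩
    dsimp only at hm
    obtain ⟨h1, h2⟩ := hh i m (by omega)
    have e : h (i, m) = (i, (h (i, m)).2) := Prod.ext h1 rfl
    obtain ⟨g1, g2⟩ := hg i (h (i, m)).2 (by omega)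
    rw [Perm.mul_apply, e]
    exact ⟨g1, by rw [g2, h2]; ring⟩
  inv_mem' := by
    rintro g ⟨z, t, hg⟩
    refine ⟨fun i => z i + (t i).natAbs, fun i => -t i, fun i m hm => ?_⟩
    dsimp only at hm
    obtain ⟨k, hk⟩ : ∃ k : ℕ, (k : ℤ) = (m : ℤ) - t i :=
      ⟨((m : ℤ) - t i).toNat, by omega⟩
    obtain ⟨g1, g2⟩ := hg i k (by omega)
    have e : g (i, k) = (i, m) := Prod.ext g1 (by dsimp only; omega)
    have e' : g⁻¹ (i, m) = (i, k) := by rw [← e]; simp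
    rw [e']
    exact ⟨rfl, by dsimp only; omega⟩

/-- The permutation that translates ray `i` by `1` outwards and ray `j` by `1` inwards, the
initial point of ray `j` being sent to the initial point of ray `i`; other rays are fixed. -/
def rayShift {n : ℕ} (i j : Fin n) (hij : i ≠ j) : Perm (RaySpace n) where
  toFun x :=
    if x.1 = i then (i, x.2 + 1)
    else if x.1 = j then (if x.2 = 0 then (i, 0) else (j, x.2 - 1))
    else x
  invFun x :=
    if x.1 = i then (if x.2 = 0 then (j, 0) else (i, x.2 - 1))
    else if x.1 = j then (j, x.2 + 1)
    else x
  left_inv := by rintro ⟨k, m⟩; grind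
  right_inv := by rintro ⟨k, m⟩; grind

/-- The isometric permutation of the rays induced by `σ`: `(i, m) ↦ (i σ, m)`. -/
def rayPerm {n : ℕ} (σ : Perm (Fin n)) : Perm (RaySpace n) :=
  σ.prodCongr (Equiv.refl ℕ)

/-- The first and the second ray. -/
def ray₁ {n : ℕ} (hn : 2 ≤ n) : Fin n := ⟨0, by omega⟩
def ray₂ {n : ℕ} (hn : 2 ≤ n) : Fin n := ⟨1, by omega⟩

theorem ray₁_ne_ray₂ {n : ℕ} (hn : 2 ≤ n) : ray₁ hn ≠ ray₂ hn := by
  simp [ray₁, ray₂]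

/-- The three generators of `H_n ⋊ S_n`, which is the group of all permutations of `X_n` that
agree, far out on each ray, with a translation followed by an isometric permutation of the rays.
They are `g_2`, the isometric exchange of the first two rays, and, if `n ≥ 3`, the isometric
rotation of the rays; if `n = 2` (where the rotation is the exchange), the third generator is the
transposition of the initial points of the two rays. -/
def generator {n : ℕ} (hn : 2 ≤ n) : Fin 3 → Perm (RaySpace n)
  | 0 => rayShift (ray₁ hn) (ray₂ hn) (ray₁_ne_ray₂ hn)
  | 1 => rayPerm (Equiv.swap (ray₁ hn) (ray₂ hn))
  | 2 => if n = 2 then Equiv.swap (ray₁ hn, 0) (ray₂ hn, 0) else rayPerm (finRotate n)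

/-- Words in three letters and their inverses; `(s, false)` is the inverse of `(s, true)`. -/
abbrev GenWord : Type := List (Fin 3 × Bool)

/-- The element of `H_n ⋊ S_n` represented by a word. Permutations act on the right: the first
letter of the word is applied first. -/
def GenWord.toPerm {n : ℕ} (hn : 2 ≤ n) : GenWord → Perm (RaySpace n)
  | [] => Equiv.refl _
  | (s, true) :: w => (generator hn s).trans (GenWord.toPerm hn w)
  | (s, false) :: w => (generator hn s).symm.trans (GenWord.toPerm hn w)

/-- `x` conjugates `a` to `b`: `x⁻¹ a x = b`, where permutations act on the right. -/
def ConjugatesTo {α : Type*} (x a b : Perm α) : Prop :=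
  (x.symm.trans a).trans x = b

/-- `FAlt(α)`: the even permutations with finite support. -/
def finitaryAlternating (α : Type*) [DecidableEq α] : Set (Perm α) :=
  {g | ∃ (s : Finset α) (σ : Perm s), Perm.sign σ = 1 ∧ g = Perm.ofSubtype σ}

/-- `U_p = ⟨FAlt(X_n), g_i ^ p (i = 2, …, n)⟩ ≤ H_n`. -/
def subgroupU {n : ℕ} (hn : 2 ≤ n) (p : ℕ) : Subgroup (Perm (RaySpace n)) :=
  Subgroup.closure (finitaryAlternating (RaySpace n) ∪
    {g | ∃ (i : Fin n) (hi : ray₁ hn ≠ i), g = rayShift (ray₁ hn) i hi ^ p})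

/-- The bijection `X_n → X_{np}` that sends, in order, the points of ray `i` whose position is
congruent to `d` modulo `p` (`0 ≤ d < p`) to the points of ray `i p + d`. -/
def raySplit (n p : ℕ) (hp : 1 ≤ p) : RaySpace n ≃ RaySpace (n * p) where
  toFun x := (finProdFinEquiv (x.1, ⟨x.2 % p, Nat.mod_lt _ hp⟩), x.2 / p)
  invFun y := ((finProdFinEquiv.symm y.1).1, (finProdFinEquiv.symm y.1).2 + p * y.2)
  left_inv := by
    rintro ⟨i, m⟩
    simp [Nat.mod_add_div]
  right_inv := by
    rintro ⟨k, m⟩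
    obtain ⟨⟨i, d⟩, rfl⟩ := finProdFinEquiv.surjective k
    have hd := d.2
    simp [Nat.add_mul_mod_self_left, Nat.mod_eq_of_lt hd, Nat.add_mul_div_left _ _ hp,
      Nat.div_eq_of_lt hd]

/-- The image of `U_p` in `Sym(X_{np})` under the isomorphism `Sym(X_n) ≅ Sym(X_{np})` induced
by the bijection `raySplit`. -/
def imageU {n p : ℕ} (hn : 2 ≤ n) (hp : 1 ≤ p) : Subgroup (Perm (RaySpace (n * p))) :=
  (subgroupU hn p).map (raySplit n p hp).permCongrHom.toMonoidHom

theorem two_le_mul_of {n p : ℕ} (hn : 2 ≤ n) (hp : 1 ≤ p) : 2 ≤ n * p :=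
  le_trans hn (Nat.le_mul_of_pos_right n hp)

/-!
An element `y` lies in the image of `U_p` exactly if it is, up to a finitary permutation, a product
of the transported shifts `g_i ^ p`, where the finitary permutation must be even unless `n ≥ 3` and
`p` is odd. Up to parity, this is a condition on the translation vector of `y`: it has to be
constant on each block of `p` rays. A conjugator has the form `x * c` with `c` in the centralizer of
`a`, so the question is about the translation vectors and parities of these `c`.

If a conjugator exists, a search finds it, so one has to be able to certify that there is none.
Since squares can be used to change `c` without changing its parity, the translation vectors of the
centralizer matter only modulo twice themselves, and every class contains a vector with
entries bounded by an explicit number. For such a vector `ρ` there are three reasons why no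
conjugator in the image of `U_p` belongs to its class: `ρ` is not a translation vector of
the centralizer, which finitely witnessed conditions on `a` detect; or `ρ + tx` is not constant on
blocks modulo twice the translation vectors of the centralizer, which a linear form modulo some `d`
certifies; or parity forbids it. The last case requires that every finitary permutation commuting
with `a` is even, which means that no ray is fixed by a power of `a` and that the finite orbits of
`a` have pairwise distinct odd lengths; then one conjugator of odd parity is a certificate for the
whole class. Hence both the existence and the absence of a conjugator are recursively enumerable.
-/

theorem natAbs_le_sum {ι : Type*} [Fintype ι] (w : ι → ℤ) (i : ι) :
    (w i).natAbs ≤ ∑ i, (w i).natAbs :=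
  Finset.single_le_sum (f := fun i => (w i).natAbs) (fun _ _ => Nat.zero_le _) (Finset.mem_univ i)

/-! ### Translation vectors -/

section Translations

/-- `g` translates the far part of ray `i` by `d`. -/
def TranslatesRay {n : ℕ} (g : Perm (RaySpace n)) (i : Fin n) (d : ℤ) : Prop :=
  ∃ M : ℕ, ∀ m, M ≤ m → (g (i, m)).1 = i ∧ ((g (i, m)).2 : ℤ) = m + d

/-- `g` translates every ray `i` by `t i` from height `M` on. -/
def TranslatesFrom {n : ℕ} (M : ℕ) (g : Perm (RaySpace n)) (t : Fin n → ℤ) : Prop :=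
  ∀ i m, M ≤ m → (g (i, m)).1 = i ∧ ((g (i, m)).2 : ℤ) = m + t i

/-- `t` is the translation vector of the element `g` of the Houghton group. -/
def TranslatesBy {n : ℕ} (g : Perm (RaySpace n)) (t : Fin n → ℤ) : Prop :=
  ∃ M, TranslatesFrom M g t

variable {n M : ℕ} {g h : Perm (RaySpace n)} {t t' : Fin n → ℤ} {i : Fin n} {d d' : ℤ}

theorem TranslatesRay.unique (hg : TranslatesRay g i d) (hg' : TranslatesRay g i d') :
    d = d' := by
  obtain ⟨M, hg⟩ := hg
  obtain ⟨M', hg'⟩ := hg'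
  have h1 := (hg (M + M') (by omega)).2
  have h2 := (hg' (M + M') (by omega)).2
  omega

theorem TranslatesRay.mul (hg : TranslatesRay g i d) (hh : TranslatesRay h i d') :
    TranslatesRay (g * h) i (d + d') := by
  obtain ⟨M, hg⟩ := hg
  obtain ⟨M', hh⟩ := hh
  refine ⟨M + M' + d'.natAbs, fun m hm => ?_⟩
  obtain ⟨h1, h2⟩ := hh m (by omega)
  obtain ⟨g1, g2⟩ := hg (h (i, m)).2 (by omega)
  rw [Perm.mul_apply, show h (i, m) = (i, (h (i, m)).2) from Prod.ext h1 rfl]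
  exact ⟨g1, by rw [g2, h2]; ring⟩

theorem TranslatesRay.inv (hg : TranslatesRay g i d) : TranslatesRay g⁻¹ i (-d) := by
  obtain ⟨M, hg⟩ := hg
  refine ⟨M + d.natAbs, fun m hm => ?_⟩
  obtain ⟨k, hk⟩ : ∃ k : ℕ, (k : ℤ) = m - d := ⟨((m : ℤ) - d).toNat, by omega⟩
  obtain ⟨h1, h2⟩ := hg k (by omega)
  rw [Perm.inv_eq_iff_eq.2 (show (i, m) = g (i, k) from
    Prod.ext h1.symm (by dsimp only; omega))]
  exact ⟨rfl, by rw [hk, sub_eq_add_neg]⟩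

theorem TranslatesRay.pow (hg : TranslatesRay g i d) (k : ℕ) :
    TranslatesRay (g ^ k) i (k * d) := by
  induction k with
  | zero => exact ⟨0, fun m _ => by simp⟩
  | succ k ih => rw [pow_succ, Nat.cast_succ, add_one_mul]; exact ih.mul hg

theorem TranslatesFrom.translatesBy (hg : TranslatesFrom M g t) : TranslatesBy g t := ⟨M, hg⟩

theorem TranslatesFrom.apply (hg : TranslatesFrom M g t) {m k : ℕ} (hm : M ≤ m)
    (hk : (k : ℤ) = m + t i) : g (i, m) = (i, k) := by
  obtain ⟨h1, h2⟩ := hg i m hm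
  exact Prod.ext h1 (by dsimp only; omega)

theorem TranslatesFrom.inv_apply (hg : TranslatesFrom M g t) {m k : ℕ} (hk : M ≤ k)
    (hm : (m : ℤ) = k + t i) : g⁻¹ (i, m) = (i, k) :=
  Perm.inv_eq_iff_eq.2 (hg.apply hk hm).symm

theorem TranslatesBy.ray (hg : TranslatesBy g t) (i : Fin n) : TranslatesRay g i (t i) :=
  hg.imp fun _ h => h i

theorem TranslatesBy.of_forall_ray (hg : ∀ i, TranslatesRay g i (t i)) : TranslatesBy g t := by
  choose M hM using hg
  exact ⟨∑ i, M i, fun i m hm => hM i m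
    ((Finset.single_le_sum (f := M) (fun _ _ => Nat.zero_le _) (Finset.mem_univ i)).trans hm)⟩

theorem mem_houghton_iff : g ∈ houghton n ↔ ∃ t, TranslatesBy g t := by
  constructor
  · rintro ⟨z, t, hg⟩
    exact ⟨t, .of_forall_ray fun i => ⟨z i, hg i⟩⟩
  · rintro ⟨t, M, hg⟩
    exact ⟨fun _ => M, t, hg⟩

theorem TranslatesBy.one : TranslatesBy (1 : Perm (RaySpace n)) 0 :=
  ⟨0, fun i m _ => by simp⟩

theorem TranslatesBy.mul (hg : TranslatesBy g t) (hh : TranslatesBy h t') :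
    TranslatesBy (g * h) (t + t') :=
  .of_forall_ray fun i => (hg.ray i).mul (hh.ray i)

theorem TranslatesBy.inv (hg : TranslatesBy g t) : TranslatesBy g⁻¹ (-t) :=
  .of_forall_ray fun i => (hg.ray i).inv

theorem TranslatesBy.pow (hg : TranslatesBy g t) (k : ℕ) : TranslatesBy (g ^ k) (k • t) :=
  .of_forall_ray fun i => by simpa using (hg.ray i).pow k

theorem TranslatesBy.zpow (hg : TranslatesBy g t) (k : ℤ) : TranslatesBy (g ^ k) (k • t) := by
  obtain ⟨k, rfl | rfl⟩ := k.eq_nat_or_neg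
  · simpa using hg.pow k
  · simpa using (hg.pow k).inv

theorem TranslatesBy.unique (hg : TranslatesBy g t) (hg' : TranslatesBy g t') : t = t' :=
  funext fun i => (hg.ray i).unique (hg'.ray i)

/-- The translation vectors of the elements of `K` that translate the far part of every ray. -/
def translationVectors (K : Subgroup (Perm (RaySpace n))) : AddSubgroup (Fin n → ℤ) where
  carrier := {t | ∃ u ∈ K, TranslatesBy u t}
  zero_mem' := ⟨1, one_mem K, .one⟩
  add_mem' := by
    rintro t t' ⟨u, hu, ht⟩ ⟨u', hu', ht'⟩
    exact ⟨u * u', mul_mem hu hu', ht.mul ht'⟩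
  neg_mem' := by
    rintro t ⟨u, hu, ht⟩
    exact ⟨u⁻¹, inv_mem hu, ht.inv⟩

theorem TranslatesFrom.pow_apply (hg : TranslatesFrom M g t) {q m k : ℕ} (hm : M ≤ m)
    (hk : M ≤ k) (h : (k : ℤ) = m + q * t i) : (g ^ q) (i, m) = (i, k) := by
  induction q generalizing m with
  | zero => simp_all
  | succ q ih =>
    push_cast at h
    -- `m + t i` lies between `m` and `k`
    obtain ⟨j, hj⟩ : ∃ j : ℕ, (j : ℤ) = m + t i := ⟨((m : ℤ) + t i).toNat, by
      rcases le_total 0 (t i) with hi | hi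
      · omega
      · nlinarith [Int.toNat_of_nonneg (show 0 ≤ (m : ℤ) + t i by nlinarith)]⟩
    rw [pow_succ, Perm.mul_apply, hg.apply hm hj]
    refine ih ?_ (by rw [h, hj]; ring)
    rcases le_total 0 (t i) with hi | hi
    · omega
    · have : (q : ℤ) * t i ≤ 0 := mul_nonpos_of_nonneg_of_nonpos (by positivity) hi
      have : (k : ℤ) ≤ j := by rw [h, hj]; linarith
      omega

end Translations

/-- From height `M` on, `g` carries each ray rigidly onto a part of some ray. This is how the
elements of `H_n ⋊ S_n` behave. -/
def RigidFrom {n : ℕ} (M : ℕ) (g : Perm (RaySpace n)) : Prop :=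
  ∀ i k, g (i, M + k) = ((g (i, M)).1, (g (i, M)).2 + k)

/-- The signed distance by which `g` raises the point at height `M` on ray `i`. -/
def translationAt {n : ℕ} (g : Perm (RaySpace n)) (M : ℕ) (i : Fin n) : ℤ := (g (i, M)).2 - M

namespace RigidFrom

variable {n M M' : ℕ} {g h : Perm (RaySpace n)} {t : Fin n → ℤ}

theorem mono (hg : RigidFrom M g) (h : M ≤ M') : RigidFrom M' g := by
  obtain ⟨d, rfl⟩ := Nat.exists_eq_add_of_le h
  intro i k
  rw [hg i d, add_assoc, hg i (d + k), add_assoc]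

theorem apply_add (hg : RigidFrom M g) (i : Fin n) {m : ℕ} (hm : M ≤ m) (k : ℕ) :
    g (i, m + k) = ((g (i, m)).1, (g (i, m)).2 + k) := hg.mono hm i k

theorem one : RigidFrom 0 (1 : Perm (RaySpace n)) := fun i k => by simp

theorem mul (hg : RigidFrom M g) (hh : RigidFrom M' h) : RigidFrom (M + M') (g * h) := by
  intro i k
  rw [Perm.mul_apply, Perm.mul_apply, hh.apply_add i (by omega) k, add_comm M M', hh i M,
    ← hg.apply_add _ (by omega)]

theorem pow (hg : RigidFrom M g) (k : ℕ) : RigidFrom (k * M) (g ^ k) := by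
  induction k with
  | zero => simpa using one
  | succ k ih => rw [pow_succ, Nat.succ_mul]; exact ih.mul hg

theorem ext (hg : RigidFrom M g) (hh : RigidFrom M h)
    (heq : ∀ i m, m ≤ M → g (i, m) = h (i, m)) : g = h := by
  ext1 ⟨i, m⟩
  rcases le_total m M with hm | hm
  · exact heq i m hm
  · obtain ⟨d, rfl⟩ := Nat.exists_eq_add_of_le hm
    rw [hg i d, hh i d, heq i M le_rfl]

theorem ray_translates (hg : RigidFrom M g) {i : Fin n} (hi : (g (i, M)).1 = i) {m : ℕ}
    (hm : M ≤ m) : (g (i, m)).1 = i ∧ ((g (i, m)).2 : ℤ) = m + translationAt g M i := by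
  obtain ⟨d, rfl⟩ := Nat.exists_eq_add_of_le hm
  rw [hg i d, hi, translationAt]
  refine ⟨rfl, ?_⟩
  push_cast
  ring

theorem translatesFrom (hg : RigidFrom M g) (hray : ∀ i, (g (i, M)).1 = i) :
    TranslatesFrom M g (translationAt g M) :=
  fun i _ hm => hg.ray_translates (hray i) hm

theorem translatesFrom_of_translatesBy (hg : RigidFrom M g) (ht : TranslatesBy g t) :
    TranslatesFrom M g t := by
  intro i m hm
  obtain ⟨M', ht⟩ := ht
  obtain ⟨h1, h2⟩ := ht i (m + M') (by omega)
  rw [hg.apply_add i hm M'] at h1 h2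
  refine ⟨h1, ?_⟩
  push_cast at h2
  omega

theorem translationAt_eq (hg : RigidFrom M g) (ht : TranslatesBy g t) (hM : M ≤ M') :
    translationAt g M' = t := by
  funext i
  rw [translationAt, (hg.translatesFrom_of_translatesBy ht i M' hM).2, add_sub_cancel_left]

theorem ray_injective (hg : RigidFrom M g) : Function.Injective fun i => (g (i, M)).1 := by
  intro i j hij
  dsimp only at hij
  have : g (i, M + (g (j, M)).2) = g (j, M + (g (i, M)).2) := by
    rw [hg i, hg j, hij, add_comm]
  exact congrArg Prod.fst (g.injective this)

/-- The permutation of the rays induced by a permutation that is rigid far out. -/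
noncomputable def rayMap (hg : RigidFrom M g) : Perm (Fin n) :=
  Equiv.ofBijective _ (Finite.injective_iff_bijective.1 hg.ray_injective)

theorem fst_apply (hg : RigidFrom M g) (i : Fin n) {m : ℕ} (hm : M ≤ m) :
    (g (i, m)).1 = hg.rayMap i := by
  obtain ⟨d, rfl⟩ := Nat.exists_eq_add_of_le hm
  rw [hg i d]
  rfl

theorem snd_apply (hg : RigidFrom M g) (i : Fin n) {m k : ℕ} (hm : M ≤ m) (hk : M ≤ k) :
    ((g (i, k)).2 : ℤ) = (g (i, m)).2 + (k - m) := by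
  obtain ⟨d, rfl⟩ := Nat.exists_eq_add_of_le hm
  obtain ⟨e, rfl⟩ := Nat.exists_eq_add_of_le hk
  rw [hg i d, hg i e]
  push_cast
  ring

theorem le_snd_apply_add (hg : RigidFrom M g) (i : Fin n) (m : ℕ) (hm : M ≤ m) :
    m ≤ (g (i, m)).2 + M := by
  obtain ⟨d, rfl⟩ := Nat.exists_eq_add_of_le hm
  rw [hg i d]
  dsimp only
  omega

theorem fst_pow_apply (hg : RigidFrom M g) {k : ℕ} {z : RaySpace n} (hz : k * M ≤ z.2) :
    ((g ^ k) z).1 = (hg.rayMap ^ k) z.1 := by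
  induction k with
  | zero => rfl
  | succ k ih =>
    rw [Nat.succ_mul] at hz
    have hk : z.2 ≤ ((g ^ k) z).2 + k * M := (hg.pow k).le_snd_apply_add z.1 z.2 (by omega)
    rw [pow_succ', pow_succ', Perm.mul_apply, Perm.mul_apply, ← ih (by omega)]
    exact hg.fst_apply (m := ((g ^ k) z).2) _ (by omega)

theorem exists_pow_fst_apply_eq (hg : RigidFrom M g) :
    ∃ L, 0 < L ∧ ∀ i, ((g ^ L) (i, L * M)).1 = i := by
  refine ⟨orderOf hg.rayMap, orderOf_pos _, fun i => ?_⟩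
  rw [hg.fst_pow_apply le_rfl, pow_orderOf_eq_one, Perm.one_apply]

end RigidFrom

section TotalTranslation

variable {n : ℕ} {c : Perm (RaySpace n)} {w : Fin n → ℤ}

open Classical in
theorem card_eq_sum_count_rays (F : Set (RaySpace n)) (f : Fin n → ℕ) {A : Finset (RaySpace n)}
    (hA : ∀ z, z ∈ A ↔ z ∈ F ∧ z.2 < f z.1) :
    A.card = ∑ i, Nat.count (fun m => (i, m) ∈ F) (f i) := by
  have : A = (Finset.univ.sigma fun i => {m ∈ Finset.range (f i) | (i, m) ∈ F} :
      Finset (Σ _ : Fin n, ℕ)).map (Equiv.sigmaEquivProd (Fin n) ℕ).toEmbedding := by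
    ext ⟨i, m⟩
    simp [hA, and_comm]
  rw [this, Finset.card_map, Finset.card_sigma]
  exact Finset.sum_congr rfl fun i _ => (Nat.count_eq_card_filter_range _ _).symm

open Classical in
theorem count_eq_count_add_of_eventually {q : ℕ → Prop} {M k l : ℕ} {d : ℤ}
    {P : Prop} [Decidable P] (h : ∀ m, M ≤ m → (q m ↔ P)) (hk : M ≤ k) (hl : M ≤ l)
    (hd : (l : ℤ) = k + d) :
    (Nat.count q l : ℤ) = Nat.count q k + if P then d else 0 := by
  obtain ⟨k, rfl⟩ := Nat.exists_eq_add_of_le hk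
  obtain ⟨l, rfl⟩ := Nat.exists_eq_add_of_le hl
  rw [Nat.count_add, Nat.count_add]
  simp only [h _ (Nat.le_add_right M _)]
  by_cases hP : P
  · simp only [hP, Nat.count_true, if_true]
    omega
  · simp [hP]

theorem TranslatesFrom.snd_symm_apply_lt_iff {M K : ℕ} (hc : TranslatesFrom M c w)
    (hw : ∀ i, M + (w i).natAbs ≤ K) (z : RaySpace n) :
    (c.symm z).2 < K ↔ (z.2 : ℤ) < K + w z.1 := by
  rcases z with ⟨i, m⟩
  have hi := hw i
  constructor
  · intro h
    by_contra! hm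
    dsimp only at hm
    have := hc.inv_apply (i := i) (m := m) (k := ((m : ℤ) - w i).toNat) (by omega) (by omega)
    rw [Perm.inv_def] at this
    rw [this] at h
    dsimp only at h
    omega
  · intro h
    by_contra! hm
    obtain ⟨h1, h2⟩ := hc (c.symm (i, m)).1 (c.symm (i, m)).2 (by omega)
    rw [Prod.mk.eta, Equiv.apply_symm_apply] at h1 h2
    rw [← h1] at h2
    dsimp only at h h2
    omega

/-- `c` maps a large box in `F` onto the part of `F` below the heights changed by `w`, and on the
rays outside `R` this does not change the number of points. -/
theorem TranslatesBy.sum_eq_zero_of_invariant (hc : TranslatesBy c w) (F : Set (RaySpace n))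
    (hF : ∀ z, c z ∈ F ↔ z ∈ F) (R : Finset (Fin n))
    (hR : ∃ M, ∀ i m, M ≤ m → ((i, m) ∈ F ↔ i ∈ R)) : ∑ i ∈ R, w i = 0 := by
  classical
  obtain ⟨M₁, hc⟩ := hc
  obtain ⟨M₂, hR⟩ := hR
  obtain ⟨K, hK⟩ : ∃ K, ∀ i, M₁ + M₂ + (w i).natAbs ≤ K :=
    ⟨_, fun i => Nat.add_le_add_left (natAbs_le_sum w i) _⟩
  have hf (i : Fin n) : ((((K : ℤ) + w i).toNat : ℕ) : ℤ) = K + w i := by have := hK i; omega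
  let A : Finset (RaySpace n) := {z ∈ Finset.univ ×ˢ Finset.range K | z ∈ F}
  have hA (z : RaySpace n) : z ∈ A ↔ z ∈ F ∧ z.2 < K := by simp [A, and_comm]
  have hA' (z : RaySpace n) :
      z ∈ A.map c.toEmbedding ↔ z ∈ F ∧ z.2 < ((K : ℤ) + w z.1).toNat := by
    rw [Finset.mem_map_equiv, hA, ← hF, Equiv.apply_symm_apply,
      hc.snd_symm_apply_lt_iff (fun i => by have := hK i; omega), ← Nat.cast_lt (α := ℤ), hf]
  have hcard := card_eq_sum_count_rays F (fun i => ((K : ℤ) + w i).toNat) hA'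
  rw [Finset.card_map, card_eq_sum_count_rays F (fun _ => K) hA] at hcard
  have hcount (i : Fin n) := count_eq_count_add_of_eventually (hR i)
    (show M₂ ≤ K by have := hK i; omega)
    (show M₂ ≤ ((K : ℤ) + w i).toNat by have := hK i; omega) (hf i)
  have : ∑ i, (if i ∈ R then w i else 0) = 0 := by
    have h := congrArg (Nat.cast (R := ℤ)) hcard
    push_cast at h
    rw [Finset.sum_congr rfl fun i _ => hcount i, Finset.sum_add_distrib] at h
    linarith
  rwa [Finset.sum_ite_mem, Finset.univ_inter] at this

theorem TranslatesBy.sum_eq_zero (hc : TranslatesBy c w) : ∑ i, w i = 0 :=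
  hc.sum_eq_zero_of_invariant Set.univ (by simp) Finset.univ ⟨0, by simp⟩

end TotalTranslation

/-! ### Construction of commuting permutations -/

section EquivariantExtension

variable {α : Type*} (a : Perm α) (S : Set α) (g : α → α)

theorem exists_equivariant_extension
    (hg : ∀ z ∈ S, ∀ k : ℤ, (a ^ k) z ∈ S → g ((a ^ k) z) = (a ^ k) (g z)) :
    ∃ c : α → α, (∀ z (k : ℤ), c ((a ^ k) z) = (a ^ k) (c z)) ∧ (∀ z ∈ S, c z = g z) ∧
      ∀ z, (∀ k : ℤ, (a ^ k) z ∉ S) → c z = z := by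
  classical
  let c : α → α := fun z => if h : ∃ k : ℤ, (a ^ k) z ∈ S then
    (a ^ (-h.choose)) (g ((a ^ h.choose) z)) else z
  have c_eq : ∀ z (k : ℤ), (a ^ k) z ∈ S → c z = (a ^ (-k)) (g ((a ^ k) z)) := by
    intro z k hk
    have h : ∃ k : ℤ, (a ^ k) z ∈ S := ⟨k, hk⟩
    have e : (a ^ k) z = (a ^ (k - h.choose)) ((a ^ h.choose) z) := by
      rw [← Perm.mul_apply, ← zpow_add, sub_add_cancel]
    simp only [c, dif_pos h]
    rw [e, hg _ h.choose_spec _ (e ▸ hk), ← Perm.mul_apply, ← zpow_add]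
    congr 2
    ring
  have c_eq_self : ∀ z, (¬ ∃ k : ℤ, (a ^ k) z ∈ S) → c z = z := fun z h => dif_neg h
  refine ⟨c, fun z k => ?_, fun z hz => ?_, fun z hz => c_eq_self z (by simpa using hz)⟩
  · by_cases h : ∃ l : ℤ, (a ^ l) z ∈ S
    · obtain ⟨l, hl⟩ := h
      have e : (a ^ (l - k)) ((a ^ k) z) = (a ^ l) z := by
        rw [← Perm.mul_apply, ← zpow_add, sub_add_cancel]
      rw [c_eq z l hl, c_eq _ (l - k) (by rwa [e]), e, ← Perm.mul_apply, ← zpow_add]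
      congr 2
      ring
    · rw [c_eq_self z h, c_eq_self]
      rintro ⟨l, hl⟩
      exact h ⟨l + k, by rwa [zpow_add, Perm.mul_apply]⟩
  · simpa using c_eq z 0 (by simpa using hz)

/-- `hinj` and `hsurj` say that `g` induces a bijection between the orbits of `a` meeting `S`,
without changing the periods. -/
theorem exists_commute_extension
    (hg : ∀ z ∈ S, ∀ k : ℤ, (a ^ k) z ∈ S → g ((a ^ k) z) = (a ^ k) (g z))
    (hinj : ∀ u ∈ S, ∀ v ∈ S, ∀ k : ℤ, g u = (a ^ k) (g v) → u = (a ^ k) v)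
    (hsat : ∀ u ∈ S, ∃ k : ℤ, (a ^ k) (g u) ∈ S)
    (hsurj : ∀ v ∈ S, ∃ u ∈ S, ∃ k : ℤ, g u = (a ^ k) v) :
    ∃ c : Perm α, Commute c a ∧ (∀ z ∈ S, c z = g z) ∧
      ∀ z, (∀ k : ℤ, (a ^ k) z ∉ S) → c z = z := by
  obtain ⟨c, hca, hcS, hc⟩ := exists_equivariant_extension a S g hg
  have hc_meets : ∀ z, (∃ k : ℤ, (a ^ k) z ∈ S) → ∃ k : ℤ, (a ^ k) (c z) ∈ S := by
    rintro z ⟨k, hk⟩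
    obtain ⟨l, hl⟩ := hsat _ hk
    exact ⟨l + k, by rwa [zpow_add, Perm.mul_apply, ← hca, hcS _ hk]⟩
  have hc_inj : Function.Injective c := by
    intro z z' e
    by_cases hz : ∃ k : ℤ, (a ^ k) z ∈ S <;> by_cases hz' : ∃ k : ℤ, (a ^ k) z' ∈ S
    · obtain ⟨k, hk⟩ := hz
      obtain ⟨l, hl⟩ := hz'
      have h := hinj _ hk _ hl (k - l) (by
        rw [← hcS _ hk, ← hcS _ hl, hca, hca, e, ← Perm.mul_apply, ← zpow_add, sub_add_cancel])
      rw [← Perm.mul_apply, ← zpow_add, sub_add_cancel] at h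
      exact (a ^ k).injective h
    · rw [hc z' (not_exists.1 hz')] at e
      exact absurd (e ▸ hc_meets z hz) hz'
    · rw [hc z (not_exists.1 hz)] at e
      exact absurd (e ▸ hc_meets z' hz') hz
    · rwa [hc z (not_exists.1 hz), hc z' (not_exists.1 hz')] at e
  have hc_surj : Function.Surjective c := by
    intro v
    by_cases hv : ∃ k : ℤ, (a ^ k) v ∈ S
    · obtain ⟨k, hk⟩ := hv
      obtain ⟨u, hu, l, e⟩ := hsurj _ hk
      refine ⟨(a ^ (-(l + k))) u, ?_⟩
      rw [hca, hcS _ hu, e, zpow_neg, zpow_add, Perm.inv_eq_iff_eq, Perm.mul_apply]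
    · exact ⟨v, hc v (not_exists.1 hv)⟩
  exact ⟨Equiv.ofBijective c ⟨hc_inj, hc_surj⟩, Equiv.ext fun z => hca z 1, hcS, hc⟩

end EquivariantExtension

section InfiniteOrbits

variable {n : ℕ} {a : Perm (RaySpace n)} {L H : ℕ} {s : Fin n → ℤ}

theorem pow_apply_ne_of_far (hL : TranslatesFrom H (a ^ L) s) {i : Fin n} {m : ℕ} (hi : s i ≠ 0)
    (hm : H ≤ m) {k : ℕ} (hk : 0 < k) : (a ^ k) (i, m) ≠ (i, m) := by
  intro h
  have hfix : ((a ^ L) ^ k) (i, m) = (i, m) := by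
    rw [← pow_mul, mul_comm, pow_mul]
    exact Function.IsFixedPt.perm_pow h L
  have hki : (k : ℤ) * s i ≠ 0 := mul_ne_zero (by omega) hi
  obtain ⟨m', hm'⟩ : ∃ m' : ℕ, (m' : ℤ) = m + |k * s i| := ⟨m + (k * s i).natAbs, by push_cast; rfl⟩
  rcases abs_cases (k * s i) with ⟨habs, hpos⟩ | ⟨habs, hneg⟩
  · have := hL.pow_apply (q := k) (i := i) hm (k := m') (by omega) (by omega)
    rw [hfix, Prod.mk.injEq] at this
    omega
  · have := hL.pow_apply (q := k) (i := i) (m := m') (by omega) hm (by omega)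
    rw [← hfix, EmbeddingLike.apply_eq_iff_eq, Prod.mk.injEq] at this
    omega

theorem pow_apply_ne_of_zpow {α : Type*} {a : Perm α} {z : α} (l : ℤ)
    (h : ∀ k : ℕ, 0 < k → (a ^ k) ((a ^ l) z) ≠ (a ^ l) z) (k : ℕ) (hk : 0 < k) :
    (a ^ k) z ≠ z := by
  intro e
  apply h k hk
  rw [← Perm.mul_apply, ← zpow_natCast, ← zpow_add, add_comm, zpow_add, Perm.mul_apply,
    zpow_natCast, e]

theorem finite_snd_lt (B : ℕ) : {z : RaySpace n | z.2 < B}.Finite :=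
  (Set.finite_univ.prod (Set.finite_lt_nat B)).subset fun _ hz => ⟨Set.mem_univ _, hz⟩

theorem eventually_le_snd_pow_apply {z : RaySpace n} (hz : ∀ k : ℕ, 0 < k → (a ^ k) z ≠ z)
    (B : ℕ) : ∃ k₀ : ℕ, ∀ k ≥ k₀, B ≤ ((a ^ k) z).2 := by
  have hinj : Function.Injective fun k : ℕ => (a ^ k) z := .of_lt_imp_ne fun k l hkl e => by
    obtain ⟨d, rfl⟩ := Nat.exists_eq_add_of_le hkl.le
    rw [pow_add, Perm.mul_apply, EmbeddingLike.apply_eq_iff_eq] at e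
    exact hz d (by omega) e.symm
  obtain ⟨k₀, hk₀⟩ := ((finite_snd_lt B).preimage hinj.injOn).bddAbove
  refine ⟨k₀ + 1, fun k hk => ?_⟩
  by_contra! h
  exact absurd (hk₀ h) (by omega)

theorem ne_zero_of_infinite (hL : TranslatesFrom H (a ^ L) s) (hL0 : 0 < L) {z : RaySpace n}
    (hz : ∀ k : ℕ, 0 < k → (a ^ k) z ≠ z) (hH : H ≤ z.2) : s z.1 ≠ 0 := fun h =>
  hz L hL0 (hL.apply (i := z.1) hH (by rw [h, add_zero]))

/-- The points at height at least `K` on the rays that are moved by the translation vector `s`. -/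
def movingPart (s : Fin n → ℤ) (K : ℕ) : Set (RaySpace n) := {z | s z.1 ≠ 0 ∧ K ≤ z.2}

theorem movingPart_anti {K K' : ℕ} (h : K ≤ K') : movingPart s K' ⊆ movingPart s K :=
  fun _ hz => ⟨hz.1, h.trans hz.2⟩

theorem exists_forall_pow_mem_movingPart (hL : TranslatesFrom H (a ^ L) s) (hL0 : 0 < L)
    {z : RaySpace n} (hz : z ∈ movingPart s H) (K : ℕ) :
    ∃ k₀ : ℕ, ∀ k ≥ k₀, (a ^ k) z ∈ movingPart s K := by
  have hinf : ∀ k : ℕ, 0 < k → (a ^ k) z ≠ z := fun k hk => pow_apply_ne_of_far hL hz.1 hz.2 hk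
  obtain ⟨k₀, hk₀⟩ := eventually_le_snd_pow_apply hinf (K + H)
  refine ⟨k₀, fun k hk => ⟨?_, (Nat.le_add_right _ _).trans (hk₀ k hk)⟩⟩
  refine ne_zero_of_infinite hL hL0 (pow_apply_ne_of_zpow (-k : ℤ) (by simpa using hinf)) ?_
  exact (Nat.le_add_left _ _).trans (hk₀ k hk)

end InfiniteOrbits

section NonzeroRays

variable {n : ℕ} {a : Perm (RaySpace n)} {L H B : ℕ} {s w : Fin n → ℤ}

/-- Translate the point `z` by `w` along its ray, stopping at the initial point of the ray. -/
def shiftPoint {n : ℕ} (w : Fin n → ℤ) (z : RaySpace n) : RaySpace n :=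
  (z.1, ((z.2 : ℤ) + w z.1).toNat)

theorem shiftPoint_shiftPoint_neg (hB : ∀ i, (w i).natAbs ≤ B) {z : RaySpace n} (hz : B ≤ z.2) :
    shiftPoint w (shiftPoint (-w) z) = z := by
  have := hB z.1
  refine Prod.ext rfl ?_
  simp only [shiftPoint, Pi.neg_apply]
  omega

theorem shiftPoint_neg_shiftPoint (hB : ∀ i, (w i).natAbs ≤ B) {z : RaySpace n} (hz : B ≤ z.2) :
    shiftPoint (-w) (shiftPoint w z) = z := by
  simpa using shiftPoint_shiftPoint_neg (w := -w) (by simpa using hB) hz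

theorem le_snd_shiftPoint_add (hB : ∀ i, (w i).natAbs ≤ B) (z : RaySpace n) :
    z.2 ≤ (shiftPoint w z).2 + B := by
  have := hB z.1
  simp only [shiftPoint]
  omega

theorem shiftPoint_mem_movingPart (hB : ∀ i, (w i).natAbs ≤ B) {K : ℕ} {z : RaySpace n}
    (hz : z ∈ movingPart s (K + B)) : shiftPoint w z ∈ movingPart s K :=
  ⟨hz.1, by have := le_snd_shiftPoint_add hB z; have := hz.2; omega⟩

theorem eq_zpow_apply_of_shiftPoint_eq (hL : TranslatesFrom H (a ^ L) s) (hL0 : 0 < L)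
    (hB : ∀ i, (w i).natAbs ≤ B)
    (hw : ∀ z ∈ movingPart s (H + B), ∀ k : ℕ, (a ^ k) z ∈ movingPart s (H + B) →
      (a ^ k) (shiftPoint w z) = shiftPoint w ((a ^ k) z))
    {u v : RaySpace n} (hu : u ∈ movingPart s (H + B)) (hv : v ∈ movingPart s (H + B)) {k : ℤ}
    (e : shiftPoint w u = (a ^ k) (shiftPoint w v)) : u = (a ^ k) v := by
  have hH : H ≤ H + B := Nat.le_add_right _ _
  obtain ⟨k₀, hk₀⟩ := exists_forall_pow_mem_movingPart hL hL0 (movingPart_anti hH hu) (H + B)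
  obtain ⟨k₁, hk₁⟩ := exists_forall_pow_mem_movingPart hL hL0 (movingPart_anti hH hv) (H + B)
  obtain ⟨N, hN, N', hN', hNk⟩ : ∃ N ≥ k₀, ∃ N' ≥ k₁, (N' : ℤ) = N + k :=
    ⟨k₀ + k₁ + k.natAbs, by omega, (k₀ + k₁ + k.natAbs + k).toNat, by omega, by omega⟩
  have hpow (z : RaySpace n) : (a ^ N) ((a ^ k) z) = (a ^ N') z := by
    rw [← zpow_natCast, ← zpow_natCast, hNk, zpow_add, Perm.mul_apply]
  have hshift : shiftPoint w ((a ^ N) u) = shiftPoint w ((a ^ N') v) := by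
    rw [← hw u hu N (hk₀ N hN), ← hw v hv N' (hk₁ N' hN'), e, hpow]
  have heq := congrArg (shiftPoint (-w)) hshift
  rw [shiftPoint_neg_shiftPoint hB (by have := (hk₀ N hN).2; omega),
    shiftPoint_neg_shiftPoint hB (by have := (hk₁ N' hN').2; omega), ← hpow] at heq
  exact (a ^ N).injective heq

/-- Every orbit of `a` through the moving part eventually stays far out, so it suffices to compare
points there. -/
theorem exists_commute_of_nonzero (hL : TranslatesFrom H (a ^ L) s) (hL0 : 0 < L)
    (hB : ∀ i, (w i).natAbs ≤ B) (hw0 : ∀ i, s i = 0 → w i = 0)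
    (hw : ∀ z ∈ movingPart s (H + B), ∀ k : ℕ, (a ^ k) z ∈ movingPart s (H + B) →
      (a ^ k) (shiftPoint w z) = shiftPoint w ((a ^ k) z)) :
    ∃ c : Perm (RaySpace n), TranslatesBy c w ∧ Commute c a := by
  have hfar {z} (hz : z ∈ movingPart s (H + B)) :
      ∃ k : ℕ, (a ^ k) z ∈ movingPart s (H + B + B) := by
    obtain ⟨k, hk⟩ := exists_forall_pow_mem_movingPart hL hL0
      (movingPart_anti (Nat.le_add_right _ _) hz) (H + B + B)
    exact ⟨k, hk k le_rfl⟩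
  obtain ⟨c, hc, hcS, hc0⟩ := exists_commute_extension a (movingPart s (H + B)) (shiftPoint w)
    (fun z hz k hk => by
      obtain ⟨k, rfl | rfl⟩ := k.eq_nat_or_neg
      · exact (hw z hz k hk).symm
      · have e : (a ^ k) ((a ^ (-k : ℤ)) z) = z := by simp
        have := hw _ hk k (e.symm ▸ hz)
        rw [e] at this
        simp [← this])
    (fun u hu v hv k e => eq_zpow_apply_of_shiftPoint_eq hL hL0 hB hw hu hv e)
    (fun u hu => by
      obtain ⟨k, hk⟩ := hfar hu
      refine ⟨k, ?_⟩
      rw [zpow_natCast, hw u hu k (movingPart_anti (Nat.le_add_right _ _) hk)]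
      exact shiftPoint_mem_movingPart hB hk)
    (fun v hv => by
      obtain ⟨k, hk⟩ := hfar hv
      exact ⟨shiftPoint (-w) ((a ^ k) v), shiftPoint_mem_movingPart (by simpa using hB) hk, k,
        shiftPoint_shiftPoint_neg hB (by have := hk.2; omega)⟩)
  refine ⟨c, .of_forall_ray fun i => ?_, hc⟩
  have := hB i
  by_cases hi : s i = 0
  · refine ⟨H, fun m hm => ?_⟩
    rw [hc0, hw0 i hi]
    · simp
    · exact fun l hl => pow_apply_ne_of_zpow l (fun k hk => pow_apply_ne_of_far hL hl.1
        ((Nat.le_add_right _ _).trans hl.2) hk) L hL0 (hL.apply hm (by rw [hi, add_zero]))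
  · refine ⟨H + B, fun m hm => ?_⟩
    rw [hcS _ ⟨hi, hm⟩]
    exact ⟨rfl, by simp only [shiftPoint]; omega⟩

end NonzeroRays

section ZeroRays

variable {n : ℕ} {a : Perm (RaySpace n)} {M L H : ℕ} {s : Fin n → ℤ}

/-- The `r`-th power of `a` fixes the far part of ray `i`. -/
def FixesRay {n : ℕ} (a : Perm (RaySpace n)) (r : ℕ) (i : Fin n) : Prop :=
  ∃ M, ∀ m, M ≤ m → (a ^ r) (i, m) = (i, m)

theorem RigidFrom.fixesRay_iff (ha : RigidFrom M a) {r : ℕ} {i : Fin n} {m : ℕ}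
    (hm : r * M ≤ m) : FixesRay a r i ↔ (a ^ r) (i, m) = (i, m) := by
  constructor
  · rintro ⟨M', h⟩
    have := h (m + M') (by omega)
    rwa [(ha.pow r).apply_add i hm, Prod.mk.injEq, Nat.add_right_cancel_iff,
      ← Prod.mk.injEq, Prod.mk.eta] at this
  · intro h
    refine ⟨m, fun m' hm' => ?_⟩
    obtain ⟨d, rfl⟩ := Nat.exists_eq_add_of_le hm'
    rw [(ha.pow r).apply_add i hm, h]

theorem FixesRay.mul {r : ℕ} {i : Fin n} (h : FixesRay a r i) (q : ℕ) :
    FixesRay a (r * q) i := by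
  obtain ⟨M, h⟩ := h
  exact ⟨M, fun m hm => by rw [pow_mul]; exact Function.IsFixedPt.perm_pow (h m hm) q⟩

theorem FixesRay.mod {r k : ℕ} {i : Fin n} (h : FixesRay a r i) (hk : FixesRay a k i) :
    FixesRay a (k % r) i := by
  obtain ⟨M, h⟩ := h.mul (k / r)
  obtain ⟨M', hk⟩ := hk
  refine ⟨M + M', fun m hm => ?_⟩
  have := hk m (by omega)
  rwa [← Nat.mod_add_div k r, pow_add, Perm.mul_apply, h m (by omega)] at this

theorem RigidFrom.fixesRay_of_pow_rayMap_eq (ha : RigidFrom M a) (hL : TranslatesFrom H (a ^ L) s)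
    (hL0 : 0 < L) {i : Fin n} (hi : s i = 0) {k : ℕ} (hk : (ha.rayMap ^ k) i = i) :
    FixesRay a k i := by
  obtain ⟨u, hu⟩ : ∃ u : ℤ, TranslatesRay (a ^ k) i u :=
    ⟨_, k * M, fun m hm => (ha.pow k).ray_translates ((ha.fst_pow_apply le_rfl).trans hk) hm⟩
  have hLu : (L : ℤ) * u = k * s i := by
    refine (hu.pow L).unique ?_
    rw [← pow_mul, mul_comm, pow_mul]
    exact (hL.translatesBy.ray i).pow k
  obtain rfl : u = 0 := by
    rw [hi, mul_zero] at hLu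
    exact (mul_eq_zero.1 hLu).resolve_left (by omega)
  exact hu.imp fun K h m hm => Prod.ext (h m hm).1 (by have := (h m hm).2; dsimp only; omega)

theorem RigidFrom.translatesRay_of_commute (ha : RigidFrom M a) {c : Perm (RaySpace n)}
    (hc : Commute c a) {i : Fin n} {q : ℕ} {d : ℤ}
    (h : TranslatesRay c ((ha.rayMap ^ q) i) d) : TranslatesRay c i d := by
  obtain ⟨K, hK⟩ := h
  refine ⟨K + q * M + d.natAbs, fun m hm => ?_⟩
  obtain ⟨k, hk⟩ : ∃ k : ℕ, (k : ℤ) = m + d := ⟨((m : ℤ) + d).toNat, by omega⟩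
  have hray {m : ℕ} (hm : q * M ≤ m) : ((a ^ q) (i, m)).1 = (ha.rayMap ^ q) i :=
    ha.fst_pow_apply hm
  obtain ⟨h1, h2⟩ := hK ((a ^ q) (i, m)).2
    (by have := (ha.pow q).le_snd_apply_add i m (by omega); omega)
  suffices c (i, m) = (i, k) by rw [this]; exact ⟨rfl, hk⟩
  apply (a ^ q).injective
  rw [← Perm.mul_apply, ← (hc.pow_right q).eq, Perm.mul_apply,
    show (a ^ q) (i, m) = ((ha.rayMap ^ q) i, ((a ^ q) (i, m)).2) from
      Prod.ext (hray (by omega)) rfl]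
  refine Prod.ext (h1.trans (hray (by omega)).symm) ?_
  have := (ha.pow q).snd_apply i (m := m) (k := k) (by omega) (by omega)
  omega

theorem exists_far_rayShift {i j : Fin n} (hij : i ≠ j) (K : ℕ) :
    ∃ e : Perm (RaySpace n), (∀ m, K ≤ m → e (i, m) = (i, m + 1)) ∧
      (∀ m, K ≤ m → e (j, m + 1) = (j, m)) ∧
      ∀ z, (z.1 = i ∨ z.1 = j) ∧ K ≤ z.2 ↔ ((e z).1 = i ∨ (e z).1 = j) ∧ K ≤ (e z).2 := by
  refine ⟨⟨fun x => if x.1 = i ∧ K ≤ x.2 then (i, x.2 + 1) else if x.1 = j ∧ K ≤ x.2 then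
      (if x.2 = K then (i, K) else (j, x.2 - 1)) else x,
    fun x => if x.1 = i ∧ K ≤ x.2 then (if x.2 = K then (j, K) else (i, x.2 - 1))
      else if x.1 = j ∧ K ≤ x.2 then (j, x.2 + 1) else x, ?_, ?_⟩, ?_, ?_, ?_⟩
  · rintro ⟨l, m⟩
    grind
  · rintro ⟨l, m⟩
    grind
  all_goals
    simp only [Equiv.coe_fn_mk]
    grind

theorem exists_zpow_apply_eq_pow {α : Type*} (a : Perm α) {L : ℕ} (hL0 : 0 < L) (k : ℤ) :
    ∃ k' < L, ∀ z, (a ^ L) z = z → (a ^ k) z = (a ^ k') z := by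
  have h0 : (0 : ℤ) < L := by exact_mod_cast hL0
  refine ⟨(k % L).toNat, by have := Int.emod_lt_of_pos k h0; omega, fun z hz => ?_⟩
  have e : (a ^ (L * (k / L) : ℤ)) z = z := by
    rw [zpow_mul, zpow_natCast]
    exact Function.IsFixedPt.perm_zpow hz _
  rw [← zpow_natCast, Int.toNat_of_nonneg (Int.emod_nonneg k h0.ne')]
  conv_lhs => rw [← Int.emod_add_mul_ediv k L, zpow_add, Perm.mul_apply, e]

theorem RigidFrom.sameCycle_fst_zpow_apply (ha : RigidFrom M a) (hL : TranslatesFrom H (a ^ L) s)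
    (hL0 : 0 < L) {z : RaySpace n} (hz : s z.1 = 0) (hK : H + L * M ≤ z.2) (k : ℤ) :
    ha.rayMap.SameCycle z.1 ((a ^ k) z).1 := by
  obtain ⟨k', hk', hak⟩ := exists_zpow_apply_eq_pow a hL0 k
  have := Nat.mul_le_mul_right M hk'.le
  rw [hak z (hL.apply (i := z.1) (by omega) (by rw [hz, add_zero])), ha.fst_pow_apply (by omega)]
  exact ⟨k', by simp⟩

theorem RigidFrom.zpow_apply_eq_self (ha : RigidFrom M a) (hL : TranslatesFrom H (a ^ L) s)
    (hL0 : 0 < L) {T : Set (Fin n)} (hT : ∀ i ∈ T, s i = 0)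
    (hper : ∀ i ∈ T, ∀ j ∈ T, ∀ k, FixesRay a k i → FixesRay a k j)
    (hcycle : ∀ i ∈ T, ∀ j ∈ T, ha.rayMap.SameCycle i j → i = j)
    {z z' : RaySpace n} (hz : z.1 ∈ T) (hzK : H + L * M ≤ z.2) {k : ℤ} (hkz : ((a ^ k) z).1 ∈ T)
    (hz' : z'.1 ∈ T) (hzK' : H + L * M ≤ z'.2) : (a ^ k) z' = z' := by
  have hcyc := hcycle _ hz _ hkz (ha.sameCycle_fst_zpow_apply hL hL0 (hT _ hz) hzK k)
  obtain ⟨k', hk', hak⟩ := exists_zpow_apply_eq_pow a hL0 k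
  have hle := Nat.mul_le_mul_right M hk'.le
  have hfix {z : RaySpace n} (hz : z.1 ∈ T) (hzK : H + L * M ≤ z.2) : (a ^ L) z = z :=
    hL.apply (i := z.1) (by omega) (by rw [hT _ hz, add_zero])
  rw [hak z (hfix hz hzK), ha.fst_pow_apply (by omega)] at hcyc
  rw [hak z' (hfix hz' hzK')]
  exact (ha.fixesRay_iff (by omega)).1
    (hper _ hz _ hz' k' (ha.fixesRay_of_pow_rayMap_eq hL hL0 (hT _ hz) hcyc.symm))

theorem exists_commute_translatesRay (ha : RigidFrom M a) (hL : TranslatesFrom H (a ^ L) s)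
    (hL0 : 0 < L) {i j : Fin n} (hi : s i = 0) (hj : s j = 0)
    (hper : ∀ k, FixesRay a k i ↔ FixesRay a k j) (hij : ¬ ha.rayMap.SameCycle i j) :
    ∃ c : Perm (RaySpace n), Commute c a ∧ TranslatesRay c i 1 ∧ TranslatesRay c j (-1) ∧
      ∀ l, ¬ ha.rayMap.SameCycle l i → ¬ ha.rayMap.SameCycle l j → TranslatesRay c l 0 := by
  set K := H + L * M
  have hne : i ≠ j := fun h => hij (h ▸ Perm.SameCycle.refl _ _)
  obtain ⟨e, he_i, he_j, heS⟩ := exists_far_rayShift hne K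
  let S : Set (RaySpace n) := {z | z.1 ∈ ({i, j} : Set (Fin n)) ∧ K ≤ z.2}
  have hS_fix {z z' : RaySpace n} (hz : z ∈ S) {k : ℤ} (hk : (a ^ k) z ∈ S) (hz' : z' ∈ S) :
      (a ^ k) z' = z' := by
    refine ha.zpow_apply_eq_self hL hL0 (T := {i, j}) ?_ ?_ ?_ hz.1 hz.2 hk.1 hz'.1 hz'.2
    · rintro _ (rfl | rfl) <;> assumption
    · rintro _ (rfl | rfl) _ (rfl | rfl) k <;> simp [hper]
    · rintro _ (rfl | rfl) _ (rfl | rfl) h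
      exacts [rfl, absurd h hij, absurd h.symm hij, rfl]
  obtain ⟨c, hc, hcS, hc0⟩ := exists_commute_extension a S e
    (fun z hz k hk => by rw [hS_fix hz hk hz, hS_fix hz hk ((heS z).1 hz)])
    (fun u hu v hv k h => by
      have hv' := (heS v).1 hv
      have hk : (a ^ k) (e v) ∈ S := h ▸ (heS u).1 hu
      rw [hS_fix hv' hk hv'] at h
      rw [hS_fix hv' hk hv, e.injective h])
    (fun u hu => ⟨0, (heS u).1 hu⟩)
    (fun v hv => ⟨e.symm v, (heS _).2 (by rwa [e.apply_symm_apply]), 0, by simp⟩)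
  refine ⟨c, hc, ⟨K, fun m hm => ?_⟩, ⟨K + 1, fun m hm => ?_⟩, fun l hli hlj => ⟨K, fun m _ => ?_⟩⟩
  · rw [hcS _ ⟨Or.inl rfl, hm⟩, he_i m hm]
    simp
  · obtain ⟨m, rfl⟩ : ∃ m', m = m' + 1 := ⟨m - 1, by omega⟩
    rw [hcS (j, m + 1) ⟨Or.inr rfl, by dsimp only; omega⟩, he_j m (by omega)]
    simp
  · rw [hc0]
    · simp
    · intro k hk
      have hs : s ((a ^ k) (l, m)).1 = 0 := by rcases hk.1 with h | h <;> rw [h] <;> assumption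
      have hcyc := ha.sameCycle_fst_zpow_apply hL hL0 hs hk.2 (-k)
      rw [← Perm.mul_apply, ← zpow_add, neg_add_cancel, zpow_zero, Perm.one_apply] at hcyc
      rcases hk.1 with h | h <;> rw [h] at hcyc
      exacts [hli hcyc.symm, hlj hcyc.symm]

/-- The translation vector `1` on the cycle of ray `i` and `-1` on the cycle of ray `j`. -/
noncomputable def cycleDiff {n : ℕ} (σ : Perm (Fin n)) (i j : Fin n) (l : Fin n) : ℤ :=
  open Classical in (if σ.SameCycle l i then 1 else 0) - (if σ.SameCycle l j then 1 else 0)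

theorem exists_commute_cycleDiff (ha : RigidFrom M a) (hL : TranslatesFrom H (a ^ L) s)
    (hL0 : 0 < L) {i j : Fin n} (hi : s i = 0) (hj : s j = 0)
    (hper : ∀ k, FixesRay a k i ↔ FixesRay a k j) (hij : ¬ ha.rayMap.SameCycle i j) :
    ∃ c : Perm (RaySpace n), TranslatesBy c (cycleDiff ha.rayMap i j) ∧ Commute c a := by
  obtain ⟨c, hc, hc_i, hc_j, hc_l⟩ := exists_commute_translatesRay ha hL hL0 hi hj hper hij
  refine ⟨c, .of_forall_ray fun l => ?_, hc⟩
  by_cases hli : ha.rayMap.SameCycle l i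
  · obtain ⟨q, rfl⟩ := hli.exists_nat_pow_eq
    rw [cycleDiff, if_pos hli, if_neg fun h => hij (hli.symm.trans h)]
    exact ha.translatesRay_of_commute hc hc_i
  by_cases hlj : ha.rayMap.SameCycle l j
  · obtain ⟨q, rfl⟩ := hlj.exists_nat_pow_eq
    rw [cycleDiff, if_neg hli, if_pos hlj]
    exact ha.translatesRay_of_commute hc hc_j
  · rw [cycleDiff, if_neg hli, if_neg hlj]
    exact hc_l l hli hlj

end ZeroRays

/-! ### Translation vectors of the centralizer -/

section CommutingTranslations

/-- The translation vectors of the permutations that commute with `a` and translate the far part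
of every ray. -/
def commutingTranslations {n : ℕ} (a : Perm (RaySpace n)) : AddSubgroup (Fin n → ℤ) :=
  translationVectors (Subgroup.centralizer {a})

theorem mem_commutingTranslations {n : ℕ} {a : Perm (RaySpace n)} {w : Fin n → ℤ} :
    w ∈ commutingTranslations a ↔ ∃ c : Perm (RaySpace n), TranslatesBy c w ∧ Commute c a := by
  simp_rw [and_comm (a := TranslatesBy _ w), Commute, SemiconjBy,
    ← Subgroup.mem_centralizer_singleton_iff]
  rfl

/-- The conditions on a translation vector `w` (with entries bounded by `B`) that characterize
membership in `commutingTranslations a`, where `a` is rigid from `M` and a positive power of `a`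
translates by `s` from `H`. -/
structure IsAdmissible {n : ℕ} (a : Perm (RaySpace n)) (M H B : ℕ) (s w : Fin n → ℤ) : Prop where
  cycle : ∀ i, w (a (i, M)).1 = w i
  fixed : ∀ r, open Classical in ∑ i with FixesRay a r i, w i = 0
  orbit : ∀ z ∈ movingPart s (H + B), ∀ k : ℕ, (a ^ k) z ∈ movingPart s (H + B) →
    (a ^ k) (shiftPoint w z) = shiftPoint w ((a ^ k) z)

variable {n : ℕ} {a c : Perm (RaySpace n)} {M L H B : ℕ} {s w : Fin n → ℤ}

theorem TranslatesFrom.exists_zpow_apply_eq_add {g : Perm (RaySpace n)} (hg : TranslatesFrom H g s)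
    {i : Fin n} (hi : s i ≠ 0) (K : ℕ) :
    ∃ (l : ℤ) (d : ℕ), K ≤ d ∧ ∀ m, H ≤ m → (g ^ l) (i, m) = (i, m + d) := by
  have hK : K ≤ K * (s i).natAbs := Nat.le_mul_of_pos_right K (Int.natAbs_pos.2 hi)
  rcases lt_or_gt_of_ne hi with hneg | hpos
  · refine ⟨-K, _, hK, fun m hm => ?_⟩
    rw [zpow_neg, Perm.inv_eq_iff_eq, zpow_natCast]
    refine (hg.pow_apply (hm.trans (Nat.le_add_right _ _)) hm ?_).symm
    push_cast
    rw [abs_of_neg hneg]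
    ring
  · refine ⟨K, _, hK, fun m hm => ?_⟩
    rw [zpow_natCast]
    refine hg.pow_apply hm (hm.trans (Nat.le_add_right _ _)) ?_
    push_cast
    rw [abs_of_pos hpos]

/-- Far enough out `c` translates by `w`, and a power of `a` carries `z` that far. -/
theorem apply_eq_shiftPoint_of_commute (hL : TranslatesFrom H (a ^ L) s) (hc : TranslatesBy c w)
    (hca : Commute c a) {z : RaySpace n} (hB : (w z.1).natAbs ≤ B) (hz : z ∈ movingPart s (H + B)) :
    c z = shiftPoint w z := by
  obtain ⟨i, m⟩ := z
  obtain ⟨hi, hm⟩ := hz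
  dsimp only at hi hm hB
  obtain ⟨m', hm'⟩ : ∃ m' : ℕ, (m' : ℤ) = m + w i := ⟨((m : ℤ) + w i).toNat, by omega⟩
  have hshift : shiftPoint w (i, m) = (i, m') :=
    Prod.ext rfl (by simp only [shiftPoint]; omega)
  obtain ⟨K, hc⟩ := hc
  obtain ⟨l, d, hd, hpush⟩ := hL.exists_zpow_apply_eq_add hi K
  apply ((a ^ L) ^ l).injective
  rw [hshift, hpush m' (by omega), ← Perm.mul_apply, ← ((hca.pow_right L).zpow_right l).eq,
    Perm.mul_apply, hpush m (by omega)]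
  exact hc.apply (by omega) (by push_cast; omega)

theorem RigidFrom.translation_ray_eq (ha : RigidFrom M a) (hc : TranslatesBy c w)
    (hca : Commute c a) (i : Fin n) : w (a (i, M)).1 = w i :=
  (ha.translatesRay_of_commute hca (q := 1) (hc.ray _)).unique (hc.ray i)

theorem isAdmissible_of_mem (ha : RigidFrom M a) (hL : TranslatesFrom H (a ^ L) s)
    (hB : ∀ i, (w i).natAbs ≤ B) (hw : w ∈ commutingTranslations a) :
    IsAdmissible a M H B s w := by
  classical
  obtain ⟨c, hc, hca⟩ := mem_commutingTranslations.1 hw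
  refine ⟨ha.translation_ray_eq hc hca, fun r => ?_, fun z hz k hk => ?_⟩
  · convert hc.sum_eq_zero_of_invariant {z | (a ^ r) z = z} (fun z => ?_) {i | FixesRay a r i}
      ⟨r * M, fun i m hm => ?_⟩
    · simp only [Set.mem_ofPred_eq]
      rw [← Perm.mul_apply, ← (hca.pow_right r).eq, Perm.mul_apply, c.injective.eq_iff]
    · simp only [Set.mem_ofPred_eq, Finset.mem_filter, Finset.mem_univ, true_and]
      exact (ha.fixesRay_iff hm).symm
  · rw [← apply_eq_shiftPoint_of_commute hL hc hca (hB _) hz,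
      ← apply_eq_shiftPoint_of_commute hL hc hca (hB _) hk,
      ← Perm.mul_apply, ← Perm.mul_apply, (hca.pow_right k).eq]

theorem RigidFrom.eq_of_sameCycle (ha : RigidFrom M a) (h : ∀ i, w (a (i, M)).1 = w i)
    {i j : Fin n} (hij : ha.rayMap.SameCycle i j) : w i = w j := by
  obtain ⟨k, rfl⟩ := hij.exists_nat_pow_eq
  induction k with
  | zero => rfl
  | succ k ih =>
    rw [pow_succ', Perm.mul_apply]
    exact (ih ⟨k, by simp⟩).trans (h _).symm

theorem RigidFrom.drift_ray_eq (ha : RigidFrom M a) (hL : TranslatesFrom H (a ^ L) s) (i : Fin n) :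
    s (a (i, M)).1 = s i :=
  ha.translation_ray_eq hL.translatesBy ((Commute.refl a).pow_left L) i

/-- Pairs of rays without drift, of equal period, lying in different cycles. -/
def RigidFrom.IsShiftPair (ha : RigidFrom M a) (s : Fin n → ℤ) (i j : Fin n) : Prop :=
  s i = 0 ∧ s j = 0 ∧ (∀ k, FixesRay a k i ↔ FixesRay a k j) ∧ ¬ ha.rayMap.SameCycle i j

open scoped Classical in
/-- The translation vector of the commuting permutation attached to a pair of rays; the value is `0`
for the pairs that are no shift pairs. -/
noncomputable def RigidFrom.shiftVector (ha : RigidFrom M a) (s : Fin n → ℤ) (q : Fin n × Fin n) :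
    Fin n → ℤ :=
  if ha.IsShiftPair s q.1 q.2 then cycleDiff ha.rayMap q.1 q.2 else 0

theorem RigidFrom.shiftVector_mem (ha : RigidFrom M a) (hL : TranslatesFrom H (a ^ L) s)
    (hL0 : 0 < L) (q : Fin n × Fin n) : ha.shiftVector s q ∈ commutingTranslations a := by
  rw [shiftVector]
  split_ifs with h
  · exact mem_commutingTranslations.2 <|
      exists_commute_cycleDiff ha hL hL0 h.1 h.2.1 h.2.2.1 h.2.2.2
  · exact zero_mem _

theorem RigidFrom.natAbs_shiftVector_le (ha : RigidFrom M a) (q : Fin n × Fin n) (l : Fin n) :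
    (ha.shiftVector s q l).natAbs ≤ 1 := by
  rw [shiftVector]
  split_ifs
  · rw [cycleDiff]
    split_ifs <;> simp
  · simp

theorem RigidFrom.shiftVector_eq_zero (ha : RigidFrom M a) (hL : TranslatesFrom H (a ^ L) s)
    (q : Fin n × Fin n) {l : Fin n} (hl : s l ≠ 0) : ha.shiftVector s q l = 0 := by
  have hs := ha.drift_ray_eq hL
  rw [shiftVector]
  split_ifs with h
  · rw [cycleDiff, if_neg, if_neg, sub_zero]
    · exact fun h' => hl ((ha.eq_of_sameCycle hs h').trans h.2.1)
    · exact fun h' => hl ((ha.eq_of_sameCycle hs h').trans h.1)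
  · rfl

theorem exists_opposite_of_sum_eq_zero {ι : Type*} {R : Finset ι} {w : ι → ℤ}
    (h : ∑ i ∈ R, w i = 0) {i : ι} (hi : i ∈ R) (hwi : w i ≠ 0) :
    (∃ i ∈ R, 0 < w i) ∧ ∃ j ∈ R, w j < 0 := by
  constructor <;> by_contra! hcon
  · exact hwi ((Finset.sum_eq_zero_iff_of_nonpos hcon).1 h i hi)
  · exact hwi ((Finset.sum_eq_zero_iff_of_nonneg hcon).1 h i hi)

open scoped Classical in
/-- All rays of minimal period in the support of `w` have the same powers of `a` fixing them. -/
theorem RigidFrom.exists_isShiftPair (ha : RigidFrom M a) (hL : TranslatesFrom H (a ^ L) s)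
    (hL0 : 0 < L) (h0 : ∀ i, s i ≠ 0 → w i = 0) (h1 : ∀ i, w (a (i, M)).1 = w i)
    (h2 : ∀ r, 0 < r → ∑ i with FixesRay a r i, w i = 0) (hw : w ≠ 0) :
    ∃ i j, ha.IsShiftPair s i j ∧ 0 < w i ∧ w j < 0 := by
  have hex : ∃ r, 0 < r ∧ ∃ i, w i ≠ 0 ∧ FixesRay a r i := by
    obtain ⟨i, hi⟩ := Function.ne_iff.1 hw
    refine ⟨L, hL0, i, hi, H, fun m hm => hL.apply hm ?_⟩
    rw [not_imp_comm.1 (h0 i) hi, add_zero]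
  obtain ⟨hr0, i₀, hi₀, hf₀⟩ := Nat.find_spec hex
  have hmin := fun k => Nat.find_min hex (m := k)
  set r := Nat.find hex
  obtain ⟨⟨i, hi, hwi⟩, j, hj, hwj⟩ := exists_opposite_of_sum_eq_zero (h2 r hr0) (i := i₀)
    (by simpa using hf₀) hi₀
  simp only [Finset.mem_filter, Finset.mem_univ, true_and] at hi hj
  have hdvd : ∀ l, w l ≠ 0 → FixesRay a r l → ∀ k, FixesRay a k l ↔ r ∣ k := by
    intro l hwl hl k
    refine ⟨fun hk => by_contra fun hnd => ?_, ?_⟩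
    · exact hmin _ (Nat.mod_lt k hr0)
        ⟨Nat.pos_of_ne_zero fun h => hnd (Nat.dvd_of_mod_eq_zero h), l, hwl, hl.mod hk⟩
    · rintro ⟨q, rfl⟩
      exact hl.mul q
  refine ⟨i, j, ⟨not_imp_comm.1 (h0 i) hwi.ne', not_imp_comm.1 (h0 j) hwj.ne, fun k => ?_,
    fun h => ?_⟩, hwi, hwj⟩
  · rw [hdvd i hwi.ne' hi, hdvd j hwj.ne hj]
  · have := ha.eq_of_sameCycle h1 h
    omega

theorem sum_natAbs_sub_cycleDiff_lt {σ : Perm (Fin n)} (hw : ∀ i j, σ.SameCycle i j → w i = w j)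
    {i j : Fin n} (hi : 0 < w i) (hj : w j < 0) :
    ∑ l, (w l - cycleDiff σ i j l).natAbs < ∑ l, (w l).natAbs := by
  have hij : ¬ σ.SameCycle i j := fun h => by have := hw i j h; omega
  refine Finset.sum_lt_sum (fun l _ => ?_) ⟨i, Finset.mem_univ _, ?_⟩
  · rw [cycleDiff]
    split_ifs with hli hlj hlj
    · simp
    · have := hw l i hli
      omega
    · have := hw l j hlj
      omega
    · simp
  · rw [cycleDiff, if_pos (Perm.SameCycle.refl _ _), if_neg hij]
    omega

open scoped Classical in
theorem mem_span_shiftVector (ha : RigidFrom M a) (hL : TranslatesFrom H (a ^ L) s) (hL0 : 0 < L)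
    (h0 : ∀ i, s i ≠ 0 → w i = 0) (h1 : ∀ i, w (a (i, M)).1 = w i)
    (h2 : ∀ r, 0 < r → ∑ i with FixesRay a r i, w i = 0) :
    w ∈ Submodule.span ℤ (Set.range (ha.shiftVector s)) := by
  induction hN : ∑ i, (w i).natAbs using Nat.strong_induction_on generalizing w with
  | _ N ih =>
  by_cases hw : w = 0
  · rw [hw]
    exact zero_mem _
  obtain ⟨i, j, hpair, hwi, hwj⟩ := ha.exists_isShiftPair hL hL0 h0 h1 h2 hw
  have hv : ha.shiftVector s (i, j) = cycleDiff ha.rayMap i j := if_pos hpair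
  have hadm := isAdmissible_of_mem ha hL (fun l => ha.natAbs_shiftVector_le (s := s) (i, j) l)
    (ha.shiftVector_mem hL hL0 (i, j))
  have hmem := ih _ (hN ▸ hv ▸ sum_natAbs_sub_cycleDiff_lt
      (fun _ _ => ha.eq_of_sameCycle h1) hwi hwj)
    (w := w - ha.shiftVector s (i, j))
    (fun l hl => by rw [Pi.sub_apply, h0 l hl, ha.shiftVector_eq_zero hL _ hl, sub_zero])
    (fun l => by rw [Pi.sub_apply, Pi.sub_apply, h1, hadm.cycle])
    (fun r hr => by simp only [Pi.sub_apply, Finset.sum_sub_distrib, h2 r hr, hadm.fixed, sub_zero])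
    rfl
  rw [← sub_add_cancel w (ha.shiftVector s (i, j))]
  exact add_mem hmem (Submodule.subset_span ⟨_, rfl⟩)

theorem sum_smul_shiftVector_mem (ha : RigidFrom M a) (hL : TranslatesFrom H (a ^ L) s)
    (hL0 : 0 < L) (f : Fin n × Fin n → ℤ) :
    ∑ q, f q • ha.shiftVector s q ∈ commutingTranslations a :=
  sum_mem fun q _ => zsmul_mem (ha.shiftVector_mem hL hL0 q) _

theorem IsAdmissible.exists_sum_shiftVector_eq (hw : IsAdmissible a M H B s w)
    (ha : RigidFrom M a) (hL : TranslatesFrom H (a ^ L) s) (hL0 : 0 < L) :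
    ∃ f : Fin n × Fin n → ℤ,
      ∑ q, f q • ha.shiftVector s q = fun i => if s i = 0 then w i else 0 := by
  have hfix : ∀ r, 0 < r → ∀ i, FixesRay a r i → s i = 0 := by
    rintro r hr0 i ⟨K, hK⟩
    by_contra hi
    exact pow_apply_ne_of_far hL hi (m := H + K) (by omega) hr0 (hK _ (by omega))
  rw [← Submodule.mem_span_range_iff_exists_fun]
  refine mem_span_shiftVector ha hL hL0 (fun i hi => if_neg hi) (fun i => ?_) (fun r hr0 => ?_)
  · simp only [ha.drift_ray_eq hL, hw.cycle]
  · refine Eq.trans ?_ (hw.fixed r)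
    exact Finset.sum_congr rfl fun i hi => if_pos (hfix r hr0 i (by simpa using hi))

theorem mem_commutingTranslations_iff (ha : RigidFrom M a) (hL : TranslatesFrom H (a ^ L) s)
    (hL0 : 0 < L) (hB : ∀ i, (w i).natAbs ≤ B) :
    w ∈ commutingTranslations a ↔ IsAdmissible a M H B s w := by
  refine ⟨isAdmissible_of_mem ha hL hB, fun hw => ?_⟩
  obtain ⟨f, hf⟩ := hw.exists_sum_shiftVector_eq ha hL hL0
  have h_zero := sum_smul_shiftVector_mem ha hL hL0 f
  have h_moving : (fun i => if s i = 0 then 0 else w i) ∈ commutingTranslations a := by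
    have hshift {z : RaySpace n} (hz : z ∈ movingPart s (H + B)) :
        shiftPoint (fun i => if s i = 0 then 0 else w i) z = shiftPoint w z := by
      simp only [shiftPoint, if_neg hz.1]
    refine mem_commutingTranslations.2 <| exists_commute_of_nonzero hL hL0 (B := B)
      (fun i => ?_) (fun i hi => if_pos hi) (fun z hz k hk => ?_)
    · split_ifs
      exacts [Nat.zero_le _, hB i]
    · rw [hshift hz, hshift hk]
      exact hw.orbit z hz k hk
  rw [hf] at h_zero
  convert add_mem h_zero h_moving using 1
  funext i
  simp only [Pi.add_apply]
  split_ifs <;> simp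

/-- For `c` commuting with `a` and translating by `w`, the permutations `c ^ s i` and
`(a ^ L) ^ w i` agree far out on the ray `i` of `z`; as both commute with `a`, they agree far out
on the ray of `(a ^ k) z`. -/
theorem mul_eq_mul_of_orbit (hL : TranslatesFrom H (a ^ L) s) (hw : w ∈ commutingTranslations a)
    {z : RaySpace n} {k : ℕ} (hz : z ∈ movingPart s H) (hk : (a ^ k) z ∈ movingPart s H) :
    w z.1 * s ((a ^ k) z).1 = w ((a ^ k) z).1 * s z.1 := by
  obtain ⟨c, hc, hca⟩ := mem_commutingTranslations.1 hw
  set i := z.1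
  set j := ((a ^ k) z).1
  obtain ⟨K₁, hc_far⟩ := hc.zpow (s i)
  obtain ⟨K₂, ha_far⟩ := hL.translatesBy.zpow (w i)
  obtain ⟨l₁, d₁, hd₁, push_i⟩ := hL.exists_zpow_apply_eq_add hz.1 (K₁ + K₂)
  obtain ⟨l₂, d₂, hd₂, push_j⟩ := hL.exists_zpow_apply_eq_add hk.1 (K₁ + K₂)
  set g := ((a ^ L) ^ l₂) * (a ^ k) * ((a ^ L) ^ l₁)⁻¹
  have hg : g (i, z.2 + d₁) = (j, ((a ^ k) z).2 + d₂) := by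
    rw [← push_i _ hz.2, ← push_j _ hk.2, Perm.mul_apply, Perm.mul_apply,
      Perm.inv_eq_iff_eq.2 rfl]
  have hcomm {u : Perm (RaySpace n)} (hu : Commute u a) : Commute u g :=
    (((hu.pow_right L).zpow_right l₂).mul_right (hu.pow_right k)).mul_right
      ((hu.pow_right L).zpow_right l₁).inv_right
  have agree_i : (c ^ s i) (i, z.2 + d₁) = ((a ^ L) ^ w i) (i, z.2 + d₁) := by
    obtain ⟨hc1, hc2⟩ := hc_far i (z.2 + d₁) (by omega)
    obtain ⟨ha1, ha2⟩ := ha_far i (z.2 + d₁) (by omega)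
    refine Prod.ext (hc1.trans ha1.symm) ?_
    simp only [Pi.smul_apply, smul_eq_mul] at hc2 ha2
    rw [mul_comm] at ha2
    omega
  have agree_j : (c ^ s i) (j, ((a ^ k) z).2 + d₂) = ((a ^ L) ^ w i) (j, ((a ^ k) z).2 + d₂) := by
    rw [← hg, ← Perm.mul_apply, ← Perm.mul_apply, (hcomm (hca.zpow_left (s i))).eq,
      (hcomm (((Commute.refl a).pow_left L).zpow_left (w i))).eq, Perm.mul_apply g,
      Perm.mul_apply g, agree_i]
  have hc2 := (hc_far j (((a ^ k) z).2 + d₂) (by omega)).2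
  have ha2 := (ha_far j (((a ^ k) z).2 + d₂) (by omega)).2
  rw [agree_j, ha2] at hc2
  simp only [Pi.smul_apply, smul_eq_mul] at hc2
  linarith

theorem mul_drift_mem_commutingTranslations (hL : TranslatesFrom H (a ^ L) s) (hL0 : 0 < L)
    {f : Fin n → ℤ} (hf : ∀ z ∈ movingPart s H, ∀ k : ℕ, (a ^ k) z ∈ movingPart s H →
      f ((a ^ k) z).1 = f z.1) :
    (fun i => f i * s i) ∈ commutingTranslations a := by
  have hle := natAbs_le_sum fun i => f i * s i
  refine mem_commutingTranslations.2 <|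
    exists_commute_of_nonzero hL hL0 hle (fun i hi => by simp [hi]) (fun z hz k hk => ?_)
  have hcomm : Commute ((a ^ L) ^ f z.1) a := ((Commute.refl a).pow_left L).zpow_left _
  have hshift {y : RaySpace n} (hy : f y.1 = f z.1)
      (hyB : y ∈ movingPart s (H + ∑ i, (f i * s i).natAbs)) :
      ((a ^ L) ^ f z.1) y = shiftPoint (fun i => f i * s i) y := by
    rw [apply_eq_shiftPoint_of_commute hL (hL.translatesBy.zpow _) hcomm (hy ▸ hle y.1) hyB]
    simp only [shiftPoint, Pi.smul_apply, smul_eq_mul, hy]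
  have hH : H ≤ H + ∑ i, (f i * s i).natAbs := Nat.le_add_right _ _
  rw [← hshift rfl hz, ← hshift (hf z (movingPart_anti hH hz) k (movingPart_anti hH hk)) hk,
    ← Perm.mul_apply, ← Perm.mul_apply, (hcomm.pow_right k).eq]

theorem floor_div_mul_drift_mem (hL : TranslatesFrom H (a ^ L) s) (hL0 : 0 < L)
    (hw : w ∈ commutingTranslations a) (q : ℚ) :
    (fun i => ⌊(w i : ℚ) / (q * s i)⌋ * s i) ∈ commutingTranslations a := by
  refine mul_drift_mem_commutingTranslations hL hL0 (fun z hz k hk => ?_)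
  have hprop : (w z.1 * s ((a ^ k) z).1 : ℚ) = w ((a ^ k) z).1 * s z.1 := by
    exact_mod_cast mul_eq_mul_of_orbit hL hw hz hk
  have hz0 : (s z.1 : ℚ) ≠ 0 := by exact_mod_cast hz.1
  have hk0 : (s ((a ^ k) z).1 : ℚ) ≠ 0 := by exact_mod_cast hk.1
  congr 1
  rw [mul_comm q, ← div_div, mul_comm q, ← div_div, (div_eq_div_iff hk0 hz0).2 hprop.symm]

theorem natAbs_sub_floor_div_mul_le (w : ℤ) {c : ℤ} (hc : c ≠ 0) :
    (w - ⌊(w : ℚ) / c⌋ * c).natAbs ≤ c.natAbs := by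
  have hc' : (c : ℚ) ≠ 0 := by exact_mod_cast hc
  have hfract : ((w - ⌊(w : ℚ) / c⌋ * c : ℤ) : ℚ) = Int.fract ((w : ℚ) / c) * c := by
    rw [Int.fract]
    push_cast
    field_simp
  have habs : |((w - ⌊(w : ℚ) / c⌋ * c : ℤ) : ℚ)| ≤ |(c : ℚ)| := by
    rw [hfract, abs_mul, Int.abs_fract]
    exact mul_le_of_le_one_left (abs_nonneg _) (Int.fract_lt_one _).le
  zify
  exact_mod_cast habs

theorem RigidFrom.natAbs_sum_mod_two_mul_shiftVector_le (ha : RigidFrom M a)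
    (f : Fin n × Fin n → ℤ) (i : Fin n) :
    (∑ q, f q % 2 * ha.shiftVector s q i).natAbs ≤ n * n := by
  refine (Int.natAbs_sum_le _ _).trans ((Finset.sum_le_card_nsmul _ _ 1 fun q _ => ?_).trans ?_)
  · rw [Int.natAbs_mul]
    exact Nat.mul_le_mul (by omega : _ ≤ 1) (ha.natAbs_shiftVector_le q i)
  · simp

/-- On the rays without drift reduce the coefficients of the shift vectors modulo `2`, on the rays
with drift reduce modulo twice the drift. -/
theorem exists_bounded_add_two_smul (ha : RigidFrom M a) (hL : TranslatesFrom H (a ^ L) s)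
    (hL0 : 0 < L) (hB : n * n ≤ B) (hs : ∀ i, 2 * (s i).natAbs ≤ B)
    (hw : w ∈ commutingTranslations a) :
    ∃ ρ ∈ commutingTranslations a, ∃ v ∈ commutingTranslations a,
      (∀ i, (ρ i).natAbs ≤ B) ∧ w = ρ + (2 : ℤ) • v := by
  obtain ⟨f, hf⟩ := (isAdmissible_of_mem ha hL (natAbs_le_sum w) hw).exists_sum_shiftVector_eq
    ha hL hL0
  have hv := add_mem (sum_smul_shiftVector_mem ha hL hL0 fun q => f q / 2)
    (floor_div_mul_drift_mem hL hL0 hw 2)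
  set v := ∑ q, (f q / 2) • ha.shiftVector s q + fun i => ⌊(w i : ℚ) / (2 * s i)⌋ * s i with hv_def
  refine ⟨w - (2 : ℤ) • v, sub_mem hw (zsmul_mem hv 2), v, hv, fun i => ?_, by abel⟩
  by_cases hi : s i = 0
  · suffices (w - (2 : ℤ) • v) i = ∑ q, f q % 2 * ha.shiftVector s q i by
      rw [this]
      exact (ha.natAbs_sum_mod_two_mul_shiftVector_le f i).trans hB
    have hwi := congrFun hf i
    simp only [hi, if_true, Finset.sum_apply, Pi.smul_apply, smul_eq_mul] at hwi
    simp only [hv_def, Pi.sub_apply, Pi.smul_apply, Pi.add_apply, Finset.sum_apply, smul_eq_mul,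
      hi, mul_zero, add_zero]
    rw [← hwi, Finset.mul_sum, ← Finset.sum_sub_distrib]
    refine Finset.sum_congr rfl fun q _ => ?_
    rw [Int.emod_def]
    ring
  · suffices (w - (2 : ℤ) • v) i = w i - ⌊(w i : ℚ) / (2 * s i : ℤ)⌋ * (2 * s i) by
      rw [this]
      refine (natAbs_sub_floor_div_mul_le (w i) (by omega)).trans ?_
      rw [Int.natAbs_mul]
      exact hs i
    simp only [hv_def, Pi.sub_apply, Pi.smul_apply, Pi.add_apply, Finset.sum_apply, smul_eq_mul,
      ha.shiftVector_eq_zero hL _ hi, mul_zero, Finset.sum_const_zero, zero_add]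
    push_cast
    ring

end CommutingTranslations

/-! ### Parity of finitary permutations -/

section Parity

variable {α : Type*} [DecidableEq α]

/-- `f` is a product of transpositions whose number has parity `e`. -/
def HasParity (f : Perm α) (e : ZMod 2) : Prop :=
  ∃ l : List (Perm α), (∀ g ∈ l, g.IsSwap) ∧ (l.length : ZMod 2) = e ∧ l.prod = f

variable {f g h : Perm α} {e e' : ZMod 2}

theorem HasParity.one : HasParity (1 : Perm α) 0 := ⟨[], by simp⟩

theorem HasParity.of_isSwap (hf : f.IsSwap) : HasParity f 1 := ⟨[f], by simp [hf]⟩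

theorem HasParity.mul (hf : HasParity f e) (hg : HasParity g e') : HasParity (f * g) (e + e') := by
  obtain ⟨l, hl, rfl, rfl⟩ := hf
  obtain ⟨l', hl', rfl, rfl⟩ := hg
  exact ⟨l ++ l', by simpa [or_imp, forall_and] using ⟨hl, hl'⟩, by simp, by simp⟩

theorem HasParity.pow (hf : HasParity f e) (k : ℕ) : HasParity (f ^ k) (k * e) := by
  induction k with
  | zero => simpa using HasParity.one
  | succ k ih =>
    rw [pow_succ, Nat.cast_succ, add_one_mul]
    exact ih.mul hf

theorem HasParity.inv (hf : HasParity f e) : HasParity f⁻¹ e := by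
  obtain ⟨l, hl, rfl, rfl⟩ := hf
  refine ⟨l.reverse, by simpa using hl, by simp, ?_⟩
  rw [List.prod_inv_reverse, List.map_congr_left (g := id), List.map_id]
  intro f hf
  obtain ⟨x, y, -, rfl⟩ := hl f hf
  exact swap_inv x y

theorem HasParity.permCongr {β : Type*} [DecidableEq β] (φ : α ≃ β) (hf : HasParity f e) :
    HasParity (φ.permCongr f) e := by
  obtain ⟨l, hl, rfl, rfl⟩ := hf
  refine ⟨l.map φ.permCongrHom, fun g hg => ?_, by simp, (map_list_prod φ.permCongrHom l).symm⟩
  obtain ⟨f, hf, rfl⟩ := List.mem_map.1 hg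
  obtain ⟨x, y, hxy, rfl⟩ := hl f hf
  exact ⟨φ x, φ y, φ.injective.ne hxy, Equiv.ext fun z => by
    simp [permCongrHom, permCongr_apply, swap_apply_def, symm_apply_eq, apply_ite φ]⟩

theorem HasParity.conj (hf : HasParity f e) (h : Perm α) : HasParity (h * f * h⁻¹) e :=
  hf.permCongr h

theorem hasParity_ofSubtype {s : Finset α} (σ : Perm s) :
    ∃ k : ℕ, Perm.sign σ = (-1) ^ k ∧ HasParity (Perm.ofSubtype σ) k := by
  induction σ using Perm.swap_induction_on with
  | one => exact ⟨0, by simp, by simpa using HasParity.one⟩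
  | swap_mul σ x y hxy ih =>
    obtain ⟨k, hsign, hk⟩ := ih
    refine ⟨k + 1, by rw [Perm.sign_mul, Perm.sign_swap hxy, hsign, pow_succ'], ?_⟩
    rw [map_mul, Perm.ofSubtype_swap_eq, Nat.cast_add, Nat.cast_one, add_comm]
    exact HasParity.mul (.of_isSwap ⟨x, y, Subtype.coe_injective.ne hxy, rfl⟩) hk

theorem exists_ofSubtype_eq_prod (l : List (Perm α)) (hl : ∀ g ∈ l, g.IsSwap) :
    ∃ s₀ : Finset α, ∀ s : Finset α, s₀ ⊆ s → ∃ σ : Perm s, Perm.sign σ = (-1) ^ l.length ∧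
      Perm.ofSubtype σ = l.prod := by
  induction l with
  | nil => exact ⟨∅, fun s _ => ⟨1, by simp⟩⟩
  | cons g l ih =>
    obtain ⟨s₀, hs₀⟩ := ih fun g hg => hl g (List.mem_cons_of_mem _ hg)
    obtain ⟨u, v, huv, rfl⟩ := hl g List.mem_cons_self
    refine ⟨insert u (insert v s₀), fun s hs => ?_⟩
    obtain ⟨σ, hsign, hσ⟩ := hs₀ s fun x hx => hs (by simp [hx])
    refine ⟨swap ⟨u, hs (by simp)⟩ ⟨v, hs (by simp)⟩ * σ, ?_, ?_⟩
    · rw [Perm.sign_mul, Perm.sign_swap (by simpa using huv), hsign, List.length_cons, pow_succ']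
    · rw [map_mul, Perm.ofSubtype_swap_eq, hσ, List.prod_cons]

theorem HasParity.exists_ofSubtype (hf : HasParity f e) :
    ∃ (s : Finset α) (σ : Perm s) (k : ℕ), Perm.sign σ = (-1) ^ k ∧ (k : ZMod 2) = e ∧
      f = Perm.ofSubtype σ := by
  obtain ⟨l, hl, rfl, rfl⟩ := hf
  obtain ⟨s, hs⟩ := exists_ofSubtype_eq_prod l hl
  obtain ⟨σ, hsign, hσ⟩ := hs s subset_rfl
  exact ⟨s, σ, _, hsign, rfl, hσ.symm⟩

theorem neg_one_units_pow_eq_one_iff {k : ℕ} : (-1 : ℤˣ) ^ k = 1 ↔ (k : ZMod 2) = 0 := by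
  rw [ZMod.natCast_eq_zero_iff_even, neg_one_pow_eq_one_iff_even (by decide)]

theorem mem_finitaryAlternating_iff : f ∈ finitaryAlternating α ↔ HasParity f 0 := by
  constructor
  · rintro ⟨s, σ, hσ, rfl⟩
    obtain ⟨k, hk, hpar⟩ := hasParity_ofSubtype σ
    rwa [neg_one_units_pow_eq_one_iff.1 (hk.symm.trans hσ)] at hpar
  · intro hf
    obtain ⟨s, σ, k, hsign, hk, rfl⟩ := hf.exists_ofSubtype
    exact ⟨s, σ, by rw [hsign, neg_one_units_pow_eq_one_iff, hk], rfl⟩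

theorem not_hasParity_one_one : ¬ HasParity (1 : Perm α) 1 := by
  intro h
  obtain ⟨s, σ, k, hsign, hk, hσ⟩ := h.exists_ofSubtype
  obtain rfl : σ = 1 := Perm.ofSubtype_injective (by rw [← hσ, map_one])
  rw [map_one, eq_comm, neg_one_units_pow_eq_one_iff, hk] at hsign
  exact one_ne_zero hsign

theorem eq_zero_or_eq_one_zmod_two (e : ZMod 2) : e = 0 ∨ e = 1 := by
  revert e
  decide

theorem HasParity.unique (hf : HasParity f e) (hf' : HasParity f e') : e = e' := by
  have h := hf.mul hf'.inv
  rw [mul_inv_cancel] at h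
  rcases eq_zero_or_eq_one_zmod_two (e + e') with hee | hee
  · rwa [CharTwo.add_eq_zero] at hee
  · exact absurd (hee ▸ h) not_hasParity_one_one

theorem exists_hasParity_of_finite (s : Finset α) (hs : ∀ x, f x ≠ x → x ∈ s) :
    ∃ e, HasParity f e := by
  have hfs (x : α) : f x ∈ s ↔ x ∈ s := by
    by_cases hx : f x = x
    · rw [hx]
    · exact iff_of_true (hs _ fun h => hx (f.injective h)) (hs x hx)
  obtain ⟨k, -, hk⟩ := hasParity_ofSubtype (f.subtypePerm hfs : Perm s)
  rw [Perm.ofSubtype_subtypePerm hfs hs] at hk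
  exact ⟨k, hk⟩

variable (α) in
/-- The finitary alternating group, as a subgroup. -/
def evenSubgroup : Subgroup (Perm α) where
  carrier := {f | HasParity f 0}
  one_mem' := .one
  mul_mem' h h' := by simpa using HasParity.mul h h'
  inv_mem' h := HasParity.inv h

theorem mem_evenSubgroup : f ∈ evenSubgroup α ↔ HasParity f 0 := Iff.rfl

instance : (evenSubgroup α).Normal := ⟨fun _ hf h => HasParity.conj hf h⟩

/-- `h` is the product of a finitary permutation of parity `e` and an element of the subgroup
generated by `G`. The parity of `h` modulo `G` need not be unique. -/
def HasParityModulo (G : Set (Perm α)) (h : Perm α) (e : ZMod 2) : Prop :=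
  ∃ u ∈ Subgroup.closure G, HasParity (h * u⁻¹) e

variable {G : Set (Perm α)}

theorem HasParity.modulo (hf : HasParity f e) : HasParityModulo G f e :=
  ⟨1, one_mem _, by simpa using hf⟩

namespace HasParityModulo

theorem of_mem_closure (hf : f ∈ Subgroup.closure G) : HasParityModulo G f 0 :=
  ⟨f, hf, by simpa using HasParity.one⟩

theorem mul (hf : HasParityModulo G f e) (hg : HasParityModulo G g e') :
    HasParityModulo G (f * g) (e + e') := by
  obtain ⟨u, hu, hfu⟩ := hf
  obtain ⟨v, hv, hgv⟩ := hg
  refine ⟨u * v, mul_mem hu hv, ?_⟩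
  convert hfu.mul (hgv.conj u) using 1
  group

theorem inv (hf : HasParityModulo G f e) : HasParityModulo G f⁻¹ e := by
  obtain ⟨u, hu, hfu⟩ := hf
  refine ⟨u⁻¹, inv_mem hu, ?_⟩
  convert hfu.inv.conj u⁻¹ using 1
  group

theorem permCongr {β : Type*} [DecidableEq β] (φ : α ≃ β) (hf : HasParityModulo G f e) :
    HasParityModulo (φ.permCongr '' G) (φ.permCongr f) e := by
  obtain ⟨u, hu, hfu⟩ := hf
  refine ⟨φ.permCongr u, (MonoidHom.map_closure φ.permCongrHom.toMonoidHom G).le ⟨u, hu, rfl⟩, ?_⟩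
  convert hfu.permCongr φ using 1
  exact (map_mul_inv φ.permCongrHom f u).symm

end HasParityModulo

theorem mem_closure_finitaryAlternating_union_iff :
    h ∈ Subgroup.closure (finitaryAlternating α ∪ G) ↔ HasParityModulo G h 0 := by
  have hAlt : finitaryAlternating α = evenSubgroup α :=
    Set.ext fun _ => mem_finitaryAlternating_iff
  rw [Subgroup.closure_union, hAlt, Subgroup.closure_eq, Subgroup.mem_sup_of_normal_left]
  constructor
  · rintro ⟨f, hf, u, hu, rfl⟩
    exact ⟨u, hu, by simpa using mem_evenSubgroup.1 hf⟩
  · rintro ⟨u, hu, hf⟩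
    exact ⟨_, hf, u, hu, by simp⟩

end Parity

theorem pow_mul_pow_eq_of_mul_eq {Q : Type*} [Monoid Q] {x y t : Q} (hx : Commute t x)
    (hy : Commute t y) (h : x * y = y * x * t) (m k : ℕ) :
    x ^ m * y ^ k = y ^ k * x ^ m * t ^ (m * k) := by
  have hpow (m : ℕ) : x ^ m * y = y * x ^ m * t ^ m := by
    induction m with
    | zero => simp
    | succ m ih =>
      calc x ^ (m + 1) * y = x ^ m * y * x * t := by rw [pow_succ, mul_assoc, h]; simp [mul_assoc]
        _ = y * x ^ m * (t ^ m * x) * t := by rw [ih]; simp only [mul_assoc]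
        _ = y * x ^ (m + 1) * t ^ (m + 1) := by
          rw [(hx.pow_left m).eq, pow_succ, pow_succ]; simp only [mul_assoc]
  induction k with
  | zero => simp
  | succ k ih =>
    calc x ^ m * y ^ (k + 1) = y ^ k * x ^ m * (t ^ (m * k) * y) := by
          rw [pow_succ, ← mul_assoc, ih]; simp only [mul_assoc]
      _ = y ^ k * (x ^ m * y) * t ^ (m * k) := by rw [(hy.pow_left _).eq]; simp only [mul_assoc]
      _ = y ^ (k + 1) * x ^ m * t ^ (m * (k + 1)) := by
          rw [hpow, pow_succ, mul_add_one, add_comm (m * k), pow_add]; simp only [mul_assoc]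

theorem exists_pi_hom_of_pairwise_commute {ι Q : Type*} [Finite ι] [DecidableEq ι] [Group Q]
    {x : ι → Q} (hx : Pairwise fun i j => Commute (x i) (x j)) :
    ∃ Φ : (ι → Multiplicative ℤ) →* Q, ∀ i, Φ (Pi.mulSingle i (Multiplicative.ofAdd 1)) = x i := by
  have := Fintype.ofFinite ι
  refine ⟨MonoidHom.noncommPiCoprod (fun i => zpowersHom Q (x i)) fun i j hij k l => ?_,
    fun i => (MonoidHom.noncommPiCoprod_mulSingle _ _ _).trans (by simp)⟩
  simpa only [zpowersHom_apply] using (hx hij).zpow_zpow _ _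

section EvenQuotient

variable {α : Type*} [DecidableEq α] {τ : Perm α}

theorem commute_mk_of_isSwap (hτ : τ.IsSwap) (x : Perm α ⧸ evenSubgroup α) :
    Commute (τ : Perm α ⧸ evenSubgroup α) x := by
  obtain ⟨g, rfl⟩ := QuotientGroup.mk_surjective x
  refine QuotientGroup.eq.2 (mem_evenSubgroup.2 ?_)
  convert ((HasParity.of_isSwap hτ).inv.conj g⁻¹).mul (.of_isSwap hτ) using 1
  · simp [mul_assoc]
  · decide

theorem mk_sq_of_isSwap (hτ : τ.IsSwap) : (τ : Perm α ⧸ evenSubgroup α) ^ 2 = 1 := by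
  obtain ⟨x, y, -, rfl⟩ := hτ
  rw [← QuotientGroup.mk_pow, pow_two, swap_mul_self, QuotientGroup.mk_one]

theorem hasParity_inv_mul_of_mk_eq {f g : Perm α} (hτ : τ.IsSwap)
    (h : (f : Perm α ⧸ evenSubgroup α) = g * τ) : HasParity (f⁻¹ * g) 1 := by
  have heven : HasParity (f⁻¹ * (g * τ)) 0 := QuotientGroup.eq.1 h
  rw [← zero_add (1 : ZMod 2)]
  convert heven.mul (HasParity.of_isSwap hτ).inv using 1
  simp [mul_assoc]

end EvenQuotient

section RayShifts

variable {n : ℕ} {i j k : Fin n}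

theorem rayShift_translatesBy (hij : i ≠ j) :
    TranslatesBy (rayShift i j hij) (Pi.single i 1 - Pi.single j 1) := by
  refine ⟨1, fun l m hm => ?_⟩
  simp only [rayShift, coe_fn_mk, Pi.sub_apply, Pi.single_apply]
  grind

theorem rayShift_rigidFrom (hij : i ≠ j) : RigidFrom 1 (rayShift i j hij) := by
  intro l k
  simp only [rayShift, coe_fn_mk]
  grind

theorem rayShift_mul_rayShift (hij : i ≠ j) (hik : i ≠ k) (hjk : j ≠ k) :
    rayShift i j hij * rayShift i k hik =
      rayShift i k hik * rayShift i j hij * swap (j, 0) (k, 0) := by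
  ext1 ⟨l, m⟩
  simp only [Perm.mul_apply, swap_apply_def]
  simp only [rayShift, coe_fn_mk]
  grind

theorem isSwap_swap_ray (hjk : j ≠ k) (m : ℕ) : (swap (j, m) (k, m)).IsSwap :=
  ⟨_, _, by simp [hjk], rfl⟩

theorem mk_rayShift_pow_mul_pow (hij : i ≠ j) (hik : i ≠ k) (hjk : j ≠ k) (p q : ℕ) :
    (rayShift i j hij : Perm (RaySpace n) ⧸ evenSubgroup (RaySpace n)) ^ p *
        (rayShift i k hik : Perm (RaySpace n) ⧸ evenSubgroup (RaySpace n)) ^ q =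
      (rayShift i k hik : Perm (RaySpace n) ⧸ evenSubgroup (RaySpace n)) ^ q *
        (rayShift i j hij : Perm (RaySpace n) ⧸ evenSubgroup (RaySpace n)) ^ p *
        ((swap (j, 0) (k, 0) : Perm (RaySpace n)) :
          Perm (RaySpace n) ⧸ evenSubgroup (RaySpace n)) ^ (p * q) :=
  pow_mul_pow_eq_of_mul_eq (commute_mk_of_isSwap (isSwap_swap_ray hjk 0) _)
    (commute_mk_of_isSwap (isSwap_swap_ray hjk 0) _)
    (congrArg QuotientGroup.mk (rayShift_mul_rayShift hij hik hjk)) p q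

theorem HasParity.translatesBy {e : ZMod 2} {f : Perm (RaySpace n)} (hf : HasParity f e) :
    TranslatesBy f 0 := by
  obtain ⟨s, σ, -, -, -, rfl⟩ := hf.exists_ofSubtype
  refine ⟨∑ z ∈ s, z.2 + 1, fun i m hm => ?_⟩
  rw [Perm.ofSubtype_apply_of_not_mem]
  · simp
  · intro hmem
    have : m ≤ ∑ z ∈ s, z.2 :=
      Finset.single_le_sum (f := fun z : RaySpace n => z.2) (fun _ _ => Nat.zero_le _) hmem
    omega

theorem TranslatesBy.exists_hasParity {f : Perm (RaySpace n)} (hf : TranslatesBy f 0) :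
    ∃ e, HasParity f e := by
  obtain ⟨M, hM⟩ := hf
  refine exists_hasParity_of_finite (Finset.univ ×ˢ Finset.range M) fun z hz => ?_
  by_contra h
  exact hz (hM.apply (by simpa using h) (by simp))

/-- The powers `g_i ^ p`. -/
def shiftPowers (hn : 2 ≤ n) (p : ℕ) : Set (Perm (RaySpace n)) :=
  {g | ∃ (i : Fin n) (hi : ray₁ hn ≠ i), g = rayShift (ray₁ hn) i hi ^ p}

variable {hn : 2 ≤ n} {p : ℕ} {h : Perm (RaySpace n)} {e : ZMod 2}

theorem mem_subgroupU_iff : h ∈ subgroupU hn p ↔ HasParityModulo (shiftPowers hn p) h 0 :=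
  mem_closure_finitaryAlternating_union_iff

/-- The commutator of `g_2 ^ p` and `g_3 ^ p` is a product of `p * p` transpositions, up to an
even permutation. -/
theorem exists_odd_mem_closure_shiftPowers (h3 : 3 ≤ n) (hp : Odd p) :
    ∃ u ∈ Subgroup.closure (shiftPowers hn p), HasParity u 1 := by
  let j : Fin n := ray₂ hn
  let k : Fin n := ⟨2, h3⟩
  have hij : ray₁ hn ≠ j := ray₁_ne_ray₂ hn
  have hik : ray₁ hn ≠ k := by simp [ray₁, k]
  have hjk : j ≠ k := by simp [ray₂, j, k]
  have hτ := isSwap_swap_ray hjk 0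
  have hx : rayShift _ j hij ^ p ∈ Subgroup.closure (shiftPowers hn p) :=
    Subgroup.subset_closure ⟨j, hij, rfl⟩
  have hy : rayShift _ k hik ^ p ∈ Subgroup.closure (shiftPowers hn p) :=
    Subgroup.subset_closure ⟨k, hik, rfl⟩
  refine ⟨_, mul_mem (inv_mem (mul_mem hx hy)) (mul_mem hy hx), hasParity_inv_mul_of_mk_eq hτ ?_⟩
  obtain ⟨q, hq⟩ := hp.mul hp
  have hcomm := mk_rayShift_pow_mul_pow hij hik hjk p p
  rwa [hq, pow_succ _ (2 * q), pow_mul _ 2 q, mk_sq_of_isSwap hτ, one_pow, one_mul]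
    at hcomm

theorem mk_shiftPowers_pairwise_commute (hnp : n = 2 ∨ Even p) :
    Pairwise fun i j : {i : Fin n // ray₁ hn ≠ i} => Commute
      ((rayShift (ray₁ hn) i.1 i.2 ^ p : Perm (RaySpace n)) :
        Perm (RaySpace n) ⧸ evenSubgroup (RaySpace n))
      ((rayShift (ray₁ hn) j.1 j.2 ^ p : Perm (RaySpace n)) :
        Perm (RaySpace n) ⧸ evenSubgroup (RaySpace n)) := by
  rintro ⟨i, hi⟩ ⟨j, hj⟩ hij
  have hij' : i ≠ j := fun h => hij (Subtype.ext h)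
  rcases hnp with rfl | hp
  · simp only [ray₁] at hi hj
    omega
  · obtain ⟨q, hq⟩ := (hp.mul_right p).two_dvd
    have hcomm := mk_rayShift_pow_mul_pow hi hj hij' p p
    rwa [hq, pow_mul _ 2 q, mk_sq_of_isSwap (isSwap_swap_ray hij' 0), one_pow, mul_one]
      at hcomm

/-- Modulo even permutations the `g_i ^ p` commute, and the translation of an element of the
subgroup generated by them determines the exponents. -/
theorem hasParity_zero_of_mem_closure_shiftPowers (hp : 1 ≤ p) (hnp : n = 2 ∨ Even p)
    {u : Perm (RaySpace n)} (hu : u ∈ Subgroup.closure (shiftPowers hn p))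
    (hu0 : TranslatesBy u 0) : HasParity u 0 := by
  obtain ⟨Φ, hΦ⟩ := exists_pi_hom_of_pairwise_commute
    (mk_shiftPowers_pairwise_commute (hn := hn) hnp)
  obtain ⟨k, hk, hray⟩ : ∃ k, (u : Perm (RaySpace n) ⧸ evenSubgroup (RaySpace n)) = Φ k ∧
      ∀ i, TranslatesRay u i.1 (-(p * (k i).toAdd)) := by
    clear hu0
    induction hu using Subgroup.closure_induction with
    | mem y hy =>
      obtain ⟨i, hi, rfl⟩ := hy
      refine ⟨Pi.mulSingle ⟨i, hi⟩ (Multiplicative.ofAdd 1), (hΦ ⟨i, hi⟩).symm,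
        fun ⟨j, hj⟩ => ?_⟩
      convert (rayShift_translatesBy hi).ray j |>.pow p using 1
      by_cases hij : j = i
      · subst hij
        simp [hj.symm]
      · simp [hj.symm, hij]
    | one => exact ⟨1, by simp, fun i => by simpa using TranslatesBy.one.ray i.1⟩
    | mul y z _ _ hy hz =>
      obtain ⟨k, hk, hyk⟩ := hy
      obtain ⟨l, hl, hzl⟩ := hz
      refine ⟨k * l, by rw [map_mul, ← hk, ← hl]; rfl, fun i => ?_⟩
      convert (hyk i).mul (hzl i) using 1
      rw [Pi.mul_apply, toAdd_mul]
      ring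
    | inv y _ hy =>
      obtain ⟨k, hk, hyk⟩ := hy
      exact ⟨k⁻¹, by rw [map_inv, ← hk]; rfl, fun i => by simpa using (hyk i).inv⟩
  obtain rfl : k = 1 := funext fun i => by
    have := (hray i).unique (hu0.ray i)
    have hp0 : p ≠ 0 := by omega
    simpa [hp0] using this
  exact (QuotientGroup.eq_one_iff u).1 (hk.trans (map_one Φ))

theorem not_hasParityModulo_one_one (hp : 1 ≤ p) (hnp : n = 2 ∨ Even p) :
    ¬ HasParityModulo (shiftPowers hn p) 1 1 := by
  rintro ⟨u, hu, hpar⟩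
  rw [one_mul] at hpar
  have hodd : HasParity u 1 := inv_inv u ▸ hpar.inv
  have heven := hasParity_zero_of_mem_closure_shiftPowers hp hnp hu hodd.translatesBy
  exact zero_ne_one (heven.unique hodd)

theorem HasParityModulo.exists_translatesBy (hh : HasParityModulo (shiftPowers hn p) h e) :
    ∃ k : Fin n → ℤ, TranslatesBy h (p • k) := by
  obtain ⟨u, hu, hpar⟩ := hh
  obtain ⟨k, hk⟩ : ∃ k : Fin n → ℤ, TranslatesBy u (p • k) := by
    clear hpar
    induction hu using Subgroup.closure_induction with
    | mem y hy =>
      obtain ⟨i, hi, rfl⟩ := hy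
      exact ⟨_, (rayShift_translatesBy hi).pow p⟩
    | one => exact ⟨0, by simpa using TranslatesBy.one⟩
    | mul y z _ _ hy hz =>
      obtain ⟨k, hk⟩ := hy
      obtain ⟨l, hl⟩ := hz
      exact ⟨k + l, smul_add p k l ▸ hk.mul hl⟩
    | inv y _ hy =>
      obtain ⟨k, hk⟩ := hy
      exact ⟨-k, smul_neg p k ▸ hk.inv⟩
  exact ⟨k, by simpa using hpar.translatesBy.mul hk⟩

theorem sum_neg_smul_single_sub_single {ι : Type*} [Fintype ι] [DecidableEq ι] {k : ι → ℤ}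
    (hk : ∑ i, k i = 0) (r : ι) : ∑ i, -k i • (Pi.single r 1 - Pi.single i 1 : ι → ℤ) = k := by
  simp only [smul_sub, Finset.sum_sub_distrib, ← Finset.sum_smul, Finset.sum_neg_distrib, hk]
  funext j
  simp [Pi.single_apply]

theorem smul_mem_translationVectors {k : Fin n → ℤ} (hk : ∑ i, k i = 0) :
    p • k ∈ translationVectors (Subgroup.closure (shiftPowers hn p)) := by
  rw [← sum_neg_smul_single_sub_single hk (ray₁ hn), Finset.smul_sum]
  refine sum_mem fun i _ => ?_
  rw [smul_comm]
  refine zsmul_mem ?_ _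
  by_cases hi : ray₁ hn = i
  · rw [hi, sub_self, smul_zero]
    exact zero_mem _
  · exact ⟨_, Subgroup.subset_closure ⟨i, hi, rfl⟩, (rayShift_translatesBy hi).pow p⟩

theorem exists_hasParityModulo_of_translatesBy (hn : 2 ≤ n) (hp : 1 ≤ p) {k : Fin n → ℤ}
    (hh : TranslatesBy h (p • k)) : ∃ e, HasParityModulo (shiftPowers hn p) h e := by
  have hsum : ∑ i, k i = 0 := by
    have := hh.sum_eq_zero
    simp only [Pi.smul_apply, nsmul_eq_mul, ← Finset.mul_sum] at this
    exact (mul_eq_zero.1 this).resolve_left (by omega)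
  obtain ⟨u, hu, hut⟩ := smul_mem_translationVectors (hn := hn) (p := p) hsum
  have hdiff := hh.mul hut.inv
  rw [add_neg_cancel] at hdiff
  obtain ⟨e, he⟩ := hdiff.exists_hasParity
  exact ⟨e, u, hu, he⟩

theorem mem_subgroupU_iff_exists : h ∈ subgroupU hn p ↔
    ∃ e, HasParityModulo (shiftPowers hn p) h e ∧ (e = 0 ∨ 3 ≤ n ∧ Odd p) := by
  rw [mem_subgroupU_iff]
  refine ⟨fun hh => ⟨0, hh, Or.inl rfl⟩, ?_⟩
  rintro ⟨e, hh, rfl | ⟨h3, hp⟩⟩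
  · exact hh
  · rcases eq_zero_or_eq_one_zmod_two e with rfl | rfl
    · exact hh
    · obtain ⟨u, hu, hodd⟩ := exists_odd_mem_closure_shiftPowers (hn := hn) h3 hp
      simpa [CharTwo.add_self_eq_zero] using
        (HasParityModulo.of_mem_closure hu).mul (hodd.inv.modulo.mul hh)

theorem notMem_subgroupU_of_hasParityModulo_one (hp : 1 ≤ p) (hnp : ¬ (3 ≤ n ∧ Odd p))
    (hh : HasParityModulo (shiftPowers hn p) h 1) : h ∉ subgroupU hn p := by
  rw [mem_subgroupU_iff]
  intro h0
  refine not_hasParityModulo_one_one hp ?_ (by simpa using hh.mul h0.inv)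
  rw [not_and_or, Nat.not_odd_iff_even] at hnp
  exact hnp.imp_left (by omega)

end RayShifts

/-! ### The image of `U_p` in `Sym(X_{np})` -/

section Transport

variable {n p : ℕ}

/-- The images in `Sym(X_{np})` of the powers `g_i ^ p`. -/
def blockShifts (hn : 2 ≤ n) (hp : 1 ≤ p) : Set (Perm (RaySpace (n * p))) :=
  (raySplit n p hp).permCongr '' shiftPowers hn p

/-- The block of `p` rays containing the ray `l`, that is, the ray of `X_n` that contains the
preimage of the ray `l` of `X_{np}`. -/
def rayBlock (l : Fin (n * p)) : Fin n := (finProdFinEquiv.symm l).1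

theorem rayBlock_finProdFinEquiv (i : Fin n) (d : Fin p) :
    rayBlock (finProdFinEquiv (i, d)) = i :=
  congrArg Prod.fst (finProdFinEquiv.symm_apply_apply (i, d))

theorem raySplit_apply (hp : 1 ≤ p) (i : Fin n) (d : Fin p) (q : ℕ) :
    raySplit n p hp (i, d + p * q) = (finProdFinEquiv (i, d), q) := by
  simp only [raySplit, coe_fn_mk, Nat.add_mul_mod_self_left, Nat.mod_eq_of_lt d.2,
    Nat.add_mul_div_left _ _ hp, Nat.div_eq_of_lt d.2, zero_add]

theorem raySplit_permCongr_apply_eq_iff (hp : 1 ≤ p) {h : Perm (RaySpace n)} {i : Fin n}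
    {d : Fin p} {q u : ℕ} :
    (raySplit n p hp).permCongr h (finProdFinEquiv (i, d), q) = (finProdFinEquiv (i, d), u) ↔
      h (i, d + p * q) = (i, d + p * u) := by
  rw [permCongr_apply, ← raySplit_apply hp, ← raySplit_apply hp, symm_apply_apply,
    (raySplit n p hp).injective.eq_iff]

theorem translatesBy_permCongr_iff (hp : 1 ≤ p) {h : Perm (RaySpace n)} {k : Fin n → ℤ} :
    TranslatesBy ((raySplit n p hp).permCongr h) (fun l => k (rayBlock l)) ↔
      TranslatesBy h (p • k) := by
  constructor
  · rintro ⟨M, hM⟩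
    refine ⟨p * M, fun i m hm => ?_⟩
    let d : Fin p := ⟨m % p, Nat.mod_lt _ hp⟩
    have hq : M ≤ m / p := (Nat.le_div_iff_mul_le hp).2 (by rwa [mul_comm])
    obtain ⟨hray, hu⟩ := hM (finProdFinEquiv (i, d)) (m / p) hq
    obtain ⟨u, hval⟩ : ∃ u, (raySplit n p hp).permCongr h (finProdFinEquiv (i, d), m / p) =
        (finProdFinEquiv (i, d), u) := ⟨_, Prod.ext hray rfl⟩
    have hmod : (d : ℕ) + p * (m / p) = m := Nat.mod_add_div m p
    have happly := (raySplit_permCongr_apply_eq_iff hp).1 hval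
    rw [hmod] at happly
    simp only [hval, rayBlock_finProdFinEquiv] at hu
    refine happly ▸ ⟨rfl, ?_⟩
    zify at hmod
    push_cast
    rw [hu, Pi.smul_apply, nsmul_eq_mul, ← hmod]
    push_cast
    ring
  · rintro ⟨M, hM⟩
    refine ⟨M + ∑ i, (k i).natAbs, fun l q hq => ?_⟩
    obtain ⟨⟨i, d⟩, rfl⟩ := finProdFinEquiv.surjective l
    have hle := natAbs_le_sum k i
    have hpq : q ≤ p * q := Nat.le_mul_of_pos_left q hp
    obtain ⟨u, hu⟩ : ∃ u : ℕ, (u : ℤ) = q + k i := ⟨(q + k i).toNat, by omega⟩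
    rw [(raySplit_permCongr_apply_eq_iff hp (u := u)).2 (hM.apply (by omega) ?_)]
    · exact ⟨rfl, by simpa only [rayBlock_finProdFinEquiv] using hu⟩
    · push_cast
      rw [hu, Pi.smul_apply, nsmul_eq_mul]
      ring

variable {e : ZMod 2}

theorem hasParityModulo_blockShifts_iff {hn : 2 ≤ n} {hp : 1 ≤ p} {h : Perm (RaySpace n)} :
    HasParityModulo (blockShifts hn hp) ((raySplit n p hp).permCongr h) e ↔
      HasParityModulo (shiftPowers hn p) h e := by
  refine ⟨fun hh => ?_, fun hh => hh.permCongr _⟩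
  have hsymm : ⇑(raySplit n p hp).symm.permCongr ∘ ⇑(raySplit n p hp).permCongr = id := by
    funext g
    ext1 z
    simp [permCongr_apply]
  have := hh.permCongr (raySplit n p hp).symm
  rwa [blockShifts, ← Set.image_comp, hsymm, Set.image_id,
    show (raySplit n p hp).symm.permCongr _ = h from congrFun hsymm h] at this

theorem permCongr_mem_imageU_iff {hn : 2 ≤ n} {hp : 1 ≤ p} {h : Perm (RaySpace n)} :
    (raySplit n p hp).permCongr h ∈ imageU hn hp ↔ h ∈ subgroupU hn p :=
  Subgroup.mem_map_iff_mem (raySplit n p hp).permCongrHom.injective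

variable {hn : 2 ≤ n} {hp : 1 ≤ p} {y : Perm (RaySpace (n * p))}

theorem mem_imageU_iff : y ∈ imageU hn hp ↔
    ∃ e, HasParityModulo (blockShifts hn hp) y e ∧ (e = 0 ∨ 3 ≤ n ∧ Odd p) := by
  obtain ⟨h, rfl⟩ := (raySplit n p hp).permCongr.surjective y
  simp only [hasParityModulo_blockShifts_iff, permCongr_mem_imageU_iff, mem_subgroupU_iff_exists]

theorem notMem_imageU_of_hasParityModulo_one (hnp : ¬ (3 ≤ n ∧ Odd p))
    (hy : HasParityModulo (blockShifts hn hp) y 1) : y ∉ imageU hn hp := by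
  obtain ⟨h, rfl⟩ := (raySplit n p hp).permCongr.surjective y
  rw [hasParityModulo_blockShifts_iff] at hy
  rw [permCongr_mem_imageU_iff]
  exact notMem_subgroupU_of_hasParityModulo_one hp hnp hy

theorem HasParityModulo.exists_block_translatesBy (hy : HasParityModulo (blockShifts hn hp) y e) :
    ∃ k : Fin n → ℤ, TranslatesBy y fun l => k (rayBlock l) := by
  obtain ⟨h, rfl⟩ := (raySplit n p hp).permCongr.surjective y
  rw [hasParityModulo_blockShifts_iff] at hy
  simpa only [translatesBy_permCongr_iff] using hy.exists_translatesBy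

theorem exists_hasParityModulo_of_block_translatesBy (hn : 2 ≤ n) (hp : 1 ≤ p) {k : Fin n → ℤ}
    (hy : TranslatesBy y fun l => k (rayBlock l)) :
    ∃ e, HasParityModulo (blockShifts hn hp) y e := by
  obtain ⟨h, rfl⟩ := (raySplit n p hp).permCongr.surjective y
  simp only [hasParityModulo_blockShifts_iff]
  exact exists_hasParityModulo_of_translatesBy hn hp ((translatesBy_permCongr_iff hp).1 hy)

end Transport

/-! ### Finitary permutations in the centralizer -/

section FinitaryCentralizer

variable {α : Type*}

theorem pow_minimalPeriod_apply (a : Perm α) (z : α) :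
    (a ^ Function.minimalPeriod a z) z = z := by
  rw [Perm.coe_pow]
  exact Function.isPeriodicPt_minimalPeriod a z

theorem pow_apply_injOn_minimalPeriod (a : Perm α) (z : α) :
    (Set.Iio (Function.minimalPeriod a z)).InjOn fun k => (a ^ k) z := by
  simpa only [Perm.coe_pow] using Function.iterate_injOn_Iio_minimalPeriod

theorem isPeriodicPt_iff_pow_apply {a : Perm α} {k : ℕ} {z : α} :
    Function.IsPeriodicPt a k z ↔ (a ^ k) z = z := by
  rw [Function.IsPeriodicPt, Function.IsFixedPt, ← Perm.coe_pow]

theorem pow_apply_ne_pow_apply {a : Perm α} {z z' : α} (hne : ∀ k : ℕ, (a ^ k) z ≠ z')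
    (h' : 0 < Function.minimalPeriod a z') (k l : ℕ) : (a ^ k) z ≠ (a ^ l) z' := by
  intro heq
  obtain ⟨q, hq⟩ : ∃ q, Function.minimalPeriod a z' = q + 1 :=
    ⟨Function.minimalPeriod a z' - 1, by omega⟩
  apply hne (l * q + k)
  rw [pow_add, Perm.mul_apply, heq, ← Perm.mul_apply, ← pow_add, ← mul_add_one, ← hq, mul_comm,
    pow_mul]
  exact Function.IsFixedPt.perm_pow (pow_minimalPeriod_apply a z') l

theorem pow_apply_eq_of_commute {a f : Perm α} (hf : Commute f a) {z : α} {l : ℕ}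
    (hl : (a ^ l) z = f z) (q : ℕ) : (f ^ q) z = (a ^ (l * q)) z := by
  induction q with
  | zero => simp
  | succ q ih =>
    rw [pow_succ', Perm.mul_apply, ih, ← Perm.mul_apply, (hf.pow_right _).eq, Perm.mul_apply, ← hl,
      ← Perm.mul_apply, ← pow_add, mul_add_one]

theorem map_map_range_eq_rotate_one {β : Type*} {f : β → β} {s : ℕ → β} {r : ℕ} (hr : 0 < r)
    (hs : ∀ k, f (s k) = s (k + 1)) (hr0 : s r = s 0) :
    ((List.range r).map s).map f = ((List.range r).map s).rotate 1 := by
  obtain ⟨q, rfl⟩ : ∃ q, r = q + 1 := ⟨r - 1, by omega⟩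
  rw [List.map_map, funext (f := f ∘ s) hs, List.range_succ_eq_map, List.map_cons (f := s),
    List.rotate_cons_succ, List.rotate_zero, ← List.range_succ_eq_map, List.range_succ]
  simp only [List.map_append, List.map_map, List.map_cons, List.map_nil, hr0]
  rfl

variable [DecidableEq α]

theorem formPerm_map (a : Perm α) : ∀ l : List α, (l.map a).formPerm = a * l.formPerm * a⁻¹
  | [] => by simp
  | [x] => by simp
  | x :: y :: l => by
    rw [List.map_cons, List.map_cons, List.formPerm_cons_cons, List.formPerm_cons_cons,
      ← List.map_cons, formPerm_map a (y :: l), swap_apply_apply]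
    group

theorem hasParity_formPerm (x : α) (l : List α) (h : (x :: l).Nodup) :
    HasParity (x :: l).formPerm l.length := by
  induction l generalizing x with
  | nil => simpa using HasParity.one
  | cons y l ih =>
    rw [List.formPerm_cons_cons, List.length_cons, Nat.cast_add, Nat.cast_one, add_comm]
    refine HasParity.mul (.of_isSwap ⟨x, y, ?_, rfl⟩) (ih y (List.nodup_cons.1 h).2)
    rintro rfl
    simp at h

theorem exists_odd_commute_of_even_period (a : Perm α) (z : α)
    (h0 : 0 < Function.minimalPeriod a z) (h : Even (Function.minimalPeriod a z)) :
    ∃ f, Commute f a ∧ HasParity f 1 := by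
  set r := Function.minimalPeriod a z
  set orbit := (List.range r).map fun k => (a ^ k) z with horbit
  have hnodup : orbit.Nodup := List.nodup_range.map_on fun k hk l hl =>
    pow_apply_injOn_minimalPeriod a z (List.mem_range.1 hk) (List.mem_range.1 hl)
  have hrotate : orbit.map a = orbit.rotate 1 :=
    map_map_range_eq_rotate_one h0 (fun k => by rw [pow_succ', Perm.mul_apply])
      (pow_minimalPeriod_apply a z)
  refine ⟨orbit.formPerm, ?_, ?_⟩
  · have hconj := formPerm_map a orbit
    rw [hrotate, List.formPerm_rotate_one _ hnodup] at hconj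
    exact eq_mul_inv_iff_mul_eq.1 hconj
  · obtain ⟨q, hq⟩ : ∃ q, r = q + 1 := ⟨r - 1, by omega⟩
    rw [hq, List.range_succ_eq_map, List.map_cons] at horbit
    rw [horbit] at hnodup ⊢
    convert hasParity_formPerm _ _ hnodup
    rw [List.length_map, List.length_map, List.length_range, eq_comm, ZMod.natCast_eq_one_iff_odd]
    exact Nat.not_even_iff_odd.1 (Nat.even_add_one.1 (hq ▸ h))

theorem commute_prod_of_conj_eq_succ {G : Type*} [Group G] {a : G} {s : ℕ → G} {r : ℕ}
    (hr : 0 < r) (hs : ∀ k, MulAut.conj a (s k) = s (k + 1)) (hr0 : s r = s 0)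
    (hcomm : ∀ k < r, ∀ l < k, Commute (s l) (s k)) :
    Commute ((List.range r).map s).prod a := by
  have hrotate := map_map_range_eq_rotate_one hr hs hr0
  have hconj : MulAut.conj a ((List.range r).map s).prod = ((List.range r).map s).prod := by
    rw [map_list_prod, hrotate]
    refine ((List.rotate_perm _ 1).symm.prod_eq' (List.pairwise_map.2 ?_)).symm
    exact List.pairwise_lt_range.imp_of_mem fun _ hl hlk => hcomm _ (List.mem_range.1 hl) _ hlk
  exact (mul_inv_eq_iff_eq_mul.1 hconj).symm

theorem exists_odd_commute_of_minimalPeriod_eq (a : Perm α) {z z' : α}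
    (h : Odd (Function.minimalPeriod a z))
    (h' : Function.minimalPeriod a z' = Function.minimalPeriod a z)
    (hne : ∀ k : ℕ, (a ^ k) z ≠ z') : ∃ f, Commute f a ∧ HasParity f 1 := by
  set r := Function.minimalPeriod a z
  have hne' := pow_apply_ne_pow_apply hne (h' ▸ h.pos)
  let s (k : ℕ) : Perm α := swap ((a ^ k) z) ((a ^ k) z')
  have hcomm : ∀ k < r, ∀ l < k, Commute (s l) (s k) := fun k hk l hl =>
    (Perm.disjoint_swap_swap (by
      have h1 := (pow_apply_injOn_minimalPeriod a z).ne (hl.trans hk) hk hl.ne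
      have h2 := (pow_apply_injOn_minimalPeriod a z').ne (h' ▸ hl.trans hk) (h' ▸ hk) hl.ne
      simp [hne', (hne' _ _).symm, h1, h2])).commute
  have hr0 : s r = s 0 := by
    have hz' : (a ^ r) z' = z' := h' ▸ pow_minimalPeriod_apply a z'
    have hz : (a ^ r) z = z := pow_minimalPeriod_apply a z
    simp only [s, pow_zero, Perm.one_apply, hz, hz']
  have hs (k : ℕ) : MulAut.conj a (s k) = s (k + 1) := by
    rw [MulAut.conj_apply, ← swap_apply_apply, ← Perm.mul_apply, ← Perm.mul_apply, ← pow_succ']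
  refine ⟨_, commute_prod_of_conj_eq_succ h.pos hs hr0 hcomm, _, fun g hg => ?_, ?_, rfl⟩
  · obtain ⟨k, -, rfl⟩ := List.mem_map.1 hg
    exact ⟨_, _, hne' k k, rfl⟩
  · rwa [List.length_map, List.length_range, ZMod.natCast_eq_one_iff_odd]

theorem not_hasParity_one_of_odd_periods {f : Perm α} (h : ∀ z, ∃ k : ℕ, Odd k ∧ (f ^ k) z = z) :
    ¬ HasParity f 1 := by
  intro hf
  obtain ⟨s, σ, -, -, -, hσ⟩ := hf.exists_ofSubtype
  choose k hodd hk using h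
  have hprod : Odd (∏ z ∈ s, k z) :=
    Finset.prod_induction k Odd (fun _ _ => Odd.mul) odd_one fun z _ => hodd z
  have hone : f ^ (∏ z ∈ s, k z) = 1 := by
    ext1 z
    by_cases hz : z ∈ s
    · obtain ⟨q, hq⟩ := Finset.dvd_prod_of_mem k hz
      rw [hq, pow_mul]
      exact Function.IsFixedPt.perm_pow (hk z) q
    · exact Function.IsFixedPt.perm_pow (hσ ▸ Perm.ofSubtype_apply_of_not_mem σ hz) _
  have := hf.pow (∏ z ∈ s, k z)
  rw [hone, ZMod.natCast_eq_one_iff_odd.2 hprod, one_mul] at this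
  exact not_hasParity_one_one this

variable {n : ℕ} {a : Perm (RaySpace n)} {M L H : ℕ} {s : Fin n → ℤ}

/-- No ray is drift-free, and the finite orbits of `a` have pairwise distinct odd lengths. The
points of height at least `H` have infinite orbits once no ray is drift-free, so only the finitely
many points below `H` are inspected. -/
def HasRigidOrbits {n : ℕ} (a : Perm (RaySpace n)) (H : ℕ) (s : Fin n → ℤ) : Prop :=
  (∀ i, s i ≠ 0) ∧ ∀ z z' : RaySpace n, z.2 < H → z'.2 < H →
    (∃ k : ℕ, H ≤ ((a ^ k) z).2) ∨ (∃ k : ℕ, H ≤ ((a ^ k) z').2) ∨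
      ((∃ k : ℕ, Odd k ∧ (a ^ k) z = z) ∧
        ((∃ k : ℕ, (a ^ k) z = z') ∨ ∃ k : ℕ, ¬ ((a ^ k) z = z ↔ (a ^ k) z' = z')))

theorem apply_eq_self_of_far_orbit (hL : TranslatesFrom H (a ^ L) s) (hs : ∀ i, s i ≠ 0)
    {f : Perm (RaySpace n)} (hf : Commute f a) (hf0 : TranslatesBy f 0) {z : RaySpace n} {k : ℕ}
    (hk : H ≤ ((a ^ k) z).2) : f z = z := by
  obtain ⟨K, hK⟩ := hf0
  have hz : ∀ l : ℕ, 0 < l → (a ^ l) z ≠ z := pow_apply_ne_of_zpow k fun l hl => by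
    rw [zpow_natCast]
    exact pow_apply_ne_of_far hL (hs _) hk hl
  obtain ⟨k₀, hk₀⟩ := eventually_le_snd_pow_apply hz K
  apply (a ^ k₀).injective
  rw [← Perm.mul_apply, ← (hf.pow_right k₀).eq, Perm.mul_apply]
  exact hK.apply (i := ((a ^ k₀) z).1) (hk₀ k₀ le_rfl) (by simp)

theorem HasRigidOrbits.not_hasParity_one (hL : TranslatesFrom H (a ^ L) s)
    (hr : HasRigidOrbits a H s) {f : Perm (RaySpace n)} (hf : Commute f a) :
    ¬ HasParity f 1 := by
  intro hpar
  have hfar {z} (h : ∃ k : ℕ, H ≤ ((a ^ k) z).2) : f z = z :=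
    apply_eq_self_of_far_orbit hL hr.1 hf hpar.translatesBy h.choose_spec
  refine not_hasParity_one_of_odd_periods (fun z => ?_) hpar
  suffices h : f z ≠ z → ∃ k : ℕ, Odd k ∧ (f ^ k) z = z by
    by_cases hz : f z = z
    exacts [⟨1, odd_one, by simpa using hz⟩, h hz]
  intro hfz
  have hz : ¬ ∃ k : ℕ, H ≤ ((a ^ k) z).2 := fun h => hfz (hfar h)
  have hfz' : ¬ ∃ k : ℕ, H ≤ ((a ^ k) (f z)).2 := fun h => hfz (f.injective (hfar h))
  rcases hr.2 z (f z) (not_le.1 fun h => hz ⟨0, by simpa using h⟩)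
    (not_le.1 fun h => hfz' ⟨0, by simpa using h⟩) with h | h | ⟨⟨k, hk, hkz⟩, ⟨l, hl⟩ | ⟨l, hl⟩⟩
  · exact absurd h hz
  · exact absurd h hfz'
  · refine ⟨k, hk, ?_⟩
    rw [pow_apply_eq_of_commute hf hl, mul_comm, pow_mul]
    exact Function.IsFixedPt.perm_pow hkz l
  · refine absurd ?_ hl
    rw [← Perm.mul_apply, ← (hf.pow_right l).eq, Perm.mul_apply, f.injective.eq_iff]

theorem odd_minimalPeriod {a : Perm α} (h : ∀ f, Commute f a → ¬ HasParity f 1) {z : α} {k : ℕ}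
    (hk : 0 < k) (hkz : (a ^ k) z = z) : Odd (Function.minimalPeriod a z) := by
  by_contra heven
  obtain ⟨f, hfa, hf⟩ := exists_odd_commute_of_even_period a z
    ((isPeriodicPt_iff_pow_apply.2 hkz).minimalPeriod_pos hk) (Nat.not_odd_iff_even.1 heven)
  exact h f hfa hf

theorem RigidFrom.drift_ne_zero (ha : RigidFrom M a) (hL : TranslatesFrom H (a ^ L) s)
    (hL0 : 0 < L) (h : ∀ f, Commute f a → ¬ HasParity f 1) (i : Fin n) : s i ≠ 0 := by
  intro hi
  set K := H + L * M
  have hfix {m} (hm : K ≤ m) : (a ^ L) (i, m) = (i, m) :=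
    hL.apply (by omega) (by rw [hi, add_zero])
  have hmod (k : ℕ) : ∃ k', k' * M ≤ K ∧ ∀ z, (a ^ L) z = z → (a ^ k) z = (a ^ k') z := by
    obtain ⟨k', hk', hak⟩ := exists_zpow_apply_eq_pow a hL0 k
    exact ⟨k', (Nat.mul_le_mul_right M hk'.le).trans (by omega), by simpa using hak⟩
  have hperiod :
      Function.minimalPeriod a (i, K + 1) = Function.minimalPeriod a (i, K) := by
    refine Function.minimalPeriod_eq_minimalPeriod_iff.2 fun k => ?_
    obtain ⟨k', hk', hak⟩ := hmod k
    rw [isPeriodicPt_iff_pow_apply, isPeriodicPt_iff_pow_apply, hak _ (hfix le_rfl),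
      hak _ (hfix K.le_succ), ← ha.fixesRay_iff hk', ← ha.fixesRay_iff (hk'.trans K.le_succ)]
  have hne (k : ℕ) : (a ^ k) (i, K) ≠ (i, K + 1) := by
    intro hk
    obtain ⟨k', hk', hak⟩ := hmod k
    rw [hak _ (hfix le_rfl)] at hk
    have hray : ((a ^ k') (i, K)).1 = (ha.rayMap ^ k') i := ha.fst_pow_apply hk'
    rw [hk] at hray
    have := (ha.fixesRay_iff hk').1 (ha.fixesRay_of_pow_rayMap_eq hL hL0 hi hray.symm)
    rw [hk, Prod.mk.injEq] at this
    omega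
  obtain ⟨f, hfa, hf⟩ := exists_odd_commute_of_minimalPeriod_eq a
    (odd_minimalPeriod h hL0 (hfix le_rfl)) hperiod hne
  exact h f hfa hf

theorem RigidFrom.hasRigidOrbits (ha : RigidFrom M a) (hL : TranslatesFrom H (a ^ L) s)
    (hL0 : 0 < L) (h : ∀ f, Commute f a → ¬ HasParity f 1) : HasRigidOrbits a H s := by
  refine ⟨ha.drift_ne_zero hL hL0 h, fun z z' _ _ => ?_⟩
  by_cases hz : ∃ k : ℕ, H ≤ ((a ^ k) z).2
  · exact Or.inl hz
  have hper : ∃ k : ℕ, 0 < k ∧ (a ^ k) z = z := by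
    by_contra! hcon
    obtain ⟨k, hk⟩ := eventually_le_snd_pow_apply hcon H
    exact hz ⟨k, hk k le_rfl⟩
  have hodd := odd_minimalPeriod h hper.choose_spec.1 hper.choose_spec.2
  refine Or.inr (Or.inr ⟨⟨_, hodd, pow_minimalPeriod_apply a z⟩, ?_⟩)
  by_contra! hcon
  obtain ⟨f, hfa, hf⟩ := exists_odd_commute_of_minimalPeriod_eq a hodd
    (Function.minimalPeriod_eq_minimalPeriod_iff.2 fun k => by
      rw [isPeriodicPt_iff_pow_apply, isPeriodicPt_iff_pow_apply]
      have := hcon.2 k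
      tauto) hcon.1
  exact h f hfa hf

end FinitaryCentralizer

/-! ### Certificates against conjugacy -/

section Duality

variable {ι : Type*} [Fintype ι]

theorem exists_addCircle_eq_sum_mul (f : (ι → ℤ) →+ AddCircle (1 : ℚ)) :
    ∃ q : ι → ℚ, ∀ w, f w = ((∑ i, w i * q i : ℚ) : AddCircle (1 : ℚ)) := by
  classical
  choose q hq using fun i => QuotientAddGroup.mk_surjective (f (Pi.single i 1))
  refine ⟨q, fun w => ?_⟩
  have hw : w = ∑ i, w i • (Pi.single i 1 : ι → ℤ) := by
    funext j
    simp [Finset.sum_apply, Pi.single_apply]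
  calc f w = ∑ i, w i • ((q i : ℚ) : AddCircle (1 : ℚ)) := by
        conv_lhs => rw [hw, map_sum]
        exact Finset.sum_congr rfl fun i _ => by rw [map_zsmul, ← hq i]
    _ = ∑ i, ((w i * q i : ℚ) : AddCircle (1 : ℚ)) :=
        Finset.sum_congr rfl fun i _ => by rw [← zsmul_eq_mul]; rfl
    _ = _ := (map_sum (QuotientAddGroup.mk' (AddSubgroup.zmultiples (1 : ℚ))) _ _).symm

theorem exists_int_eq_mul_natCast {ι : Type*} [Finite ι] (q : ι → ℚ) :
    ∃ d : ℕ, 0 < d ∧ ∃ k : ι → ℤ, ∀ i, (k i : ℚ) = q i * d := by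
  have := Fintype.ofFinite ι
  refine ⟨∏ i, (q i).den, Finset.prod_pos fun i _ => (q i).den_pos, ?_⟩
  choose e he using fun i => Finset.dvd_prod_of_mem (fun i => (q i).den) (Finset.mem_univ i)
  refine ⟨fun i => (q i).num * e i, fun i => ?_⟩
  rw [he i]
  push_cast
  rw [← mul_assoc, Rat.mul_den_eq_num]

theorem addCircle_coe_eq_zero_iff_dvd {q : ℚ} {d : ℕ} (hd : 0 < d) {k : ℤ}
    (hk : (k : ℚ) = q * d) : (q : AddCircle (1 : ℚ)) = 0 ↔ (d : ℤ) ∣ k := by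
  have hd0 : (d : ℚ) ≠ 0 := by positivity
  rw [AddCircle.coe_eq_zero_iff]
  refine exists_congr fun m => ?_
  rw [zsmul_one, ← mul_left_inj' hd0, ← hk, mul_comm, eq_comm]
  exact_mod_cast Iff.rfl

theorem dvd_sum_emod_mul_iff {d : ℤ} (k w : ι → ℤ) :
    d ∣ ∑ i, k i % d * w i ↔ d ∣ ∑ i, k i * w i := by
  refine dvd_iff_dvd_of_dvd_sub ?_
  rw [← Finset.sum_sub_distrib]
  refine Finset.dvd_sum fun i _ => ?_
  rw [← sub_mul]
  exact (dvd_sub_comm.1 Int.dvd_self_sub_emod).mul_right _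

/-- A character of `ℤ ^ ι ⧸ A` with values in `ℚ ⧸ ℤ` that does not vanish at `v` is a linear form
with rational coefficients; clearing denominators gives `d` and `lam`. -/
theorem exists_dual_certificate (A : AddSubgroup (ι → ℤ)) {v : ι → ℤ} (hv : v ∉ A) :
    ∃ d : ℕ, 0 < d ∧ ∃ lam : ι → ℕ, (∀ i, lam i < d) ∧
      (∀ w ∈ A, (d : ℤ) ∣ ∑ i, lam i * w i) ∧ ¬ (d : ℤ) ∣ ∑ i, lam i * v i := by
  have hne : (QuotientAddGroup.mk v : (ι → ℤ) ⧸ A) ≠ 0 := by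
    rwa [Ne, QuotientAddGroup.eq_zero_iff]
  obtain ⟨c, hc⟩ := CharacterModule.exists_character_apply_ne_zero_of_ne_zero hne
  obtain ⟨q, hq⟩ := exists_addCircle_eq_sum_mul
    (AddMonoidHom.comp (c : (ι → ℤ) ⧸ A →+ AddCircle (1 : ℚ)) (QuotientAddGroup.mk' A))
  obtain ⟨d, hd, k, hk⟩ := exists_int_eq_mul_natCast q
  have hiff (w : ι → ℤ) : (d : ℤ) ∣ ∑ i, ((k i % d).toNat : ℤ) * w i ↔
      c (QuotientAddGroup.mk w : (ι → ℤ) ⧸ A) = 0 := by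
    have hnonneg (i) : 0 ≤ k i % d := Int.emod_nonneg _ (by omega)
    simp only [Int.toNat_of_nonneg (hnonneg _), dvd_sum_emod_mul_iff]
    refine (addCircle_coe_eq_zero_iff_dvd hd ?_).symm.trans (Eq.congr_left (hq w).symm)
    push_cast
    rw [Finset.sum_mul]
    exact Finset.sum_congr rfl fun i _ => by rw [hk]; ring
  refine ⟨d, hd, fun i => (k i % d).toNat, fun i => ?_, fun w hw => (hiff w).2 ?_,
    fun h => hc ((hiff v).1 h)⟩
  · have := Int.emod_lt_of_pos (k i) (by omega : (0 : ℤ) < d)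
    dsimp only
    omega
  · rw [(QuotientAddGroup.eq_zero_iff w).2 hw, map_zero]

end Duality

section Conjugators

variable {n : ℕ} {a b x : Perm (RaySpace n)} {tx : Fin n → ℤ}

theorem commute_inv_mul {G : Type*} [Group G] {x y a b : G} (hx : x * a = b * x)
    (hy : y * a = b * y) : Commute (x⁻¹ * y) a := by
  rw [Commute, SemiconjBy, mul_assoc, hy, ← mul_assoc, ← mul_assoc, mul_left_inj,
    inv_mul_eq_iff_eq_mul, ← mul_assoc, hx, mul_inv_cancel_right]

theorem neg_add_mem_commutingTranslations (hx : x * a = b * x) (htx : TranslatesBy x tx)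
    {y : Perm (RaySpace n)} {ty : Fin n → ℤ} (hy : y * a = b * y) (hty : TranslatesBy y ty) :
    -tx + ty ∈ commutingTranslations a :=
  mem_commutingTranslations.2 ⟨_, htx.inv.mul hty, commute_inv_mul hx hy⟩

theorem exists_conjugator_translatesBy (hx : x * a = b * x) (htx : TranslatesBy x tx)
    {w : Fin n → ℤ} (hw : w ∈ commutingTranslations a) :
    ∃ y, y * a = b * y ∧ TranslatesBy y (tx + w) := by
  obtain ⟨c, hc, hca⟩ := mem_commutingTranslations.1 hw
  exact ⟨x * c, by rw [mul_assoc, hca.eq, ← mul_assoc, hx, mul_assoc], htx.mul hc⟩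

end Conjugators

section Certificates

variable {n p : ℕ} {a b x : Perm (RaySpace (n * p))} {M L H B : ℕ} {s tx ρ : Fin (n * p) → ℤ}

variable (n p) in
/-- The vectors that are constant on each block of `p` rays. -/
def blockVectors : AddSubgroup (Fin (n * p) → ℤ) :=
  (LinearMap.range (LinearMap.funLeft ℤ ℤ (rayBlock (n := n) (p := p)))).toAddSubgroup

theorem mem_blockVectors {t : Fin (n * p) → ℤ} :
    t ∈ blockVectors n p ↔ ∃ k : Fin n → ℤ, (fun l => k (rayBlock l)) = t := Iff.rfl

/-- Twice the vectors of `commutingTranslations a`. -/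
def doubleTranslations {n : ℕ} (a : Perm (RaySpace n)) : AddSubgroup (Fin n → ℤ) :=
  (commutingTranslations a).map (zsmulAddGroupHom 2)

/-- A linear form modulo `d` that vanishes on `doubleTranslations a` and on `blockVectors n p`, but
not at `ρ + tx`; the first condition is tested only on the vectors with entries bounded by `B`. -/
def DualCertificate (a : Perm (RaySpace (n * p))) (M H B : ℕ) (s tx ρ : Fin (n * p) → ℤ) : Prop :=
  ∃ d : ℕ, 0 < d ∧ ∃ lam : Fin (n * p) → ℕ, (∀ i, lam i < d) ∧
    (∀ j : Fin n, (d : ℤ) ∣ ∑ i : Fin (n * p), if rayBlock i = j then (lam i : ℤ) else 0) ∧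
    (∀ w : Fin (n * p) → ℤ, (∀ i, (w i).natAbs ≤ B) →
      ¬ IsAdmissible a M H B s w ∨ (d : ℤ) ∣ ∑ i, lam i * (2 * w i)) ∧
    ¬ (d : ℤ) ∣ ∑ i, lam i * (ρ i + tx i)

/-- A conjugator of odd parity whose translation vector is `ρ + tx` modulo twice the commuting
translations, in a situation where odd parity is an obstruction. -/
def OddCertificate (hn : 2 ≤ n) (hp : 1 ≤ p) (a b : Perm (RaySpace (n * p))) (H : ℕ)
    (s tx ρ : Fin (n * p) → ℤ) : Prop :=
  ¬ (3 ≤ n ∧ Odd p) ∧ HasRigidOrbits a H s ∧ ∃ y c : Perm (RaySpace (n * p)),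
    HasParityModulo (blockShifts hn hp) y 1 ∧ y * a = b * y ∧ Commute c a ∧
    ∃ ty tc, TranslatesBy y ty ∧ TranslatesBy c tc ∧ ∀ i, ty i = tx i + ρ i + 2 * tc i

theorem dvd_sum_mul_two_mul_of_bounded {n : ℕ} {a : Perm (RaySpace n)} {s : Fin n → ℤ}
    (ha : RigidFrom M a) (hL : TranslatesFrom H (a ^ L) s) (hL0 : 0 < L) (hB : n * n ≤ B)
    (hs : ∀ i, 2 * (s i).natAbs ≤ B) {d : ℤ} {lam : Fin n → ℤ}
    (h : ∀ w ∈ commutingTranslations a, (∀ i, (w i).natAbs ≤ B) → d ∣ ∑ i, lam i * (2 * w i))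
    {w : Fin n → ℤ} (hw : w ∈ commutingTranslations a) : d ∣ ∑ i, lam i * (2 * w i) := by
  obtain ⟨m, hm⟩ : ∃ m, ∀ i, (w i).natAbs ≤ m := ⟨_, natAbs_le_sum w⟩
  induction m using Nat.strong_induction_on generalizing w with
  | _ m ih =>
  rcases le_or_gt m B with hmB | hmB
  · exact h w hw fun i => (hm i).trans hmB
  · obtain ⟨ρ, hρ, v, hv, hρB, rfl⟩ := exists_bounded_add_two_smul ha hL hL0 hB hs hw
    have hv_dvd := ih ((m + B) / 2) (by omega) hv fun i => by
      have hmi := hm i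
      have hρi := hρB i
      simp only [Pi.add_apply, Pi.smul_apply, smul_eq_mul] at hmi
      omega
    have hsum : ∑ i, lam i * (2 * (ρ + (2 : ℤ) • v) i) =
        ∑ i, lam i * (2 * ρ i) + 2 * ∑ i, lam i * (2 * v i) := by
      rw [Finset.mul_sum, ← Finset.sum_add_distrib]
      refine Finset.sum_congr rfl fun i _ => ?_
      simp only [Pi.add_apply, Pi.smul_apply, smul_eq_mul]
      ring
    rw [hsum]
    exact dvd_add (h ρ hρ hρB) (hv_dvd.mul_left 2)

theorem sum_mul_block (lam : Fin (n * p) → ℤ) (k : Fin n → ℤ) :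
    ∑ i, lam i * k (rayBlock i) = ∑ j, k j * ∑ i, if rayBlock i = j then lam i else 0 := by
  simp only [Finset.mul_sum, mul_ite, mul_zero]
  rw [Finset.sum_comm]
  refine Finset.sum_congr rfl fun i _ => ?_
  rw [Finset.sum_ite_eq, if_pos (Finset.mem_univ _), mul_comm]

theorem dualCertificate_iff (ha : RigidFrom M a) (hL : TranslatesFrom H (a ^ L) s) (hL0 : 0 < L)
    (hB : n * p * (n * p) ≤ B) (hs : ∀ i, 2 * (s i).natAbs ≤ B) :
    DualCertificate a M H B s tx ρ ↔ ρ + tx ∉ doubleTranslations a ⊔ blockVectors n p := by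
  constructor
  · rintro ⟨d, -, lam, -, hblock, hdouble, hne⟩ hmem
    obtain ⟨_, ⟨v, hv, rfl⟩, _, ⟨k, rfl⟩, hsum⟩ := AddSubgroup.mem_sup.1 hmem
    have hv_dvd := dvd_sum_mul_two_mul_of_bounded ha hL hL0 hB hs (fun w hw hwB =>
      (hdouble w hwB).resolve_left (not_not.2 (isAdmissible_of_mem ha hL hwB hw))) hv
    have hk_dvd : (d : ℤ) ∣ ∑ i, lam i * k (rayBlock i) := by
      rw [sum_mul_block]
      exact Finset.dvd_sum fun j _ => (hblock j).mul_left _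
    have hform : ∑ i, (lam i : ℤ) * (ρ i + tx i) =
        ∑ i, lam i * (2 * v i) + ∑ i, lam i * k (rayBlock i) := by
      rw [← Finset.sum_add_distrib]
      refine Finset.sum_congr rfl fun i _ => ?_
      rw [← mul_add]
      exact congrArg _ (congrFun hsum i).symm
    exact hne (hform ▸ dvd_add hv_dvd hk_dvd)
  · intro hmem
    obtain ⟨d, hd, lam, hlam, hsup, hne⟩ := exists_dual_certificate _ hmem
    refine ⟨d, hd, lam, hlam, fun j => ?_, fun w hwB => ?_, hne⟩
    · have := hsup (fun i => (Pi.single j 1 : Fin n → ℤ) (rayBlock i))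
        (AddSubgroup.mem_sup_right ⟨Pi.single j 1, rfl⟩)
      rw [sum_mul_block] at this
      simpa [Pi.single_apply] using this
    · rw [← mem_commutingTranslations_iff ha hL hL0 hwB, ← imp_iff_not_or]
      exact fun hw => hsup _ (AddSubgroup.mem_sup_left ⟨w, hw, rfl⟩)

variable {hn : 2 ≤ n} {hp : 1 ≤ p}

/-- `h` is the square of an element commuting with `a`, up to a finitary permutation commuting with
`a`, and the latter is even by rigidity. -/
theorem HasRigidOrbits.hasParityModulo_zero (hr : HasRigidOrbits a H s)
    (hL : TranslatesFrom H (a ^ L) s) {h : Perm (RaySpace (n * p))} (hha : Commute h a)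
    {u : Fin (n * p) → ℤ} (hh : TranslatesBy h ((2 : ℤ) • u)) (hu : u ∈ commutingTranslations a)
    (hblock : (2 : ℤ) • u ∈ blockVectors n p) : HasParityModulo (blockShifts hn hp) h 0 := by
  obtain ⟨g, hg, hga⟩ := mem_commutingTranslations.1 hu
  obtain ⟨k, hk⟩ := mem_blockVectors.1 hblock
  have hg_block : TranslatesBy g fun i => k (rayBlock i) / 2 := by
    convert hg using 1
    funext i
    have := congrFun hk i
    simp only [Pi.smul_apply, smul_eq_mul] at this
    omega
  obtain ⟨e, he⟩ := exists_hasParityModulo_of_block_translatesBy hn hp (k := fun j => k j / 2)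
    hg_block
  have hf : TranslatesBy ((g * g)⁻¹ * h) 0 := by
    convert (hg.mul hg).inv.mul hh using 1
    rw [two_smul, neg_add_cancel]
  obtain ⟨e', he'⟩ := hf.exists_hasParity
  obtain rfl : e' = 0 := (eq_zero_or_eq_one_zmod_two e').resolve_right fun h1 =>
    hr.not_hasParity_one hL ((hga.mul_left hga).inv_left.mul_left hha) (h1 ▸ he')
  have := (he.mul he).mul he'.modulo
  rwa [mul_inv_cancel_left, CharTwo.add_self_eq_zero, zero_add] at this

theorem OddCertificate.notMem_imageU (hcert : OddCertificate hn hp a b H s tx ρ)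
    (hL : TranslatesFrom H (a ^ L) s) {y : Perm (RaySpace (n * p))} (hy : y * a = b * y)
    {k : Fin n → ℤ} (hk : TranslatesBy y fun i => k (rayBlock i)) {v : Fin (n * p) → ℤ}
    (hv : v ∈ commutingTranslations a) (hsum : -tx + (fun i => k (rayBlock i)) = ρ + (2 : ℤ) • v) :
    y ∉ imageU hn hp := by
  obtain ⟨hnp, hr, y₁, c, hy₁, hya, hca, ty, tc, hty, htc, hrel⟩ := hcert
  obtain ⟨k₁, hk₁⟩ := hy₁.exists_block_translatesBy
  obtain rfl := hty.unique hk₁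
  have hdiff : -(fun i => k₁ (rayBlock i)) + (fun i => k (rayBlock i)) = (2 : ℤ) • (-tc + v) := by
    funext i
    have hsum_i := congrFun hsum i
    have hrel_i := hrel i
    simp only [Pi.add_apply, Pi.neg_apply, Pi.smul_apply, smul_eq_mul] at hsum_i ⊢
    linarith
  have hpar : HasParityModulo (blockShifts hn hp) (y₁⁻¹ * y) 0 :=
    hr.hasParityModulo_zero hL (commute_inv_mul hya hy) (hdiff ▸ hty.inv.mul hk)
      (add_mem (neg_mem (mem_commutingTranslations.2 ⟨c, htc, hca⟩)) hv)
      (hdiff ▸ add_mem (neg_mem ⟨k₁, rfl⟩) ⟨k, rfl⟩)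
  intro hyU
  refine notMem_imageU_of_hasParityModulo_one hnp hy₁ ?_
  rw [← inv_mem_iff, ← mul_mem_cancel_right hyU]
  exact mem_imageU_iff.2 ⟨0, hpar, Or.inl rfl⟩

theorem oddCertificate_of_forall_notMem_imageU (ha : RigidFrom M a)
    (hL : TranslatesFrom H (a ^ L) s) (hL0 : 0 < L) (hx : x * a = b * x) (htx : TranslatesBy x tx)
    (hρ : ρ ∈ commutingTranslations a)
    (hmem : ρ + tx ∈ doubleTranslations a ⊔ blockVectors n p)
    (hno : ∀ y, y * a = b * y → y ∉ imageU hn hp) : OddCertificate hn hp a b H s tx ρ := by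
  obtain ⟨_, ⟨v, hv, rfl⟩, _, ⟨k, rfl⟩, hsum⟩ := AddSubgroup.mem_sup.1 hmem
  obtain ⟨c, hc, hca⟩ := mem_commutingTranslations.1 (neg_mem hv)
  have hsum' (i) : 2 * v i + k (rayBlock i) = ρ i + tx i := congrFun hsum i
  obtain ⟨y, hya, hy⟩ := exists_conjugator_translatesBy hx htx (sub_mem hρ (zsmul_mem hv 2))
  replace hy : TranslatesBy y fun i => k (rayBlock i) := by
    convert hy using 1
    funext i
    simp only [Pi.add_apply, Pi.sub_apply, Pi.smul_apply, smul_eq_mul]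
    linarith [hsum' i]
  obtain ⟨e, he⟩ := exists_hasParityModulo_of_block_translatesBy hn hp hy
  have hnot : ¬ (e = 0 ∨ 3 ≤ n ∧ Odd p) := fun h => hno y hya (mem_imageU_iff.2 ⟨e, he, h⟩)
  obtain rfl : e = 1 :=
    (eq_zero_or_eq_one_zmod_two e).resolve_left fun h => hnot (Or.inl h)
  have hrigid : HasRigidOrbits a H s := ha.hasRigidOrbits hL hL0 fun f hf hf1 =>
    hno (y * f) (by rw [mul_assoc, hf.eq, ← mul_assoc, hya, mul_assoc])
      (mem_imageU_iff.2 ⟨_, he.mul hf1.modulo, Or.inl (CharTwo.add_self_eq_zero 1)⟩)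
  refine ⟨fun h => hnot (Or.inr h), hrigid, y, c, he, hya, hca, _, _, hy, hc, fun i => ?_⟩
  simp only [Pi.neg_apply]
  linarith [hsum' i]

theorem forall_certificate_iff (ha : RigidFrom M a) (hL : TranslatesFrom H (a ^ L) s) (hL0 : 0 < L)
    (hB : n * p * (n * p) ≤ B) (hs : ∀ i, 2 * (s i).natAbs ≤ B) (hx : x * a = b * x)
    (htx : TranslatesBy x tx) :
    (∀ ρ : Fin (n * p) → ℤ, (∀ i, (ρ i).natAbs ≤ B) → ¬ IsAdmissible a M H B s ρ ∨
      DualCertificate a M H B s tx ρ ∨ OddCertificate hn hp a b H s tx ρ) ↔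
    ¬ ∃ y ∈ imageU hn hp, y * a = b * y := by
  constructor
  · rintro hcert ⟨y, hyU, hy⟩
    obtain ⟨e, hye, -⟩ := mem_imageU_iff.1 hyU
    obtain ⟨k, hk⟩ := hye.exists_block_translatesBy
    obtain ⟨ρ, hρ, v, hv, hρB, hsum⟩ := exists_bounded_add_two_smul ha hL hL0 hB hs
      (neg_add_mem_commutingTranslations hx htx hy hk)
    rcases hcert ρ hρB with h | h | h
    · exact h (isAdmissible_of_mem ha hL hρB hρ)
    · refine (dualCertificate_iff ha hL hL0 hB hs).1 h (AddSubgroup.mem_sup.2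
        ⟨_, ⟨-v, neg_mem hv, rfl⟩, _, ⟨k, rfl⟩, ?_⟩)
      funext i
      have := congrFun hsum i
      simp only [Pi.add_apply, Pi.neg_apply, Pi.smul_apply, smul_eq_mul, zsmulAddGroupHom_apply,
        LinearMap.funLeft_apply] at this ⊢
      linarith
    · exact h.notMem_imageU hL hy hk hv hsum hyU
  · intro hno ρ hρB
    rw [← mem_commutingTranslations_iff ha hL hL0 hρB, ← imp_iff_not_or,
      dualCertificate_iff ha hL hL0 hB hs, ← imp_iff_not_or]
    exact fun hρ hmem => oddCertificate_of_forall_notMem_imageU ha hL hL0 hx htx hρ hmem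
      fun y hy hyU => hno ⟨y, hyU, hy⟩

end Certificates

/-! ### Permutations as functions on pairs of natural numbers -/

section Codes

variable {n p : ℕ} {f f' : ℕ × ℕ → ℕ × ℕ} {g g' : Perm (RaySpace n)}

/-- The points of `X_n` as pairs of natural numbers. -/
def pointCode (z : RaySpace n) : ℕ × ℕ := (z.1, z.2)

theorem pointCode_injective : Function.Injective (pointCode (n := n)) :=
  Fin.val_injective.prodMap Function.injective_id

/-- `f` describes the action of the permutation `g` on coded points. -/
def Represents (f : ℕ × ℕ → ℕ × ℕ) (g : Perm (RaySpace n)) : Prop :=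
  ∀ z, f (pointCode z) = pointCode (g z)

namespace Represents

theorem unique (h : Represents f g) (h' : Represents f g') : g = g' :=
  Equiv.ext fun z => pointCode_injective ((h z).symm.trans (h' z))

theorem one : Represents id (1 : Perm (RaySpace n)) := fun _ => rfl

theorem mul (h : Represents f g) (h' : Represents f' g') : Represents (f ∘ f') (g * g') :=
  fun z => by
  rw [Function.comp_apply, h' z, h, Perm.mul_apply]

theorem iterate (h : Represents f g) (k : ℕ) : Represents f^[k] (g ^ k) := by
  induction k with
  | zero => exact one
  | succ k ih =>
    rw [Function.iterate_succ, pow_succ]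
    exact ih.mul h

theorem apply (h : Represents f g) (i : Fin n) (m : ℕ) :
    f (i, m) = (((g (i, m)).1 : ℕ), (g (i, m)).2) := h (i, m)

theorem apply_eq_iff (h : Represents f g) {z z' : RaySpace n} :
    f (pointCode z) = pointCode z' ↔ g z = z' := by
  rw [h z, pointCode_injective.eq_iff]

theorem swap (u v : RaySpace n) :
    Represents (Equiv.swap (pointCode u) (pointCode v)) (Equiv.swap u v) :=
  pointCode_injective.swap_apply u v

theorem rayPerm {σ : Perm (Fin n)} {s : ℕ → ℕ} (h : ∀ i : Fin n, s i = σ i) :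
    Represents (Prod.map s id) (rayPerm σ) := fun z => Prod.ext (h z.1) rfl

end Represents

/-- The permutation `rayShift` on coded points. -/
def shiftCode (i j : ℕ) (z : ℕ × ℕ) : ℕ × ℕ :=
  if z.1 = i then (i, z.2 + 1)
  else if z.1 = j then (if z.2 = 0 then (i, 0) else (j, z.2 - 1))
  else z

theorem Represents.rayShift {i j : Fin n} (hij : i ≠ j) :
    Represents (shiftCode i j) (rayShift i j hij) := by
  rintro ⟨k, m⟩
  simp only [shiftCode, pointCode, _root_.rayShift, coe_fn_mk, Fin.val_inj]
  grind

theorem rayShift_inv {i j : Fin n} (hij : i ≠ j) :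
    (rayShift i j hij)⁻¹ = rayShift j i hij.symm := by
  ext1 ⟨k, m⟩
  simp only [Perm.inv_def, rayShift, coe_fn_mk, coe_fn_symm_mk]
  grind

/-- The bijection `raySplit` on coded points. -/
def splitCode (p : ℕ) (z : ℕ × ℕ) : ℕ × ℕ := (z.2 % p + p * z.1, z.2 / p)

/-- The inverse of `raySplit` on coded points. -/
def unsplitCode (p : ℕ) (z : ℕ × ℕ) : ℕ × ℕ := (z.1 / p, z.1 % p + p * z.2)

theorem Represents.permCongr_raySplit (hp : 1 ≤ p) (h : Represents f g) :
    Represents (splitCode p ∘ f ∘ unsplitCode p) ((raySplit n p hp).permCongr g) := fun z => by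
  have hz : unsplitCode p (pointCode z) = pointCode ((raySplit n p hp).symm z) := rfl
  rw [Function.comp_apply, Function.comp_apply, hz, h]
  rfl

theorem RigidFrom.permCongr_raySplit {M : ℕ} (hp : 1 ≤ p) (hg : RigidFrom (p * M) g) :
    RigidFrom M ((raySplit n p hp).permCongr g) := by
  intro l k
  obtain ⟨⟨i, d⟩, rfl⟩ := finProdFinEquiv.surjective l
  simp only [permCongr_apply, (symm_apply_eq _).2 (raySplit_apply hp i d _).symm]
  rw [mul_add, ← add_assoc, hg.apply_add i (Nat.le_add_left _ _)]
  simp [raySplit, Nat.add_mul_div_left _ _ hp]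

/-- The `p`-th power of `rayShift`, transported along `raySplit`, on coded points. -/
def blockShiftCode (p i j : ℕ) : ℕ × ℕ → ℕ × ℕ :=
  splitCode p ∘ (shiftCode i j)^[p] ∘ unsplitCode p

theorem Represents.blockShift (hp : 1 ≤ p) {i j : Fin n} (hij : i ≠ j) :
    Represents (blockShiftCode p i j) ((raySplit n p hp).permCongr (_root_.rayShift i j hij ^ p)) :=
  ((Represents.rayShift hij).iterate p).permCongr_raySplit hp

theorem rigidFrom_blockShift (hp : 1 ≤ p) {i j : Fin n} (hij : i ≠ j) :
    RigidFrom 1 ((raySplit n p hp).permCongr (rayShift i j hij ^ p)) :=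
  ((rayShift_rigidFrom hij).pow p).permCongr_raySplit hp

end Codes

section Letters

variable {n p : ℕ}

/-- A letter `inl (u, v)` stands for the transposition of the points `u`, `v` of `X_{np}`, a letter
`inr (i, j)` for the block shift from ray `j` to ray `i` of `X_n`. -/
abbrev Letter : Type := ((ℕ × ℕ) × (ℕ × ℕ)) ⊕ (ℕ × ℕ)

/-- The action of a letter on coded points. Shifts between two rays other than the first one act
trivially, because they need not belong to the group generated by `blockShifts`. -/
def letterEval (n p : ℕ) (c : Letter) (z : ℕ × ℕ) : ℕ × ℕ :=
  match c with
  | .inl (u, v) => if u.1 < n * p ∧ v.1 < n * p then swap u v z else z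
  | .inr (i, j) =>
    if i < n ∧ j < n ∧ i ≠ j ∧ (i = 0 ∨ j = 0) then blockShiftCode p i j z else z

/-- The number of transpositions, `0` or `1`, performed by a letter. -/
def letterSwapCount (n p : ℕ) : Letter → ℕ
  | .inl (u, v) => if u.1 < n * p ∧ v.1 < n * p ∧ u ≠ v then 1 else 0
  | .inr _ => 0

/-- A height from which on a letter acts rigidly. -/
def letterHeight : Letter → ℕ
  | .inl (u, v) => u.2 + v.2 + 1
  | .inr _ => 1

/-- The action of a list of letters on coded points; the last letter acts first. -/
def listEval (n p : ℕ) (l : List Letter) (z : ℕ × ℕ) : ℕ × ℕ :=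
  l.foldr (letterEval n p) z

/-- The number of transpositions performed by a list of letters. -/
def swapCount (n p : ℕ) (l : List Letter) : ℕ :=
  l.foldr (fun c k => letterSwapCount n p c + k) 0

/-- A height from which on a list of letters acts rigidly. -/
def listHeight (l : List Letter) : ℕ :=
  l.foldr (fun c k => letterHeight c + k) 0

theorem rigidFrom_swap (u v : RaySpace n) : RigidFrom (u.2 + v.2 + 1) (swap u v) := by
  have hfix : ∀ i m, u.2 + v.2 + 1 ≤ m → swap u v (i, m) = (i, m) := fun i m hm =>
    swap_apply_of_ne_of_ne (by rintro rfl; simp at hm) (by rintro rfl; simp at hm)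
  intro i k
  rw [hfix i _ le_rfl, hfix i _ (Nat.le_add_right _ _)]

theorem permCongr_rayShift_pow_inv (hp : 1 ≤ p) {i j : Fin n} (hij : i ≠ j) :
    ((raySplit n p hp).permCongr (rayShift i j hij ^ p))⁻¹ =
      (raySplit n p hp).permCongr (rayShift j i hij.symm ^ p) := by
  rw [← rayShift_inv hij, inv_pow]
  rfl

theorem blockShift_mem_closure (hn : 2 ≤ n) (hp : 1 ≤ p) {i j : Fin n} (hij : i ≠ j)
    (h0 : i = ray₁ hn ∨ j = ray₁ hn) : (raySplit n p hp).permCongr (rayShift i j hij ^ p) ∈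
      Subgroup.closure (blockShifts hn hp) := by
  rcases h0 with rfl | rfl
  · exact Subgroup.subset_closure ⟨_, ⟨j, hij, rfl⟩, rfl⟩
  · rw [← permCongr_rayShift_pow_inv hp hij.symm]
    exact inv_mem (Subgroup.subset_closure ⟨_, ⟨i, hij.symm, rfl⟩, rfl⟩)

theorem exists_represents_letterEval (hn : 2 ≤ n) (hp : 1 ≤ p) (c : Letter) :
    ∃ g, Represents (letterEval n p c) g ∧
      HasParityModulo (blockShifts hn hp) g (letterSwapCount n p c) ∧
      RigidFrom (letterHeight c) g := by
  have trivial_action (h : letterEval n p c = id) (h' : letterSwapCount n p c = 0) :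
      ∃ g, Represents (letterEval n p c) g ∧
        HasParityModulo (blockShifts hn hp) g (letterSwapCount n p c) ∧
        RigidFrom (letterHeight c) g :=
    ⟨1, h ▸ .one, by simpa [h'] using HasParity.one.modulo, .mono .one (Nat.zero_le _)⟩
  rcases c with ⟨⟨i, m⟩, ⟨j, k⟩⟩ | ⟨i, j⟩
  · by_cases hij : i < n * p ∧ j < n * p
    · by_cases hne : (i, m) = (j, k)
      · exact trivial_action (by ext1 z; simp [letterEval, hne]) (by simp [letterSwapCount, hne])
      · refine ⟨swap (⟨i, hij.1⟩, m) (⟨j, hij.2⟩, k), fun z => ?_, ?_, rigidFrom_swap _ _⟩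
        · simp only [letterEval, hij, and_self, if_true]
          exact Represents.swap (⟨i, hij.1⟩, m) (⟨j, hij.2⟩, k) z
        · simp only [letterSwapCount, hij, hne, ne_eq, not_false_eq_true, and_self, if_true,
            Nat.cast_one]
          exact (HasParity.of_isSwap ⟨_, _, by simpa using hne, rfl⟩).modulo
    · exact trivial_action (by ext1 z; simp [letterEval, hij])
        (if_neg fun h => hij ⟨h.1, h.2.1⟩)
  · by_cases h : i < n ∧ j < n ∧ i ≠ j ∧ (i = 0 ∨ j = 0)
    · have hij : (⟨i, h.1⟩ : Fin n) ≠ ⟨j, h.2.1⟩ := fun e => h.2.2.1 (congrArg Fin.val e)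
      refine ⟨_, fun z => ?_, ?_, rigidFrom_blockShift hp hij⟩
      · simpa only [letterEval, if_pos h] using Represents.blockShift hp hij z
      · rw [letterSwapCount, Nat.cast_zero]
        exact .of_mem_closure (blockShift_mem_closure hn hp hij (h.2.2.2.imp Fin.ext Fin.ext))
    · exact trivial_action (by ext1 z; simp only [letterEval, if_neg h]; rfl) rfl

theorem exists_represents_listEval (hn : 2 ≤ n) (hp : 1 ≤ p) (l : List Letter) :
    ∃ g, Represents (listEval n p l) g ∧
      HasParityModulo (blockShifts hn hp) g (swapCount n p l) ∧ RigidFrom (listHeight l) g := by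
  induction l with
  | nil => exact ⟨1, .one, by simpa [swapCount] using HasParity.one.modulo, .one⟩
  | cons c l ih =>
    obtain ⟨f, hf, hf_parity, hf_rigid⟩ := exists_represents_letterEval hn hp c
    obtain ⟨g, hg, hg_parity, hg_rigid⟩ := ih
    refine ⟨f * g, hf.mul hg, ?_, hf_rigid.mul hg_rigid⟩
    simpa [swapCount] using hf_parity.mul hg_parity

theorem exists_letterEval_of_isSwap {g : Perm (RaySpace (n * p))} (hg : g.IsSwap) :
    ∃ c, letterSwapCount n p c = 1 ∧ Represents (letterEval n p c) g := by
  obtain ⟨u, v, huv, rfl⟩ := hg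
  refine ⟨.inl (pointCode u, pointCode v), if_pos ⟨u.1.2, v.1.2, pointCode_injective.ne huv⟩,
    fun z => ?_⟩
  rw [← Represents.swap u v z]
  exact if_pos ⟨u.1.2, v.1.2⟩

theorem exists_letterEval_blockShift (hn : 2 ≤ n) (hp : 1 ≤ p) {i j : Fin n} (hij : i ≠ j)
    (h0 : i = ray₁ hn ∨ j = ray₁ hn) : ∃ c, letterSwapCount n p c = 0 ∧
      Represents (letterEval n p c) ((raySplit n p hp).permCongr (rayShift i j hij ^ p)) := by
  refine ⟨.inr (i, j), rfl, fun z => ?_⟩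
  rw [← Represents.blockShift hp hij z]
  exact if_pos ⟨i.2, j.2, Fin.val_ne_of_ne hij,
    h0.imp (congrArg Fin.val) (congrArg Fin.val)⟩

theorem exists_listEval_mul {f g : Perm (RaySpace (n * p))} {e e' : ZMod 2}
    (hf : ∃ c, (letterSwapCount n p c : ZMod 2) = e ∧ Represents (letterEval n p c) f)
    (hg : ∃ l, (swapCount n p l : ZMod 2) = e' ∧ Represents (listEval n p l) g) :
    ∃ l, (swapCount n p l : ZMod 2) = e + e' ∧ Represents (listEval n p l) (f * g) := by
  obtain ⟨c, rfl, hc⟩ := hf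
  obtain ⟨l, rfl, hl⟩ := hg
  exact ⟨c :: l, Nat.cast_add _ _, hc.mul hl⟩

theorem exists_listEval_of_mem_closure {hn : 2 ≤ n} {hp : 1 ≤ p} {g : Perm (RaySpace (n * p))}
    (hg : g ∈ Subgroup.closure (blockShifts hn hp)) :
    ∃ l, (swapCount n p l : ZMod 2) = 0 ∧ Represents (listEval n p l) g := by
  induction hg using Subgroup.closure_induction_left with
  | one => exact ⟨[], by simp [swapCount], .one⟩
  | mul_left f hf g _ ih =>
    obtain ⟨_, ⟨i, hi, rfl⟩, rfl⟩ := hf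
    obtain ⟨c, hc, hcf⟩ := exists_letterEval_blockShift hn hp hi (.inl rfl)
    simpa using exists_listEval_mul ⟨c, by rw [hc, Nat.cast_zero], hcf⟩ ih
  | inv_mul_cancel f hf g _ ih =>
    obtain ⟨_, ⟨i, hi, rfl⟩, rfl⟩ := hf
    obtain ⟨c, hc, hcf⟩ := exists_letterEval_blockShift hn hp hi.symm (.inr rfl)
    rw [← permCongr_rayShift_pow_inv] at hcf
    simpa using exists_listEval_mul ⟨c, by rw [hc, Nat.cast_zero], hcf⟩ ih

theorem HasParityModulo.exists_listEval {hn : 2 ≤ n} {hp : 1 ≤ p} {g : Perm (RaySpace (n * p))}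
    {e : ZMod 2} (hg : HasParityModulo (blockShifts hn hp) g e) :
    ∃ l, (swapCount n p l : ZMod 2) = e ∧ Represents (listEval n p l) g := by
  obtain ⟨u, hu, τ, hτ, rfl, hprod⟩ := hg
  rw [eq_mul_of_mul_inv_eq hprod.symm]
  clear hprod
  induction τ with
  | nil => simpa using exists_listEval_of_mem_closure hu
  | cons f τ ih =>
    obtain ⟨c, hc, hcf⟩ := exists_letterEval_of_isSwap (hτ f List.mem_cons_self)
    have := exists_listEval_mul ⟨c, congrArg Nat.cast hc, hcf⟩
      (ih fun g hg => hτ g (List.mem_cons_of_mem f hg))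
    simpa [mul_assoc, add_comm] using this

theorem exists_mem_houghton_represents {N : ℕ} (hn : 2 ≤ n) (hN : n * 1 = N) (l : List Letter) :
    ∃ c ∈ houghton N, Represents (listEval n 1 l) c ∧ RigidFrom (listHeight l) c := by
  subst hN
  obtain ⟨c, hc, hc_parity, hc_rigid⟩ := exists_represents_listEval hn le_rfl l
  obtain ⟨k, hk⟩ := hc_parity.exists_block_translatesBy
  exact ⟨c, mem_houghton_iff.2 ⟨_, hk⟩, hc, hc_rigid⟩

theorem exists_listEval_of_mem_houghton {N : ℕ} (hn : 2 ≤ n) (hN : n * 1 = N)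
    {c : Perm (RaySpace N)} (hc : c ∈ houghton N) : ∃ l, Represents (listEval n 1 l) c := by
  subst hN
  obtain ⟨t, ht⟩ := mem_houghton_iff.1 hc
  have hblock : t = fun l => t (finProdFinEquiv (rayBlock l, 0)) := by
    funext l
    obtain ⟨⟨i, d⟩, rfl⟩ := finProdFinEquiv.surjective l
    rw [rayBlock_finProdFinEquiv, Subsingleton.elim d 0]
  rw [hblock] at ht
  obtain ⟨e, he⟩ := exists_hasParityModulo_of_block_translatesBy hn le_rfl
    (k := fun i => t (finProdFinEquiv (i, 0))) ht
  obtain ⟨l, -, hl⟩ := he.exists_listEval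
  exact ⟨l, hl⟩

end Letters

section Words

variable {n : ℕ}

/-- The action of a letter of a word in the generators, or of its inverse, on coded points of
`X_n`. -/
def genLetterEval (n : ℕ) (c : Fin 3 × Bool) (z : ℕ × ℕ) : ℕ × ℕ :=
  if c.1 = 0 then (if c.2 then shiftCode 0 1 z else shiftCode 1 0 z)
  else if c.1 = 1 then (swap 0 1 z.1, z.2)
  else if n = 2 then swap (0, 0) (1, 0) z
  else if c.2 then (if z.1 + 1 = n then 0 else z.1 + 1, z.2)
  else (if z.1 = 0 then n - 1 else z.1 - 1, z.2)

/-- The action of a word in the generators on coded points; the first letter acts first. -/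
def wordEval (n : ℕ) (w : GenWord) (z : ℕ × ℕ) : ℕ × ℕ :=
  w.foldl (fun z c => genLetterEval n c z) z

/-- The permutation that is the value of the letter `(s, c)`. -/
def genLetterPerm (hn : 2 ≤ n) (c : Fin 3 × Bool) : Perm (RaySpace n) :=
  if c.2 then generator hn c.1 else (generator hn c.1)⁻¹

theorem GenWord.toPerm_cons (hn : 2 ≤ n) (c : Fin 3 × Bool) (w : GenWord) :
    GenWord.toPerm hn (c :: w) = w.toPerm hn * genLetterPerm hn c := by
  rcases c with ⟨s, _ | _⟩ <;> rfl

theorem rayPerm_inv (σ : Perm (Fin n)) : (rayPerm σ)⁻¹ = rayPerm σ⁻¹ := rfl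

theorem rigidFrom_rayPerm (σ : Perm (Fin n)) : RigidFrom 0 (rayPerm σ) := fun i k => by
  simp [rayPerm]

theorem represents_rayPerm_finRotate (hn : 2 ≤ n) :
    Represents (fun z => (if z.1 + 1 = n then 0 else z.1 + 1, z.2)) (rayPerm (finRotate n)) := by
  obtain ⟨n, rfl⟩ := Nat.exists_eq_add_of_le' (one_le_two.trans hn)
  refine Represents.rayPerm (s := fun i => if i + 1 = n + 1 then 0 else i + 1) fun i => ?_
  rw [show (finRotate (n + 1) i : ℕ) = _ from coe_finRotate i]
  simp only [Nat.add_right_cancel_iff, Fin.ext_iff, Fin.val_last]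

theorem represents_rayPerm_finRotate_inv (hn : 2 ≤ n) :
    Represents (fun z => (if z.1 = 0 then n - 1 else z.1 - 1, z.2)) (rayPerm (finRotate n))⁻¹ := by
  refine Represents.rayPerm (s := fun i => if i = 0 then n - 1 else i - 1) fun i => ?_
  obtain ⟨i, rfl⟩ := (finRotate n).surjective i
  have hi := (represents_rayPerm_finRotate hn).apply i 0
  simp only [rayPerm, prodCongr_apply, Prod.map, Prod.mk.injEq, refl_apply, and_true] at hi
  rw [symm_apply_apply, ← hi]
  grind

theorem represents_genLetterEval (hn : 2 ≤ n) (c : Fin 3 × Bool) :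
    Represents (genLetterEval n c) (genLetterPerm hn c) := by
  obtain ⟨s, c⟩ := c
  fin_cases s
  · cases c
    · change Represents (shiftCode 1 0) (rayShift _ _ (ray₁_ne_ray₂ hn))⁻¹
      exact rayShift_inv (ray₁_ne_ray₂ hn) ▸ Represents.rayShift (ray₁_ne_ray₂ hn).symm
    · exact Represents.rayShift (ray₁_ne_ray₂ hn)
  · have h : Represents (Prod.map (swap 0 1) id) (rayPerm (swap (ray₁ hn) (ray₂ hn))) :=
      Represents.rayPerm fun i => Fin.val_injective.swap_apply (ray₁ hn) (ray₂ hn) i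
    cases c
    · change Represents (Prod.map (swap 0 1) id) (rayPerm (swap (ray₁ hn) (ray₂ hn)))⁻¹
      rwa [rayPerm_inv, swap_inv]
    · exact h
  · by_cases h2 : n = 2
    · refine fun z => .trans ?_ (.trans (Represents.swap (ray₁ hn, 0) (ray₂ hn, 0) z) ?_)
      · simp [genLetterEval, h2, pointCode, ray₁, ray₂]
      · simp [genLetterPerm, generator, h2]
    · have h := represents_rayPerm_finRotate hn
      have h' := represents_rayPerm_finRotate_inv hn
      unfold genLetterEval
      cases c <;> simpa [genLetterPerm, generator, h2]

theorem rigidFrom_genLetterPerm (hn : 2 ≤ n) (c : Fin 3 × Bool) :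
    RigidFrom 1 (genLetterPerm hn c) := by
  have hrayPerm (σ : Perm (Fin n)) : RigidFrom 1 (rayPerm σ) :=
    (rigidFrom_rayPerm σ).mono zero_le_one
  obtain ⟨s, c⟩ := c
  fin_cases s
  · cases c
    · change RigidFrom 1 (rayShift _ _ (ray₁_ne_ray₂ hn))⁻¹
      exact rayShift_inv (ray₁_ne_ray₂ hn) ▸ rayShift_rigidFrom (ray₁_ne_ray₂ hn).symm
    · exact rayShift_rigidFrom (ray₁_ne_ray₂ hn)
  · cases c <;> exact hrayPerm _
  · by_cases h2 : n = 2
    · have h := rigidFrom_swap (ray₁ hn, 0) (ray₂ hn, 0)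
      simpa [genLetterPerm, generator, h2] using h
    · cases c <;> simp [genLetterPerm, generator, h2, rayPerm_inv, hrayPerm]

theorem represents_wordEval (hn : 2 ≤ n) (w : GenWord) :
    Represents (wordEval n w) (w.toPerm hn) := by
  induction w with
  | nil => exact .one
  | cons c w ih =>
    rw [GenWord.toPerm_cons]
    exact ih.mul (represents_genLetterEval hn c)

theorem GenWord.rigidFrom_toPerm (hn : 2 ≤ n) (w : GenWord) :
    RigidFrom w.length (w.toPerm hn) := by
  induction w with
  | nil => exact .one
  | cons c w ih =>
    rw [GenWord.toPerm_cons]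
    exact ih.mul (rigidFrom_genLetterPerm hn c)

end Words

/-! ### Recursively enumerable predicates -/

section Searchable

attribute [fun_prop] Primrec PrimrecPred Primrec.const Primrec.id Primrec.comp Primrec.pair
  Primrec.fst Primrec.snd Primrec.ite Primrec.list_length PrimrecPred.comp PrimrecPred.and
  PrimrecPred.or PrimrecPred.not

variable {α β : Type*} [Primcodable α] [Primcodable β] {f g : α → ℕ}

@[fun_prop]
theorem primrec_add (hf : Primrec f) (hg : Primrec g) : Primrec fun a => f a + g a :=
  Primrec.nat_add.comp hf hg

@[fun_prop]
theorem primrec_sub (hf : Primrec f) (hg : Primrec g) : Primrec fun a => f a - g a :=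
  Primrec.nat_sub.comp hf hg

@[fun_prop]
theorem primrec_mul (hf : Primrec f) (hg : Primrec g) : Primrec fun a => f a * g a :=
  Primrec.nat_mul.comp hf hg

@[fun_prop]
theorem primrec_div (hf : Primrec f) (hg : Primrec g) : Primrec fun a => f a / g a :=
  Primrec.nat_div.comp hf hg

@[fun_prop]
theorem primrec_mod (hf : Primrec f) (hg : Primrec g) : Primrec fun a => f a % g a :=
  Primrec.nat_mod.comp hf hg

@[fun_prop]
theorem primrec_pow (hf : Primrec f) (hg : Primrec g) : Primrec fun a => f a ^ g a :=
  (Primrec₂.unpaired'.1 Nat.Primrec.pow).comp hf hg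

@[fun_prop]
theorem primrec_sum_range {F : α → ℕ → ℕ} (hf : Primrec f)
    (hF : Primrec fun z : α × ℕ => F z.1 z.2) :
    Primrec fun a => ∑ i ∈ Finset.range (f a), F a i := by
  refine (Primrec.nat_rec' hf (Primrec.const 0) (h := fun a z => z.2 + F a z.1) ?_).of_eq
    fun a => ?_
  · exact Primrec₂.mk (by fun_prop)
  · induction f a with
    | zero => rfl
    | succ k ih => rw [Finset.sum_range_succ, ← ih]

@[fun_prop]
theorem primrecPred_eq {f g : α → β} (hf : Primrec f) (hg : Primrec g) :
    PrimrecPred fun a => f a = g a := Primrec.eq.comp hf hg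

@[fun_prop]
theorem primrecPred_le (hf : Primrec f) (hg : Primrec g) : PrimrecPred fun a => f a ≤ g a :=
  Primrec.nat_le.comp hf hg

@[fun_prop]
theorem primrecPred_lt (hf : Primrec f) (hg : Primrec g) : PrimrecPred fun a => f a < g a :=
  Primrec.nat_lt.comp hf hg

/-- `q` is recursively enumerable, in the form `∃ k, R (a, k)` with `R` primitive recursive. -/
@[fun_prop]
def IsSearchable (q : α → Prop) : Prop :=
  ∃ R : α × ℕ → Prop, PrimrecPred R ∧ ∀ a, q a ↔ ∃ k, R (a, k)

/-- All numbers below `k` satisfy `q`. As a constant, this bounded quantifier is visible to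
`fun_prop`. -/
def ForallBelow (k : ℕ) (q : ℕ → Prop) : Prop := ∀ i < k, q i

variable {q r : α → Prop}

theorem primrec_unpair_snd : Primrec fun z : α × ℕ => z.2.unpair :=
  Primrec.unpair.comp Primrec.snd

theorem primrecPred_forall_lt {q : α → ℕ → Prop} (hf : Primrec f)
    (hq : PrimrecPred fun z : α × ℕ => q z.1 z.2) : PrimrecPred fun a => ∀ i < f a, q a i := by
  have h : PrimrecRel fun (i : ℕ) (a : α) => q a i := hq.comp (Primrec.snd.pair Primrec.fst)
  simpa using h.forall_mem_list.comp (Primrec.list_range.comp hf) Primrec.id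

theorem primrecPred_exists_mem {q : α → β → Prop} {l : α → List β} (hl : Primrec l)
    (hq : PrimrecPred fun z : α × β => q z.1 z.2) : PrimrecPred fun a => ∃ b ∈ l a, q a b := by
  have h : PrimrecRel fun (b : β) (a : α) => q a b := hq.comp (Primrec.snd.pair Primrec.fst)
  exact h.exists_mem_list.comp hl Primrec.id

namespace IsSearchable

theorem of_primrecPred (hq : PrimrecPred q) : IsSearchable q :=
  ⟨fun z => q z.1, by fun_prop, by simp⟩

@[fun_prop]
theorem eq {f g : α → β} (hf : Primrec f) (hg : Primrec g) : IsSearchable fun a => f a = g a :=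
  of_primrecPred (by fun_prop)

@[fun_prop]
theorem ne {f g : α → β} (hf : Primrec f) (hg : Primrec g) : IsSearchable fun a => f a ≠ g a :=
  of_primrecPred (by fun_prop)

@[fun_prop]
theorem not_iff (hq : PrimrecPred q) (hr : PrimrecPred r) :
    IsSearchable fun a => ¬ (q a ↔ r a) := by
  have h : (fun a => ¬ (q a ↔ r a)) = fun a => q a ∧ ¬ r a ∨ ¬ q a ∧ r a := by
    funext a
    exact propext (by tauto)
  exact h ▸ of_primrecPred (by fun_prop)

@[fun_prop]
theorem le (hf : Primrec f) (hg : Primrec g) : IsSearchable fun a => f a ≤ g a :=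
  of_primrecPred (by fun_prop)

@[fun_prop]
theorem lt (hf : Primrec f) (hg : Primrec g) : IsSearchable fun a => f a < g a :=
  of_primrecPred (by fun_prop)

@[fun_prop]
theorem and (hq : IsSearchable q) (hr : IsSearchable r) : IsSearchable fun a => q a ∧ r a := by
  obtain ⟨R, hR, hq⟩ := hq
  obtain ⟨S, hS, hr⟩ := hr
  have := primrec_unpair_snd (α := α)
  refine ⟨fun z => R (z.1, z.2.unpair.1) ∧ S (z.1, z.2.unpair.2), by fun_prop, fun a => ?_⟩
  simp only [hq, hr]
  constructor
  · rintro ⟨⟨k, hk⟩, l, hl⟩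
    exact ⟨Nat.pair k l, by simpa using ⟨hk, hl⟩⟩
  · rintro ⟨k, hk, hl⟩
    exact ⟨⟨_, hk⟩, _, hl⟩

@[fun_prop]
theorem or (hq : IsSearchable q) (hr : IsSearchable r) : IsSearchable fun a => q a ∨ r a := by
  obtain ⟨R, hR, hq⟩ := hq
  obtain ⟨S, hS, hr⟩ := hr
  exact ⟨fun z => R z ∨ S z, by fun_prop, fun a => by simp only [hq, hr, exists_or]⟩

@[fun_prop]
theorem existsType {q : α → β → Prop} (hq : IsSearchable fun z : α × β => q z.1 z.2) :
    IsSearchable fun a => ∃ b, q a b := by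
  obtain ⟨R, hR, hq⟩ := hq
  have := primrec_unpair_snd (α := α)
  have hd : Primrec fun z : α × ℕ => (Encodable.decode (α := β) z.2.unpair.1).toList :=
    Primrec.optionToList.comp (Primrec.decode.comp (by fun_prop))
  have := this.comp (Primrec.fst (β := β))
  refine ⟨_, primrecPred_exists_mem (q := fun z b => R ((z.1, b), z.2.unpair.2)) hd (by fun_prop),
    fun a => ⟨?_, ?_⟩⟩
  · rintro ⟨b, hb⟩
    obtain ⟨k, hk⟩ := (hq (a, b)).1 hb
    exact ⟨Nat.pair (Encodable.encode b) k, b, by simp, by simpa using hk⟩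
  · rintro ⟨k, b, -, hk⟩
    exact ⟨b, (hq (a, b)).2 ⟨_, hk⟩⟩

@[fun_prop]
theorem forallBelow {q : α → ℕ → Prop} (hf : Primrec f)
    (hq : IsSearchable fun z : α × ℕ => q z.1 z.2) :
    IsSearchable fun a => ForallBelow (f a) (q a) := by
  obtain ⟨R, hR, hq⟩ := hq
  refine ⟨_, primrecPred_forall_lt (f := fun z => f z.1) (by fun_prop)
    (q := fun z i => ∃ k ∈ List.range z.2, R ((z.1, i), k))
    (primrecPred_exists_mem (Primrec.list_range.comp (by fun_prop)) (by fun_prop)), fun a => ?_⟩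
  simp only [List.mem_range]
  simp only [ForallBelow, show ∀ i, q a i ↔ _ from fun i => hq (a, i)]
  constructor
  · intro h
    choose! k hk using h
    refine ⟨(Finset.range (f a)).sup k + 1, fun i hi => ⟨k i, ?_, hk i hi⟩⟩
    exact Nat.lt_succ_of_le (Finset.le_sup (f := k) (Finset.mem_range.2 hi))
  · rintro ⟨K, hK⟩ i hi
    obtain ⟨k, -, hk⟩ := hK i hi
    exact ⟨k, hk⟩

end IsSearchable

end Searchable

section Evaluators

variable {α : Type*} [Primcodable α]

@[fun_prop]
theorem primrec_swap {β : Type*} [Primcodable β] [DecidableEq β] {u v z : α → β}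
    (hu : Primrec u) (hv : Primrec v) (hz : Primrec z) :
    Primrec fun a => swap (u a) (v a) (z a) := by
  simp only [swap_apply_def]
  fun_prop

@[fun_prop]
theorem primrec_shiftCode {i j : α → ℕ} {z : α → ℕ × ℕ} (hi : Primrec i) (hj : Primrec j)
    (hz : Primrec z) : Primrec fun a => shiftCode (i a) (j a) (z a) := by
  unfold shiftCode
  fun_prop

@[fun_prop]
theorem primrec_blockShiftCode {p i j : α → ℕ} {z : α → ℕ × ℕ} (hp : Primrec p) (hi : Primrec i)
    (hj : Primrec j) (hz : Primrec z) :
    Primrec fun a => blockShiftCode (p a) (i a) (j a) (z a) := by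
  have h := Primrec.nat_iterate hp (f := p) (g := fun a => unsplitCode (p a) (z a))
    (by unfold unsplitCode; fun_prop) (h := fun a => shiftCode (i a) (j a))
    (Primrec₂.mk (by fun_prop))
  simp only [blockShiftCode, splitCode, Function.comp_apply]
  fun_prop

@[fun_prop]
theorem primrec_letterEval {n p : α → ℕ} {c : α → Letter} {z : α → ℕ × ℕ} (hn : Primrec n)
    (hp : Primrec p) (hc : Primrec c) (hz : Primrec z) :
    Primrec fun a => letterEval (n a) (p a) (c a) (z a) := by
  refine (Primrec.sumCasesOn hc
    (g := fun a u => if u.1.1 < n a * p a ∧ u.2.1 < n a * p a then swap u.1 u.2 (z a) else z a)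
    (h := fun a i => if i.1 < n a ∧ i.2 < n a ∧ i.1 ≠ i.2 ∧ (i.1 = 0 ∨ i.2 = 0) then
      blockShiftCode (p a) i.1 i.2 (z a) else z a)
    (Primrec₂.mk (by fun_prop)) (Primrec₂.mk (by fun_prop))).of_eq fun a => ?_
  unfold letterEval
  cases c a <;> rfl

@[fun_prop]
theorem primrec_letterSwapCount {n p : α → ℕ} {c : α → Letter} (hn : Primrec n)
    (hp : Primrec p) (hc : Primrec c) :
    Primrec fun a => letterSwapCount (n a) (p a) (c a) := by
  refine (Primrec.sumCasesOn hc
    (g := fun a u => if u.1.1 < n a * p a ∧ u.2.1 < n a * p a ∧ u.1 ≠ u.2 then 1 else 0)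
    (h := fun _ _ => 0) (Primrec₂.mk (by fun_prop)) (Primrec₂.mk (by fun_prop))).of_eq fun a => ?_
  unfold letterSwapCount
  cases c a <;> rfl

@[fun_prop]
theorem primrec_letterHeight {c : α → Letter} (hc : Primrec c) :
    Primrec fun a => letterHeight (c a) := by
  refine (Primrec.sumCasesOn hc (g := fun _ u => u.1.2 + u.2.2 + 1) (h := fun _ _ => 1)
    (Primrec₂.mk (by fun_prop)) (Primrec₂.mk (by fun_prop))).of_eq fun a => ?_
  unfold letterHeight
  cases c a <;> rfl

@[fun_prop]
theorem primrec_listEval {n p : α → ℕ} {l : α → List Letter} {z : α → ℕ × ℕ} (hn : Primrec n)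
    (hp : Primrec p) (hl : Primrec l) (hz : Primrec z) :
    Primrec fun a => listEval (n a) (p a) (l a) (z a) :=
  Primrec.list_foldr hl hz (h := fun a q => letterEval (n a) (p a) q.1 q.2)
    (Primrec₂.mk (by fun_prop))

@[fun_prop]
theorem primrec_swapCount {n p : α → ℕ} {l : α → List Letter} (hn : Primrec n)
    (hp : Primrec p) (hl : Primrec l) : Primrec fun a => swapCount (n a) (p a) (l a) :=
  Primrec.list_foldr hl (Primrec.const 0)
    (h := fun a q => letterSwapCount (n a) (p a) q.1 + q.2) (Primrec₂.mk (by fun_prop))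

@[fun_prop]
theorem primrec_listHeight {l : α → List Letter} (hl : Primrec l) :
    Primrec fun a => listHeight (l a) :=
  Primrec.list_foldr hl (Primrec.const 0)
    (h := fun _ (q : Letter × ℕ) => letterHeight q.1 + q.2) (Primrec₂.mk (by fun_prop))

@[fun_prop]
theorem primrec_genLetterEval {N : α → ℕ} {c : α → Fin 3 × Bool} {z : α → ℕ × ℕ} (hN : Primrec N)
    (hc : Primrec c) (hz : Primrec z) : Primrec fun a => genLetterEval (N a) (c a) (z a) := by
  unfold genLetterEval
  fun_prop

@[fun_prop]
theorem primrec_wordEval {N : α → ℕ} {w : α → GenWord} {z : α → ℕ × ℕ} (hN : Primrec N)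
    (hw : Primrec w) (hz : Primrec z) : Primrec fun a => wordEval (N a) (w a) (z a) :=
  Primrec.list_foldl hw hz (h := fun a q => genLetterEval (N a) q.2 q.1)
    (Primrec₂.mk (by fun_prop))

/-- The action of a power of a word on coded points. -/
def wordPow (N : ℕ) (w : GenWord) (k : ℕ) (z : ℕ × ℕ) : ℕ × ℕ := (wordEval N w)^[k] z

@[fun_prop]
theorem primrec_wordPow {N : α → ℕ} {w : α → GenWord} {k : α → ℕ} {z : α → ℕ × ℕ}
    (hN : Primrec N) (hw : Primrec w) (hk : Primrec k) (hz : Primrec z) :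
    Primrec fun a => wordPow (N a) (w a) (k a) (z a) :=
  Primrec.nat_iterate hk hz (h := fun a => wordEval (N a) (w a)) (Primrec₂.mk (by fun_prop))

end Evaluators

/-! ### Certificates as recursively enumerable predicates -/

section Digits

variable {α : Type*} [Primcodable α] {N d β u : ℕ}

/-- The base-`D` digit of `u` at place `i`. -/
def digitAt (D u i : ℕ) : ℕ := u / D ^ i % D

@[fun_prop]
theorem primrec_digitAt {D u i : α → ℕ} (hD : Primrec D) (hu : Primrec u) (hi : Primrec i) :
    Primrec fun q => digitAt (D q) (u q) (i q) := by
  unfold digitAt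
  fun_prop

theorem exists_digitAt {D : ℕ} (f : Fin N → Fin D) :
    ∃ u < D ^ N, ∀ i : Fin N, digitAt D u i = f i :=
  ⟨finFunctionFinEquiv f, Fin.is_lt _, fun i =>
    congrArg Fin.val (congrFun (finFunctionFinEquiv.symm_apply_apply f) i)⟩

theorem exists_forall_lt_iff_exists_digitAt (hd : 0 < d) {P : (Fin N → ℕ) → Prop} :
    (∃ f : Fin N → ℕ, (∀ i, f i < d) ∧ P f) ↔ ∃ u, P fun i : Fin N => digitAt d u i := by
  constructor
  · rintro ⟨f, hf, hP⟩
    obtain ⟨u, -, hu⟩ := exists_digitAt fun i => ⟨f i, hf i⟩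
    exact ⟨u, by simpa only [hu] using hP⟩
  · rintro ⟨u, hP⟩
    exact ⟨_, fun i => Nat.mod_lt _ hd, hP⟩

/-- The vector with entries in `[-β, β]` whose entries, raised by `β`, are the base-`(2 * β + 1)`
digits of `u`. -/
def codedVector (N β u : ℕ) (i : Fin N) : ℤ := digitAt (2 * β + 1) u i - β

theorem natAbs_codedVector_le (i : Fin N) : (codedVector N β u i).natAbs ≤ β := by
  have : digitAt (2 * β + 1) u i < 2 * β + 1 := Nat.mod_lt _ (by omega)
  unfold codedVector
  omega

theorem exists_codedVector {w : Fin N → ℤ} (hw : ∀ i, (w i).natAbs ≤ β) :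
    ∃ u < (2 * β + 1) ^ N, codedVector N β u = w := by
  obtain ⟨u, hu, h⟩ := exists_digitAt fun i =>
    (⟨(w i + β).toNat, by have := hw i; omega⟩ : Fin (2 * β + 1))
  refine ⟨u, hu, funext fun i => ?_⟩
  have := hw i
  rw [codedVector, h]
  dsimp only
  omega

theorem codedVector_eq_iff {i j : Fin N} : codedVector N β u i = codedVector N β u j ↔
    digitAt (2 * β + 1) u i = digitAt (2 * β + 1) u j := by
  rw [codedVector, codedVector, sub_left_inj, Nat.cast_inj]

theorem forallBelow_iff {q : ℕ → Prop} : ForallBelow N q ↔ ∀ i : Fin N, q i :=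
  ⟨fun h i => h i i.2, fun h i hi => h ⟨i, hi⟩⟩

theorem forallBelow_codedVector_iff {q : ℕ → Prop} {P : (Fin N → ℤ) → Prop}
    (h : ∀ u, q u ↔ P (codedVector N β u)) :
    ForallBelow ((2 * β + 1) ^ N) q ↔ ∀ w, (∀ i, (w i).natAbs ≤ β) → P w := by
  constructor
  · intro hq w hw
    obtain ⟨u, hu, rfl⟩ := exists_codedVector hw
    exact (h u).1 (hq u hu)
  · exact fun hP u _ => (h u).2 (hP _ natAbs_codedVector_le)

theorem sum_range_modEq_iff {f g : ℕ → ℕ} :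
    ∑ i ∈ Finset.range N, f i ≡ ∑ i ∈ Finset.range N, g i [MOD d] ↔
      (d : ℤ) ∣ ∑ i : Fin N, ((f i : ℤ) - g i) := by
  rw [Nat.ModEq.comm, Nat.modEq_iff_dvd, Finset.sum_range, Finset.sum_range,
    Finset.sum_sub_distrib]
  push_cast
  rfl

@[fun_prop]
theorem IsSearchable.modEq {d f g : α → ℕ} (hd : Primrec d) (hf : Primrec f) (hg : Primrec g) :
    IsSearchable fun a => f a ≡ g a [MOD d a] := by
  unfold Nat.ModEq
  fun_prop

@[fun_prop]
theorem IsSearchable.not_modEq {d f g : α → ℕ} (hd : Primrec d) (hf : Primrec f) (hg : Primrec g) :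
    IsSearchable fun a => ¬ f a ≡ g a [MOD d a] := by
  unfold Nat.ModEq
  fun_prop

end Digits

section CodedAdmissibility

variable {N : ℕ} {q : ℕ × ℕ → Prop}

theorem exists_pointCode_iff : (∃ z : ℕ × ℕ, z.1 < N ∧ q z) ↔ ∃ z : RaySpace N, q (pointCode z) :=
  ⟨fun ⟨z, hz, h⟩ => ⟨(⟨z.1, hz⟩, z.2), h⟩, fun ⟨z, h⟩ => ⟨pointCode z, z.1.2, h⟩⟩

theorem forallBelow_pointCode_iff {K : ℕ} :
    (ForallBelow N fun i => ForallBelow K fun m => q (i, m)) ↔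
      ∀ z : RaySpace N, z.2 < K → q (pointCode z) :=
  ⟨fun h z hz => h z.1 z.1.2 z.2 hz, fun h i hi m hm => h (⟨i, hi⟩, m) hm⟩

theorem represents_wordPow (hN : 2 ≤ N) (a : GenWord) (k : ℕ) :
    Represents (wordPow N a k) (a.toPerm hN ^ k) :=
  (represents_wordEval hN a).iterate k

/-- The height of the image under `a ^ L` of the point at height `L * a.length` on ray `i`. -/
def driftHeight (N : ℕ) (a : GenWord) (L i : ℕ) : ℕ := (wordPow N a L (i, L * a.length)).2

/-- `movingPart` on coded points. -/
def CodedMoving (N : ℕ) (a : GenWord) (L β : ℕ) (z : ℕ × ℕ) : Prop :=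
  driftHeight N a L z.1 ≠ L * a.length ∧ L * a.length + β ≤ z.2

/-- `shiftPoint` on coded points, for the translation vector coded by `u`. -/
def codedShift (β u : ℕ) (z : ℕ × ℕ) : ℕ × ℕ := (z.1, z.2 + digitAt (2 * β + 1) u z.1 - β)

/-- The translation vector coded by `u` violates one of the clauses of `IsAdmissible`. -/
def CodedInadmissible (N : ℕ) (a : GenWord) (L β u : ℕ) : Prop :=
  (∃ i, i < N ∧ digitAt (2 * β + 1) u (wordEval N a (i, a.length)).1 ≠ digitAt (2 * β + 1) u i) ∨
  (∃ r, ∑ i ∈ Finset.range N, (if wordPow N a r (i, r * a.length) = (i, r * a.length) then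
    digitAt (2 * β + 1) u i else β) ≠ N * β) ∨
  ∃ z : ℕ × ℕ, z.1 < N ∧ ∃ k, CodedMoving N a L β z ∧ CodedMoving N a L β (wordPow N a k z) ∧
    wordPow N a k (codedShift β u z) ≠ codedShift β u (wordPow N a k z)

section Computability

variable {α : Type*} [Primcodable α] {N L β u : α → ℕ} {a : α → GenWord}

@[fun_prop]
theorem primrec_driftHeight {i : α → ℕ} (hN : Primrec N) (ha : Primrec a) (hL : Primrec L)
    (hi : Primrec i) : Primrec fun q => driftHeight (N q) (a q) (L q) (i q) := by
  unfold driftHeight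
  fun_prop

@[fun_prop]
theorem isSearchable_codedInadmissible (hN : Primrec N) (ha : Primrec a) (hL : Primrec L)
    (hβ : Primrec β) (hu : Primrec u) :
    IsSearchable fun q => CodedInadmissible (N q) (a q) (L q) (β q) (u q) := by
  unfold CodedInadmissible CodedMoving codedShift
  fun_prop

end Computability

variable (hN : 2 ≤ N) (a : GenWord) (L β u : ℕ)

theorem driftHeight_eq (i : Fin N) : (driftHeight N a L i : ℤ) =
    translationAt (a.toPerm hN ^ L) (L * a.length) i + (L * a.length : ℕ) := by
  rw [driftHeight, (represents_wordPow hN a L).apply, translationAt, sub_add_cancel]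

theorem driftHeight_ne_iff (i : Fin N) : driftHeight N a L i ≠ L * a.length ↔
    translationAt (a.toPerm hN ^ L) (L * a.length) i ≠ 0 := by
  have := driftHeight_eq hN a L i
  omega

theorem codedMoving_pointCode_iff (z : RaySpace N) : CodedMoving N a L β (pointCode z) ↔
    z ∈ movingPart (translationAt (a.toPerm hN ^ L) (L * a.length)) (L * a.length + β) :=
  and_congr (driftHeight_ne_iff hN a L z.1) Iff.rfl

theorem codedShift_pointCode (z : RaySpace N) :
    codedShift β u (pointCode z) = pointCode (shiftPoint (codedVector N β u) z) := by
  simp only [codedShift, pointCode, shiftPoint, codedVector, Prod.mk.injEq, true_and]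
  omega

theorem exists_digitAt_ne_iff :
    (∃ i, i < N ∧
      digitAt (2 * β + 1) u (wordEval N a (i, a.length)).1 ≠ digitAt (2 * β + 1) u i) ↔
      ¬ ∀ i, codedVector N β u (a.toPerm hN (i, a.length)).1 = codedVector N β u i := by
  rw [not_forall, Fin.exists_iff]
  refine exists_congr fun i => exists_prop.symm.trans (exists_congr fun hi => not_congr ?_)
  rw [codedVector_eq_iff, (represents_wordEval hN a).apply ⟨i, hi⟩]

theorem sum_digitAt_of_fixesRay_eq_iff (r : ℕ) :
    ∑ i ∈ Finset.range N, (if wordPow N a r (i, r * a.length) = (i, r * a.length) then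
      digitAt (2 * β + 1) u i else β) = N * β ↔
      open Classical in ∑ i with FixesRay (a.toPerm hN) r i, codedVector N β u i = 0 := by
  classical
  have hfix (i : Fin N) : wordPow N a r (i, r * a.length) = (↑i, r * a.length) ↔
      FixesRay (a.toPerm hN) r i := by
    rw [(a.rigidFrom_toPerm hN).fixesRay_iff le_rfl]
    exact (represents_wordPow hN a r).apply_eq_iff (z := (i, _)) (z' := (i, _))
  have hsum : (N * β : ℤ) = ∑ _i : Fin N, (β : ℤ) := by simp
  rw [Finset.sum_range, Finset.sum_filter, ← Nat.cast_inj (R := ℤ), ← sub_eq_zero]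
  push_cast
  rw [hsum, ← Finset.sum_sub_distrib]
  simp only [hfix]
  refine Eq.congr (Finset.sum_congr rfl fun i _ => ?_) rfl
  split_ifs <;> simp [codedVector]

theorem exists_codedShift_ne_iff :
    (∃ z : ℕ × ℕ, z.1 < N ∧ ∃ k, CodedMoving N a L β z ∧ CodedMoving N a L β (wordPow N a k z) ∧
      wordPow N a k (codedShift β u z) ≠ codedShift β u (wordPow N a k z)) ↔
      ¬ ∀ z ∈ movingPart (translationAt (a.toPerm hN ^ L) (L * a.length)) (L * a.length + β),
        ∀ k : ℕ, (a.toPerm hN ^ k) z ∈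
            movingPart (translationAt (a.toPerm hN ^ L) (L * a.length)) (L * a.length + β) →
          (a.toPerm hN ^ k) (shiftPoint (codedVector N β u) z) =
            shiftPoint (codedVector N β u) ((a.toPerm hN ^ k) z) := by
  have hr (k : ℕ) (z : RaySpace N) := represents_wordPow hN a k z
  rw [exists_pointCode_iff]
  simp only [hr, codedShift_pointCode, codedMoving_pointCode_iff hN, ne_eq,
    pointCode_injective.eq_iff]
  push Not
  simp only [exists_and_left]

theorem codedInadmissible_iff : CodedInadmissible N a L β u ↔
    ¬ IsAdmissible (a.toPerm hN) a.length (L * a.length) β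
      (translationAt (a.toPerm hN ^ L) (L * a.length)) (codedVector N β u) := by
  simp only [CodedInadmissible, exists_digitAt_ne_iff hN, ne_eq,
    sum_digitAt_of_fixesRay_eq_iff hN, exists_codedShift_ne_iff hN, ← not_forall, ← not_and_or]
  exact not_congr ⟨fun h => ⟨h.1, h.2.1, h.2.2⟩, fun h => ⟨h.cycle, h.fixed, h.orbit⟩⟩

end CodedAdmissibility

section CodedDual

/-- `DualCertificate` for the translation vector coded by `u`, with the entries of the functional
coded as digits. -/
def CodedDual (n p : ℕ) (a x : GenWord) (L β u : ℕ) : Prop :=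
  ∃ d, 0 < d ∧ ∃ lam,
    ForallBelow n (fun j =>
      ∑ i ∈ Finset.range (n * p), (if i / p = j then digitAt d lam i else 0) ≡ 0 [MOD d]) ∧
    ForallBelow ((2 * β + 1) ^ (n * p)) (fun v => CodedInadmissible (n * p) a L β v ∨
      ∑ i ∈ Finset.range (n * p), digitAt d lam i * (2 * digitAt (2 * β + 1) v i) ≡
        ∑ i ∈ Finset.range (n * p), digitAt d lam i * (2 * β) [MOD d]) ∧
    ¬ ∑ i ∈ Finset.range (n * p), digitAt d lam i *
        (digitAt (2 * β + 1) u i + (wordEval (n * p) x (i, x.length)).2) ≡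
      ∑ i ∈ Finset.range (n * p), digitAt d lam i * (β + x.length) [MOD d]

@[fun_prop]
theorem isSearchable_codedDual {α : Type*} [Primcodable α] {n p L β u : α → ℕ}
    {a x : α → GenWord} (hn : Primrec n) (hp : Primrec p) (ha : Primrec a) (hx : Primrec x)
    (hL : Primrec L) (hβ : Primrec β) (hu : Primrec u) :
    IsSearchable fun q => CodedDual (n q) (p q) (a q) (x q) (L q) (β q) (u q) := by
  unfold CodedDual
  fun_prop

variable {n p : ℕ}

theorem sum_digitAt_block_modEq_iff (d lam : ℕ) (j : Fin n) :
    ∑ i ∈ Finset.range (n * p), (if i / p = j then digitAt d lam i else 0) ≡ 0 [MOD d] ↔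
    (d : ℤ) ∣ ∑ i : Fin (n * p), if rayBlock i = j then (digitAt d lam i : ℤ) else 0 := by
  have hblock (i : Fin (n * p)) : (i : ℕ) / p = j ↔ rayBlock i = j := by
    rw [Fin.ext_iff]
    rfl
  rw [Nat.modEq_zero_iff_dvd, Finset.sum_range, ← Int.natCast_dvd_natCast]
  push_cast
  simp only [hblock]

theorem codedDual_iff (hN : 2 ≤ n * p) (a x : GenWord) (L β u : ℕ) :
    CodedDual n p a x L β u ↔
      DualCertificate (a.toPerm hN) a.length (L * a.length) β
        (translationAt (a.toPerm hN ^ L) (L * a.length)) (translationAt (x.toPerm hN) x.length)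
        (codedVector (n * p) β u) := by
  refine exists_congr fun d => and_congr_right fun hd => ?_
  rw [exists_forall_lt_iff_exists_digitAt hd]
  refine exists_congr fun lam => and_congr ?_ (and_congr ?_ (not_congr ?_))
  · rw [forallBelow_iff]
    exact forall_congr' (sum_digitAt_block_modEq_iff d lam)
  · refine forallBelow_codedVector_iff fun v => or_congr (codedInadmissible_iff hN a L β v) ?_
    rw [sum_range_modEq_iff]
    refine Eq.to_iff (congrArg _ (Finset.sum_congr rfl fun i _ => ?_))
    rw [codedVector]
    push_cast
    ring
  · rw [sum_range_modEq_iff]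
    refine Eq.to_iff (congrArg _ (Finset.sum_congr rfl fun i _ => ?_))
    rw [codedVector, translationAt, (represents_wordEval hN x).apply]
    push_cast
    ring

end CodedDual

section CodedOdd

/-- `HasRigidOrbits` on coded points. -/
def CodedRigid (N : ℕ) (a : GenWord) (L : ℕ) : Prop :=
  ForallBelow N (fun i => driftHeight N a L i ≠ L * a.length) ∧
  ForallBelow N fun i => ForallBelow (L * a.length) fun m =>
    ForallBelow N fun i' => ForallBelow (L * a.length) fun m' =>
      (∃ k, L * a.length ≤ (wordPow N a k (i, m)).2) ∨
      (∃ k, L * a.length ≤ (wordPow N a k (i', m')).2) ∨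
      ((∃ k, k % 2 = 1 ∧ wordPow N a k (i, m) = (i, m)) ∧
        ((∃ k, wordPow N a k (i, m) = (i', m')) ∨
          ∃ k, ¬ (wordPow N a k (i, m) = (i, m) ↔ wordPow N a k (i', m') = (i', m'))))

/-- The permutation represented by `l` conjugates `a` to `b`. Above the heights tested both sides
act rigidly. -/
def CodedConj (n p N : ℕ) (a b : GenWord) (l : List Letter) : Prop :=
  ForallBelow N fun i => ForallBelow (listHeight l + a.length + b.length + 1) fun m =>
    listEval n p l (wordEval N a (i, m)) = wordEval N b (listEval n p l (i, m))

/-- The last clause of `OddCertificate` for the translation vector coded by `u`, where the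
translations are measured at height `K`. -/
def CodedTranslationEq (n p : ℕ) (x : GenWord) (l l' : List Letter) (K β u : ℕ) : Prop :=
  ForallBelow (n * p) fun i =>
    (listEval n p l (i, K)).2 + β + 2 * K = (wordEval (n * p) x (i, K)).2 +
      digitAt (2 * β + 1) u i + 2 * (listEval (n * p) 1 l' (i, K)).2

/-- `OddCertificate` for the translation vector coded by `u`, with the permutations `y` and `c`
represented by lists of letters. -/
def CodedOdd (n p : ℕ) (a b x : GenWord) (L β u : ℕ) : Prop :=
  (n < 3 ∨ p % 2 = 0) ∧ CodedRigid (n * p) a L ∧ ∃ l l' : List Letter,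
    swapCount n p l % 2 = 1 ∧ CodedConj n p (n * p) a b l ∧ CodedConj (n * p) 1 (n * p) a a l' ∧
    CodedTranslationEq n p x l l' (listHeight l + listHeight l' + x.length) β u

section Computability

variable {α : Type*} [Primcodable α] {n p N L β u : α → ℕ} {a b x : α → GenWord}

@[fun_prop]
theorem isSearchable_codedRigid (hN : Primrec N) (ha : Primrec a) (hL : Primrec L) :
    IsSearchable fun q => CodedRigid (N q) (a q) (L q) := by
  unfold CodedRigid
  fun_prop

@[fun_prop]
theorem isSearchable_codedConj {l : α → List Letter} (hn : Primrec n) (hp : Primrec p)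
    (hN : Primrec N) (ha : Primrec a) (hb : Primrec b) (hl : Primrec l) :
    IsSearchable fun q => CodedConj (n q) (p q) (N q) (a q) (b q) (l q) := by
  unfold CodedConj
  fun_prop

@[fun_prop]
theorem isSearchable_codedOdd (hn : Primrec n) (hp : Primrec p) (ha : Primrec a) (hb : Primrec b)
    (hx : Primrec x) (hL : Primrec L) (hβ : Primrec β) (hu : Primrec u) :
    IsSearchable fun q => CodedOdd (n q) (p q) (a q) (b q) (x q) (L q) (β q) (u q) := by
  unfold CodedOdd CodedTranslationEq
  fun_prop

end Computability

theorem codedRigid_iff {N : ℕ} (hN : 2 ≤ N) (a : GenWord) (L : ℕ) :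
    CodedRigid N a L ↔ HasRigidOrbits (a.toPerm hN) (L * a.length)
      (translationAt (a.toPerm hN ^ L) (L * a.length)) := by
  have hr := represents_wordPow hN a
  have hheight (k : ℕ) (i : Fin N) (m : ℕ) :
      (wordPow N a k (i, m)).2 = ((a.toPerm hN ^ k) (i, m)).2 := by
    rw [(hr k).apply]
  have heq (k : ℕ) (i i' : Fin N) (m m' : ℕ) :
      wordPow N a k (i, m) = (↑i', m') ↔ (a.toPerm hN ^ k) (i, m) = (i', m') :=
    (hr k).apply_eq_iff (z := (i, m)) (z' := (i', m'))
  refine and_congr (forallBelow_iff.trans (forall_congr' (driftHeight_ne_iff hN a L))) ?_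
  simp only [forallBelow_iff (N := N), ForallBelow.eq_def (L * a.length), hheight, heq,
    Prod.forall, Nat.odd_iff]
  exact ⟨fun h i m i' m' hm => h i m hm i' m', fun h i m hm i' m' => h i m i' m' hm⟩

theorem codedConj_iff {n p N : ℕ} (hN : 2 ≤ N) (a b : GenWord) {l : List Letter}
    {y : Perm (RaySpace N)} (hy : Represents (listEval n p l) y)
    (hrigid : RigidFrom (listHeight l) y) :
    CodedConj n p N a b l ↔ y * a.toPerm hN = b.toPerm hN * y := by
  have hya := hy.mul (represents_wordEval hN a)
  have hby := (represents_wordEval hN b).mul hy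
  rw [CodedConj, forallBelow_pointCode_iff (q := fun z =>
    listEval n p l (wordEval N a z) = wordEval N b (listEval n p l z))]
  constructor
  · intro h
    refine RigidFrom.ext (M := listHeight l + a.length + b.length)
      ((hrigid.mul (a.rigidFrom_toPerm hN)).mono (by omega))
      (((b.rigidFrom_toPerm hN).mul hrigid).mono (by omega)) fun i m hm => pointCode_injective ?_
    rw [← hya, ← hby]
    exact h (i, m) (by omega)
  · intro h z _
    exact (hya z).trans (h ▸ (hby z).symm)

theorem codedTranslationEq_iff {n p : ℕ} (hN : 2 ≤ n * p) {x : GenWord} {l l' : List Letter}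
    {y c : Perm (RaySpace (n * p))} (hy : Represents (listEval n p l) y)
    (hc : Represents (listEval (n * p) 1 l') c) {K β u : ℕ} :
    CodedTranslationEq n p x l l' K β u ↔ ∀ i, translationAt y K i =
      translationAt (x.toPerm hN) K i + codedVector (n * p) β u i + 2 * translationAt c K i := by
  rw [CodedTranslationEq, forallBelow_iff]
  refine forall_congr' fun i => ?_
  rw [hy.apply, hc.apply, (represents_wordEval hN x).apply]
  simp only [translationAt, codedVector]
  omega

variable {n p : ℕ}

theorem RigidFrom.of_represents_listEval (hn : 2 ≤ n) (hp : 1 ≤ p) {l : List Letter}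
    {y : Perm (RaySpace (n * p))} (hy : Represents (listEval n p l) y) :
    RigidFrom (listHeight l) y := by
  obtain ⟨g, hg, -, hrigid⟩ := exists_represents_listEval hn hp l
  exact hy.unique hg ▸ hrigid

theorem codedTranslationEq_iff_of_translatesBy (hN : 2 ≤ n * p) {x : GenWord} {l l' : List Letter}
    {y c : Perm (RaySpace (n * p))} (hy : Represents (listEval n p l) y)
    (hyr : RigidFrom (listHeight l) y) (hc : Represents (listEval (n * p) 1 l') c)
    (hcr : RigidFrom (listHeight l') c) {tx ty tc : Fin (n * p) → ℤ} {β u : ℕ}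
    (htx : TranslatesBy (x.toPerm hN) tx) (hty : TranslatesBy y ty) (htc : TranslatesBy c tc) :
    CodedTranslationEq n p x l l' (listHeight l + listHeight l' + x.length) β u ↔
      ∀ i, ty i = tx i + codedVector (n * p) β u i + 2 * tc i := by
  rw [codedTranslationEq_iff hN hy hc, hyr.translationAt_eq hty (by omega),
    hcr.translationAt_eq htc (by omega), (x.rigidFrom_toPerm hN).translationAt_eq htx (by omega)]

theorem codedOdd_iff (hn : 2 ≤ n) (hp : 1 ≤ p) (a b : GenWord) {x : GenWord}
    {tx : Fin (n * p) → ℤ} (htx : TranslatesBy (x.toPerm (two_le_mul_of hn hp)) tx) (L β u : ℕ) :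
    CodedOdd n p a b x L β u ↔
      OddCertificate hn hp (a.toPerm (two_le_mul_of hn hp)) (b.toPerm (two_le_mul_of hn hp))
        (L * a.length) (translationAt (a.toPerm (two_le_mul_of hn hp) ^ L) (L * a.length)) tx
        (codedVector (n * p) β u) := by
  have hN := two_le_mul_of hn hp
  have hodd : n < 3 ∨ p % 2 = 0 ↔ ¬ (3 ≤ n ∧ Odd p) := by
    rw [Nat.odd_iff]
    omega
  refine and_congr hodd (and_congr (codedRigid_iff hN a L) ⟨?_, ?_⟩)
  · rintro ⟨l, l', hl, hconj, hcomm, htrans⟩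
    obtain ⟨y, hy, hpar, hyr⟩ := exists_represents_listEval hn hp l
    obtain ⟨c, hcH, hc, hcr⟩ := exists_mem_houghton_represents hN (mul_one _) l'
    obtain ⟨k, hk⟩ := hpar.exists_block_translatesBy
    obtain ⟨tc, htc⟩ := mem_houghton_iff.1 hcH
    rw [← Nat.odd_iff, ← ZMod.natCast_eq_one_iff_odd] at hl
    exact ⟨y, c, hl ▸ hpar, (codedConj_iff hN a b hy hyr).1 hconj,
      (codedConj_iff hN a a hc hcr).1 hcomm, _, tc, hk, htc,
      (codedTranslationEq_iff_of_translatesBy hN hy hyr hc hcr htx hk htc).1 htrans⟩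
  · rintro ⟨y, c, hpar, hconj, hcomm, ty, tc, hty, htc, htrans⟩
    obtain ⟨l, hl, hy⟩ := hpar.exists_listEval
    obtain ⟨l', hc⟩ := exists_listEval_of_mem_houghton hN (mul_one _)
      (mem_houghton_iff.2 ⟨tc, htc⟩)
    obtain ⟨c', -, hc', hcr⟩ := exists_mem_houghton_represents hN (mul_one _) l'
    obtain rfl := hc.unique hc'
    have hyr := RigidFrom.of_represents_listEval hn hp hy
    rw [ZMod.natCast_eq_one_iff_odd, Nat.odd_iff] at hl
    exact ⟨l, l', hl, (codedConj_iff hN a b hy hyr).2 hconj,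
      (codedConj_iff hN a a hc hcr).2 hcomm,
      (codedTranslationEq_iff_of_translatesBy hN hy hyr hc hcr htx hty htc).2 htrans⟩

end CodedOdd

section Decision

/-- A bound for the entries of the translation vectors that a certificate has to deal with. -/
def entryBound (N : ℕ) (a : GenWord) (L : ℕ) : ℕ :=
  N * N + 2 * ∑ i ∈ Finset.range N,
    ((driftHeight N a L i - L * a.length) + (L * a.length - driftHeight N a L i))

/-- A certificate that the elements are conjugate in `imageU`. -/
def CodedYes (n p : ℕ) (a b : GenWord) : Prop :=
  ∃ l : List Letter, (swapCount n p l % 2 = 0 ∨ 3 ≤ n ∧ p % 2 = 1) ∧ CodedConj n p (n * p) a b l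

/-- A certificate that the elements are not conjugate in `imageU`: a power of `a` that preserves
the rays, and a reason to exclude each bounded translation vector. -/
def CodedNo (n p : ℕ) (a b x : GenWord) : Prop :=
  ∃ L, 0 < L ∧ ForallBelow (n * p) (fun i => (wordPow (n * p) a L (i, L * a.length)).1 = i) ∧
    ForallBelow ((2 * entryBound (n * p) a L + 1) ^ (n * p)) fun u =>
      CodedInadmissible (n * p) a L (entryBound (n * p) a L) u ∨
      CodedDual n p a x L (entryBound (n * p) a L) u ∨
      CodedOdd n p a b x L (entryBound (n * p) a L) u

/-- A certificate that the input is not a valid one. -/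
def CodedInvalid (n p : ℕ) (a b x : GenWord) : Prop :=
  n < 2 ∨ p < 1 ∨ (∃ i, i < n * p ∧ (wordEval (n * p) x (i, x.length)).1 ≠ i) ∨
    ∃ z : ℕ × ℕ, z.1 < n * p ∧
      wordEval (n * p) x (wordEval (n * p) a z) ≠ wordEval (n * p) b (wordEval (n * p) x z)

section Computability

variable {α : Type*} [Primcodable α] {n p : α → ℕ} {a b x : α → GenWord}

@[fun_prop]
theorem isSearchable_codedYes (hn : Primrec n) (hp : Primrec p) (ha : Primrec a) (hb : Primrec b) :
    IsSearchable fun q => CodedYes (n q) (p q) (a q) (b q) := by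
  unfold CodedYes
  fun_prop

@[fun_prop]
theorem isSearchable_codedNo (hn : Primrec n) (hp : Primrec p) (ha : Primrec a) (hb : Primrec b)
    (hx : Primrec x) : IsSearchable fun q => CodedNo (n q) (p q) (a q) (b q) (x q) := by
  unfold CodedNo entryBound
  fun_prop

@[fun_prop]
theorem isSearchable_codedInvalid (hn : Primrec n) (hp : Primrec p) (ha : Primrec a)
    (hb : Primrec b) (hx : Primrec x) :
    IsSearchable fun q => CodedInvalid (n q) (p q) (a q) (b q) (x q) := by
  unfold CodedInvalid
  fun_prop

theorem exists_computable_of_isSearchable {q r : α → Prop} (hq : IsSearchable q)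
    (hr : IsSearchable r) (h : ∀ a, q a ∨ r a) :
    ∃ f : α → Bool, Computable f ∧ ∀ a, (f a = true → q a) ∧ (f a = false → r a) := by
  classical
  obtain ⟨Q, hQ, hq⟩ := hq
  obtain ⟨R, hR, hr⟩ := hr
  have hex (a) : ∃ k, Q (a, k) ∨ R (a, k) := by
    rw [exists_or, ← hq, ← hr]
    exact h a
  have hfind : Computable fun a => Nat.find (hex a) := by
    have hrfind : Partrec fun a =>
        Nat.rfind fun k => Part.some (decide (Q (a, k) ∨ R (a, k))) :=
      Partrec.rfind (hQ.or hR).decide.to_comp.partrec.to₂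
    exact hrfind.of_eq_tot fun a => Nat.mem_rfind.2 ⟨by simpa using Nat.find_spec (hex a),
      fun {m} hm => by simpa using Nat.find_min (hex a) hm⟩
  refine ⟨fun a => decide (Q (a, Nat.find (hex a))),
    hQ.decide.to_comp.comp (Computable.id.pair hfind), fun a => ⟨fun hd => ?_, fun hd => ?_⟩⟩
  · exact (hq a).2 ⟨_, of_decide_eq_true hd⟩
  · exact (hr a).2 ⟨_, (Nat.find_spec (hex a)).resolve_left (of_decide_eq_false hd)⟩

end Computability

theorem two_mul_natAbs_translationAt_le {N : ℕ} (hN : 2 ≤ N) (a : GenWord) (L : ℕ) (i : Fin N) :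
    2 * (translationAt (a.toPerm hN ^ L) (L * a.length) i).natAbs ≤ entryBound N a L := by
  have hle := natAbs_le_sum (translationAt (a.toPerm hN ^ L) (L * a.length)) i
  have hsum : ∑ i ∈ Finset.range N,
      ((driftHeight N a L i - L * a.length) + (L * a.length - driftHeight N a L i)) =
      ∑ i, (translationAt (a.toPerm hN ^ L) (L * a.length) i).natAbs := by
    rw [Finset.sum_range]
    refine Finset.sum_congr rfl fun i _ => ?_
    have := driftHeight_eq hN a L i
    omega
  rw [entryBound, hsum]
  omega

theorem conjugatesTo_iff {α : Type*} {x a b : Perm α} : ConjugatesTo x a b ↔ x * a = b * x := by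
  have : (x.symm.trans a).trans x = x * a * x⁻¹ := rfl
  rw [ConjugatesTo, this, mul_inv_eq_iff_eq_mul]

variable {n p : ℕ} (hn : 2 ≤ n) (hp : 1 ≤ p) (a b x : GenWord)

theorem codedYes_iff : CodedYes n p a b ↔
    ∃ y ∈ imageU hn hp, y * a.toPerm (two_le_mul_of hn hp) =
      b.toPerm (two_le_mul_of hn hp) * y := by
  constructor
  · rintro ⟨l, hl, hconj⟩
    obtain ⟨y, hy, hpar, hyr⟩ := exists_represents_listEval hn hp l
    rw [← Nat.even_iff, ← ZMod.natCast_eq_zero_iff_even, ← Nat.odd_iff] at hl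
    exact ⟨y, mem_imageU_iff.2 ⟨_, hpar, hl⟩, (codedConj_iff _ a b hy hyr).1 hconj⟩
  · rintro ⟨y, hyU, hconj⟩
    obtain ⟨e, hpar, he⟩ := mem_imageU_iff.1 hyU
    obtain ⟨l, rfl, hy⟩ := hpar.exists_listEval
    rw [ZMod.natCast_eq_zero_iff_even, Nat.even_iff, Nat.odd_iff] at he
    exact ⟨l, he, (codedConj_iff _ a b hy (.of_represents_listEval hn hp hy)).2 hconj⟩

variable {hn hp a b x}

theorem forallBelow_certificate_iff (hx : x.toPerm (two_le_mul_of hn hp) ∈ houghton (n * p))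
    (hconj : x.toPerm (two_le_mul_of hn hp) * a.toPerm (two_le_mul_of hn hp) =
      b.toPerm (two_le_mul_of hn hp) * x.toPerm (two_le_mul_of hn hp)) {L : ℕ} (hL : 0 < L)
    (hray : ∀ i, ((a.toPerm (two_le_mul_of hn hp) ^ L) (i, L * a.length)).1 = i) :
    (ForallBelow ((2 * entryBound (n * p) a L + 1) ^ (n * p)) fun u =>
      CodedInadmissible (n * p) a L (entryBound (n * p) a L) u ∨
      CodedDual n p a x L (entryBound (n * p) a L) u ∨
      CodedOdd n p a b x L (entryBound (n * p) a L) u) ↔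
    ¬ ∃ y ∈ imageU hn hp, y * a.toPerm (two_le_mul_of hn hp) =
      b.toPerm (two_le_mul_of hn hp) * y := by
  have hN := two_le_mul_of hn hp
  obtain ⟨tx, htx⟩ := mem_houghton_iff.1 hx
  have ha := a.rigidFrom_toPerm hN
  have hB : n * p * (n * p) ≤ entryBound (n * p) a L := Nat.le_add_right _ _
  have htx' := (x.rigidFrom_toPerm hN).translationAt_eq htx le_rfl
  rw [← forall_certificate_iff ha ((ha.pow L).translatesFrom hray) hL hB
    (two_mul_natAbs_translationAt_le hN a L) hconj htx]
  refine forallBelow_codedVector_iff fun u => or_congr (codedInadmissible_iff hN a L _ u)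
    (or_congr ?_ (codedOdd_iff hn hp a b htx L _ u))
  rw [codedDual_iff hN, htx']

theorem codedNo_iff (hx : x.toPerm (two_le_mul_of hn hp) ∈ houghton (n * p))
    (hconj : x.toPerm (two_le_mul_of hn hp) * a.toPerm (two_le_mul_of hn hp) =
      b.toPerm (two_le_mul_of hn hp) * x.toPerm (two_le_mul_of hn hp)) :
    CodedNo n p a b x ↔ ¬ ∃ y ∈ imageU hn hp, y * a.toPerm (two_le_mul_of hn hp) =
      b.toPerm (two_le_mul_of hn hp) * y := by
  have hN := two_le_mul_of hn hp
  have hray (L : ℕ) : ForallBelow (n * p)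
      (fun i => (wordPow (n * p) a L (i, L * a.length)).1 = i) ↔
      ∀ i, ((a.toPerm hN ^ L) (i, L * a.length)).1 = i := by
    rw [forallBelow_iff]
    refine forall_congr' fun i => ?_
    rw [(represents_wordPow hN a L).apply, Fin.ext_iff]
  constructor
  · rintro ⟨L, hL, hLray, hcert⟩
    exact (forallBelow_certificate_iff hx hconj hL ((hray L).1 hLray)).1 hcert
  · intro hno
    obtain ⟨L, hL, hLray⟩ := (a.rigidFrom_toPerm hN).exists_pow_fst_apply_eq
    exact ⟨L, hL, (hray L).2 hLray, (forallBelow_certificate_iff hx hconj hL hLray).2 hno⟩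

theorem mem_houghton_toPerm_iff {N : ℕ} (hN : 2 ≤ N) (x : GenWord) :
    x.toPerm hN ∈ houghton N ↔ ∀ i : Fin N, (wordEval N x (i, x.length)).1 = i := by
  have hx := x.rigidFrom_toPerm hN
  simp only [(represents_wordEval hN x).apply, Fin.val_inj]
  constructor
  · intro h i
    obtain ⟨t, ht⟩ := mem_houghton_iff.1 h
    exact (hx.translatesFrom_of_translatesBy ht i _ le_rfl).1
  · exact fun h => mem_houghton_iff.2 ⟨_, (hx.translatesFrom h).translatesBy⟩

theorem codedInvalid_iff : CodedInvalid n p a b x ↔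
    ¬ (x.toPerm (two_le_mul_of hn hp) ∈ houghton (n * p) ∧
      x.toPerm (two_le_mul_of hn hp) * a.toPerm (two_le_mul_of hn hp) =
        b.toPerm (two_le_mul_of hn hp) * x.toPerm (two_le_mul_of hn hp)) := by
  have hN := two_le_mul_of hn hp
  have hxa := (represents_wordEval hN x).mul (represents_wordEval hN a)
  have hbx := (represents_wordEval hN b).mul (represents_wordEval hN x)
  have hconj : x.toPerm hN * a.toPerm hN = b.toPerm hN * x.toPerm hN ↔
      ∀ z : RaySpace (n * p), wordEval (n * p) x (wordEval (n * p) a (pointCode z)) =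
        wordEval (n * p) b (wordEval (n * p) x (pointCode z)) := by
    rw [Equiv.ext_iff]
    refine forall_congr' fun z => pointCode_injective.eq_iff.symm.trans ?_
    rw [← hxa z, ← hbx z]
    rfl
  have hn' : ¬ n < 2 := by omega
  have hp' : ¬ p < 1 := by omega
  rw [CodedInvalid, mem_houghton_toPerm_iff hN, hconj, not_and_or, not_forall, not_forall,
    exists_pointCode_iff]
  simp only [hn', hp', false_or, Fin.exists_iff, exists_prop]

theorem codedYes_or_codedNo_or_codedInvalid (n p : ℕ) (a b x : GenWord) :
    CodedYes n p a b ∨ CodedNo n p a b x ∨ CodedInvalid n p a b x := by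
  by_cases hn : 2 ≤ n
  · by_cases hp : 1 ≤ p
    · have hyes := codedYes_iff hn hp a b
      have hno := codedNo_iff (hn := hn) (hp := hp) (a := a) (b := b) (x := x)
      have hinvalid := codedInvalid_iff (hn := hn) (hp := hp) (a := a) (b := b) (x := x)
      tauto
    · exact .inr (.inr (.inr (.inl (by omega))))
  · exact .inr (.inr (.inl (by omega)))

end Decision

theorem mainTheorem8 :
    ∃ decideConj : ℕ × ℕ × GenWord × GenWord × GenWord → Bool,
      Computable decideConj ∧
      ∀ (n p : ℕ) (hn : 2 ≤ n) (hp : 1 ≤ p) (a b x : GenWord),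
        x.toPerm (two_le_mul_of hn hp) ∈ houghton (n * p) →
        ConjugatesTo (x.toPerm (two_le_mul_of hn hp)) (a.toPerm (two_le_mul_of hn hp))
          (b.toPerm (two_le_mul_of hn hp)) →
        (decideConj (n, p, a, b, x) = true ↔
          ∃ y ∈ imageU hn hp, ConjugatesTo y (a.toPerm (two_le_mul_of hn hp))
            (b.toPerm (two_le_mul_of hn hp))) := by
  obtain ⟨f, hf, hcert⟩ := exists_computable_of_isSearchable
    (q := fun z : ℕ × ℕ × GenWord × GenWord × GenWord => CodedYes z.1 z.2.1 z.2.2.1 z.2.2.2.1)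
    (r := fun z => CodedNo z.1 z.2.1 z.2.2.1 z.2.2.2.1 z.2.2.2.2 ∨
      CodedInvalid z.1 z.2.1 z.2.2.1 z.2.2.2.1 z.2.2.2.2) (by fun_prop) (by fun_prop)
    fun _ => codedYes_or_codedNo_or_codedInvalid ..
  refine ⟨f, hf, fun n p hn hp a b x hx hconj => ?_⟩
  simp only [conjugatesTo_iff] at hconj ⊢
  obtain ⟨hyes, hno⟩ := hcert (n, p, a, b, x)
  refine ⟨fun h => (codedYes_iff hn hp a b).1 (hyes h), fun hy => ?_⟩
  by_contra h
  rcases hno (by simpa using h) with h' | h'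
  · exact (codedNo_iff hx hconj).1 h' hy
  · exact (codedInvalid_iff (hn := hn) (hp := hp)).1 h' ⟨hx, hconj⟩
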